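/- Let $p,q\ge 2$ be integers and $\beta>0$, $h\ge 0$. For $N\ge 1$ let $\boldsymbol X=(X_1,\dots,X_N)\in\{1,\dots,q\}^N$ have the tensor Curie–Weiss Potts law $$\mathbb P_{\beta,h,N}(\boldsymbol X)=\frac{1}{q^N Z_N(\beta,h)}\exp\Big(\beta N\sum_{r=1}^q \bar X_{\cdot r}^{\,p}+Nh\bar X_{\cdot 1}\Big),\qquad \bar X_{\cdot r}=\frac1N\#\{i: X_i=r\},$$ with $Z_N(\beta,h)$ the normalizing constant, and let $\bar{\boldsymbol X}_N=(\bar X_{\cdot1},\dots,\bar X_{\cdot q})$. On the set $\mathcal P_q$ of $q$-dimensional probability vectors put $H_{\beta,h}(\boldsymbol t)=\beta\sum_r t_r^p+ht_1-\sum_r t_r\log t_r$. Let $\mathcal H_q=\{\boldsymbol t\in\mathbb R^q:\sum_r t_r=0\}$, $\boldsymbol u=(1-q,1,\dots,1)$, and $\boldsymbol x_s=\big(\tfrac{1+(q-1)s}{q},\tfrac{1-s}{q},\dots,\tfrac{1-s}{q}\big)$. Assume that $(\beta,h)$ is a type-I special point, that is: $H_{\beta,h}$ has a unique global maximizer $\boldsymbol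 m_*$ on $\mathcal P_q$, $\boldsymbol m_*=\boldsymbol x_s$ with $s\in[0,1)$; the quadratic form $\boldsymbol t\mapsto\sum_r\big(\beta p(p-1)m_{*,r}^{p-2}-1/m_{*,r}\big)t_r^2$ restricted to $\mathcal H_q$ is singular; and the fourth derivative of $s'\mapsto H_{\beta,h}(\boldsymbol x_{s'})$ at $s$ is negative. Write, uniquely, $$\bar{\boldsymbol X}_N-\boldsymbol m_*=N^{-1/4}T_N\boldsymbol u+N^{-1/2}\boldsymbol V_N,\qquad T_N\in\mathbb R,\quad \boldsymbol V_N\in\mathcal H_q\cap\operatorname{Span}(\boldsymbol u)^\perp .$$ (1) One has $\mathbb E T_N^4>0$ for every $N\ge1$. Let $Z_{T_N}$ have density proportional to $\exp\big(-x^4/(4\,\mathbb E T_N^4)\big)$ on $\mathbb R$. There is a constant $C>0$ depending only on $\beta,h,p,q$ such that for all $N\ge1$ and every $1$-Lipschitz $g:\mathbb R\to\mathbb R$, $g(Z_{T_N})$ is integrable and $$|\mathbb E g(T_N)-\mathbb E g(Z_{T_N})|\le \frac{C}{N^{1/4}},\qquad\text{and}\qquad \sup_{t\in\mathbb R}|\mathbb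 P(T_N\le t)-\mathbb P(Z_{T_N}\le t)|\le\frac{C}{N^{1/4}} .$$ (2) Let $\Sigma=\Sigma_N=\mathbb E[\boldsymbol V_N\boldsymbol V_N^{\top}]$ and let $\boldsymbol Z$ be standard normal in $\mathbb R^q$. For every three times differentiable $g:\mathbb R^q\to\mathbb R$ whose derivatives of orders $1,2,3$ are bounded there is a constant $C>0$ depending only on $\beta,h,p,q,g$ such that for all $N\ge1$, $g(\Sigma^{1/2}\boldsymbol Z)$ is integrable and $$|\mathbb E g(\boldsymbol V_N)-\mathbb E g(\Sigma^{1/2}\boldsymbol Z)|\le\frac{C}{N^{1/4}} .$$ (3) For $g:\mathbb R^q\to\mathbb R$ and $\delta>0$ put $g_\delta^+(x)=\sup_{|y|\le\delta}g(x+y)$ and $g_\delta^-(x)=\inf_{|y|\le\delta}g(x+y)$. Let $\mathcal G$ be a class of real measurable functions on $\mathbb R^q$ such that: (i) $|g|\le M$ for all $g\in\mathcal G$; (ii) $x\mapsto g(Ax+b)$ is in $\mathcal G$ for all $g\in\mathcal G$, all $q\times q$ matrices $A$ and all $b\in\mathbb R^q$; (iii) $g_\delta^{+},g_\delta^{-}\in\mathcal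 G$ for all $g\in\mathcal G$, $\delta>0$; (iv) $\int(g_\delta^+-g_\delta^-)(x)\,\phi(x)\,dx\le c\,\delta$ for all $g\in\mathcal G$, $\delta>0$, where $\phi$ is the standard normal density on $\mathbb R^q$. Then there is a constant $D>0$, depending only on $\beta,h,p,q$ and on the constants $M,c$ of the class, such that for all $N\ge2$ $$\sup_{g\in\mathcal G}|\mathbb E g(\boldsymbol V_N)-\mathbb E g(\Sigma^{1/2}\boldsymbol Z)|\le\frac{D\log N}{N^{1/4}} .$$ -/

import Mathlib

open MeasureTheory ProbabilityTheory

noncomputable section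

namespace CWPotts

/-! ### The tensor Curie-Weiss Potts model -/

/-- The Kronecker symbol `δ_{r,1}`: the first colour is the index `0` of `Fin q`. -/
def firstColor {q : ℕ} (r : Fin q) : ℝ := if (r : ℕ) = 0 then 1 else 0

/-- The magnetization vector of a configuration: the vector of the proportions of the colours. -/
def magnetization {N q : ℕ} (x : Fin N → Fin q) : EuclideanSpace ℝ (Fin q) :=
  WithLp.toLp 2 fun r => ((Finset.univ.filter fun i => x i = r).card : ℝ) / N

/-- The exponent `β N ∑ᵣ X̄ᵣᵖ + N h X̄₁` of the model. -/
def exponent (p : ℕ) (β h : ℝ) {N q : ℕ} (x : Fin N → Fin q) : ℝ :=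
  β * N * ∑ r, magnetization x r ^ p + N * h * ∑ r, firstColor r * magnetization x r

/-- The normalizing constant `Z_N(β, h)`. -/
def partitionFn (p q N : ℕ) (β h : ℝ) : ℝ :=
  ((q : ℝ) ^ N)⁻¹ * ∑ x : Fin N → Fin q, Real.exp (exponent p β h x)

/-- The probability of a configuration. -/
def gibbs (p : ℕ) (β h : ℝ) {N q : ℕ} (x : Fin N → Fin q) : ℝ :=
  1 / ((q : ℝ) ^ N * partitionFn p q N β h) * Real.exp (exponent p β h x)

/-- The expectation of a function of the configuration. -/
def expect (p : ℕ) (β h : ℝ) {N q : ℕ} (F : (Fin N → Fin q) → ℝ) : ℝ :=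
  ∑ x, gibbs p β h x * F x

/-- The probability of an event. -/
def prob (p : ℕ) (β h : ℝ) {N q : ℕ} (A : Set (Fin N → Fin q)) : ℝ :=
  expect p β h (A.indicator 1)

/-! ### Type-I special points -/

/-- The set of `q`-dimensional probability vectors. -/
def probVectors (q : ℕ) : Set (EuclideanSpace ℝ (Fin q)) :=
  {t | (∀ r, 0 ≤ t r) ∧ ∑ r, t r = 1}

/-- The space of zero-sum vectors. -/
def zeroSum (q : ℕ) : Set (EuclideanSpace ℝ (Fin q)) := {t | ∑ r, t r = 0}

/-- The negative free energy. -/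
def negFreeEnergy (p : ℕ) (β h : ℝ) {q : ℕ} (t : EuclideanSpace ℝ (Fin q)) : ℝ :=
  β * ∑ r, t r ^ p + h * ∑ r, firstColor r * t r - ∑ r, t r * Real.log (t r)

def IsUniqueMaximizer (p : ℕ) (β h : ℝ) {q : ℕ} (m : EuclideanSpace ℝ (Fin q)) : Prop :=
  m ∈ probVectors q ∧
    ∀ t ∈ probVectors q, t ≠ m → negFreeEnergy p β h t < negFreeEnergy p β h m

/-- The bilinear form of the quadratic form
`Q_{v,β}(t) = ∑ᵣ (β p (p - 1) vᵣ^(p-2) - 1 / vᵣ) tᵣ²`. -/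
def hessForm (p : ℕ) (β : ℝ) {q : ℕ} (v t t' : EuclideanSpace ℝ (Fin q)) : ℝ :=
  ∑ r, (β * p * (p - 1) * v r ^ (p - 2) - 1 / v r) * (t r * t' r)

/-- The quadratic form `Q_{v,β}` is singular on the space of zero-sum vectors: its restriction to
that space has a nonzero kernel. (At a maximizer of the negative free energy the restriction is
negative semidefinite, so its kernel consists of the zero-sum `t` with `Q_{v,β}(t) = 0`.) -/
def IsSingularOnZeroSum (p : ℕ) (β : ℝ) {q : ℕ} (v : EuclideanSpace ℝ (Fin q)) : Prop :=
  ∃ t ∈ zeroSum q, t ≠ 0 ∧ ∀ t' ∈ zeroSum q, hessForm p β v t t' = 0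

/-- The vector `x_s = ((1 + (q-1)s)/q, (1-s)/q, …, (1-s)/q)`. -/
def xs (q : ℕ) (s : ℝ) : EuclideanSpace ℝ (Fin q) :=
  WithLp.toLp 2 fun r => if (r : ℕ) = 0 then (1 + (q - 1) * s) / q else (1 - s) / q

/-- The point `(β, h)` is type-I special, and `x_s`, `0 ≤ s < 1`, is the unique maximizer of the
negative free energy. -/
structure IsTypeISpecial (p q : ℕ) (β h s : ℝ) : Prop where
  nonneg : 0 ≤ s
  lt_one : s < 1
  isUniqueMaximizer : IsUniqueMaximizer p β h (xs q s)
  isSingular : IsSingularOnZeroSum p β (xs q s)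
  fourth_deriv_neg : iteratedDeriv 4 (fun s' => negFreeEnergy p β h (xs q s')) s < 0

/-! ### The decomposition of the centred magnetization vector -/

/-- The vector `u = (1 - q, 1, …, 1)`. -/
def uVec (q : ℕ) : EuclideanSpace ℝ (Fin q) :=
  WithLp.toLp 2 fun r => if (r : ℕ) = 0 then 1 - (q : ℝ) else 1

/-- The coefficient `T_N` in `X̄_N - m = N^(-1/4) T_N u + N^(-1/2) V_N`. -/
def TN {N q : ℕ} (m : EuclideanSpace ℝ (Fin q)) (x : Fin N → Fin q) : ℝ :=
  (N : ℝ) ^ (1 / 4 : ℝ) * (inner ℝ (uVec q) (magnetization x - m) / ‖uVec q‖ ^ 2)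

/-- The transverse part `V_N` in `X̄_N - m = N^(-1/4) T_N u + N^(-1/2) V_N`. -/
def VN {N q : ℕ} (m : EuclideanSpace ℝ (Fin q)) (x : Fin N → Fin q) :
    EuclideanSpace ℝ (Fin q) :=
  (N : ℝ) ^ (1 / 2 : ℝ) •
    (magnetization x - m - ((N : ℝ) ^ (-1 / 4 : ℝ) * TN m x) • uVec q)

/-- The fourth moment `E[T_N⁴]`. -/
def fourthMoment (p : ℕ) (β h : ℝ) (N : ℕ) {q : ℕ} (m : EuclideanSpace ℝ (Fin q)) : ℝ :=
  expect p β h fun x : Fin N → Fin q => TN m x ^ 4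

/-- The matrix `Σ = E[V_N V_Nᵀ]`. -/
def covMatrix (p : ℕ) (β h : ℝ) (N : ℕ) {q : ℕ} (m : EuclideanSpace ℝ (Fin q)) :
    Matrix (Fin q) (Fin q) ℝ :=
  Matrix.of fun i j => expect p β h fun x : Fin N → Fin q => VN m x i * VN m x j

theorem sum_magnetization {N q : ℕ} (hN : 1 ≤ N) (x : Fin N → Fin q) :
    ∑ r, magnetization x r = 1 := by
  have h : ∑ r, (Finset.univ.filter fun i => x i = r).card = N := by
    have := Finset.card_eq_sum_card_fiberwise (f := x) (s := Finset.univ) (t := Finset.univ)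
      (fun _ _ => Finset.mem_coe.2 (Finset.mem_univ _))
    simpa using this.symm
  have hN' : (N : ℝ) ≠ 0 := by positivity
  simp only [magnetization]
  rw [← Finset.sum_div, ← Nat.cast_sum, h, div_self hN']

theorem sum_uVec {q : ℕ} (hq : 2 ≤ q) : ∑ r, uVec q r = 0 := by
  obtain ⟨k, rfl⟩ : ∃ k, q = k + 1 := ⟨q - 1, by omega⟩
  simp [uVec, Fin.sum_univ_succ]

theorem uVec_ne_zero {q : ℕ} (hq : 2 ≤ q) : uVec q ≠ 0 := by
  intro h
  have := congrArg (fun v : EuclideanSpace ℝ (Fin q) => v ⟨1, by omega⟩) h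
  simp [uVec] at this

/-- `T_N` and `V_N` are the unique coefficients of the decomposition
`X̄_N - m = N^(-1/4) T_N u + N^(-1/2) V_N` with `V_N` zero-sum and orthogonal to `u`. -/
theorem decomposition {N q : ℕ} (hN : 1 ≤ N) (hq : 2 ≤ q) {m : EuclideanSpace ℝ (Fin q)}
    (hm : ∑ r, m r = 1) (x : Fin N → Fin q) (T : ℝ) (V : EuclideanSpace ℝ (Fin q)) :
    (magnetization x - m =
        ((N : ℝ) ^ (-1 / 4 : ℝ) * T) • uVec q + (N : ℝ) ^ (-1 / 2 : ℝ) • V ∧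
      V ∈ zeroSum q ∧ inner ℝ (uVec q) V = 0) ↔ T = TN m x ∧ V = VN m x := by
  have hN0 : (0 : ℝ) < N := by positivity
  have h4 : (N : ℝ) ^ (1 / 4 : ℝ) * (N : ℝ) ^ (-1 / 4 : ℝ) = 1 := by
    rw [← Real.rpow_add hN0]; norm_num
  have h2 : (N : ℝ) ^ (1 / 2 : ℝ) * (N : ℝ) ^ (-1 / 2 : ℝ) = 1 := by
    rw [← Real.rpow_add hN0]; norm_num
  have hu : ‖uVec q‖ ^ 2 ≠ 0 := by
    have := norm_ne_zero_iff.2 (uVec_ne_zero hq)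
    positivity
  constructor
  · rintro ⟨hd, -, hV⟩
    have hT : T = TN m x := by
      rw [TN, hd, inner_add_right, inner_smul_right, inner_smul_right, hV,
        real_inner_self_eq_norm_sq, mul_zero, add_zero, mul_div_assoc, div_self hu, mul_one,
        ← mul_assoc, h4, one_mul]
    refine ⟨hT, ?_⟩
    rw [VN, ← hT, hd, add_sub_cancel_left, smul_smul, h2, one_smul]
  · rintro ⟨rfl, rfl⟩
    refine ⟨?_, ?_, ?_⟩
    · rw [VN, smul_smul, mul_comm ((N : ℝ) ^ (-1 / 2 : ℝ)), h2, one_smul, add_sub_cancel]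
    · have h1 := sum_magnetization hN x
      have h3 := sum_uVec hq
      simp only [zeroSum, Set.mem_ofPred_eq, VN, PiLp.smul_apply, PiLp.sub_apply, smul_eq_mul]
      rw [← Finset.mul_sum, Finset.sum_sub_distrib, Finset.sum_sub_distrib, ← Finset.mul_sum,
        h1, h3, hm]
      ring
    · rw [VN, inner_smul_right, inner_sub_right, inner_smul_right, real_inner_self_eq_norm_sq, TN,
        ← mul_assoc, mul_comm ((N : ℝ) ^ (-1 / 4 : ℝ)), h4, one_mul, div_mul_cancel₀ _ hu,
        sub_self, mul_zero]

/-! ### The limiting law of the longitudinal part -/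

/-- The law on `ℝ` with density proportional to `exp (-x⁴ / (4 a))`. -/
def quarticLaw (a : ℝ) : Measure ℝ :=
  volume.withDensity fun x =>
    ENNReal.ofReal (Real.exp (-x ^ 4 / (4 * a)) / ∫ y : ℝ, Real.exp (-y ^ 4 / (4 * a)))

theorem integrable_exp_quartic {a : ℝ} (ha : 0 < a) :
    Integrable fun y : ℝ => Real.exp (-y ^ 4 / (4 * a)) := by
  have hb : 0 < 1 / (4 * a) := by positivity
  have h := ((integrable_exp_neg_mul_sq (b := 2 * (1 / (4 * a))) (by positivity)).const_mul
    (Real.exp (1 / (4 * a))))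
  refine h.mono' (by fun_prop) (Filter.Eventually.of_forall fun y => ?_)
  rw [Real.norm_eq_abs, abs_of_pos (Real.exp_pos _), ← Real.exp_add]
  refine Real.exp_le_exp.2 ?_
  have h1 : 0 ≤ (1 / (4 * a)) * (y ^ 2 - 1) ^ 2 := by positivity
  have h2 : -y ^ 4 / (4 * a) = -(y ^ 4) * (1 / (4 * a)) := by ring
  rw [h2]
  nlinarith [h1]

theorem isProbabilityMeasure_quarticLaw {a : ℝ} (ha : 0 < a) :
    IsProbabilityMeasure (quarticLaw a) := by
  have hi := integrable_exp_quartic ha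
  have hpos : 0 < ∫ y : ℝ, Real.exp (-y ^ 4 / (4 * a)) := integral_exp_pos hi
  constructor
  rw [quarticLaw, withDensity_apply _ MeasurableSet.univ, Measure.restrict_univ,
    ← ofReal_integral_eq_lintegral_ofReal (hi.div_const _)
      (Filter.Eventually.of_forall fun x => by positivity),
    integral_div, div_self hpos.ne', ENNReal.ofReal_one]

/-! ### Test functions for the transverse part -/

/-- A three times differentiable function whose derivatives of orders one, two and three are
bounded, i.e. `|g|_1, |g|_2, |g|_3 < ∞`. -/
def IsThriceDiffTest {d : ℕ} (g : EuclideanSpace ℝ (Fin d) → ℝ) : Prop :=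
  (∀ k < 3, Differentiable ℝ (iteratedFDeriv ℝ k g)) ∧
    ∃ K : ℝ, ∀ k ∈ Finset.Icc 1 3, ∀ x, ‖iteratedFDeriv ℝ k g x‖ ≤ K

/-- `g_δ^+(x) = sup {g (x + y) : |y| ≤ δ}`. -/
def upperEnv {d : ℕ} (g : EuclideanSpace ℝ (Fin d) → ℝ) (δ : ℝ) (x : EuclideanSpace ℝ (Fin d)) :
    ℝ :=
  sSup ((fun y => g (x + y)) '' {y | ‖y‖ ≤ δ})

/-- `g_δ^-(x) = inf {g (x + y) : |y| ≤ δ}`. -/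
def lowerEnv {d : ℕ} (g : EuclideanSpace ℝ (Fin d) → ℝ) (δ : ℝ) (x : EuclideanSpace ℝ (Fin d)) :
    ℝ :=
  sInf ((fun y => g (x + y)) '' {y | ‖y‖ ≤ δ})

/-- `𝒢` is a class of measurable test functions on `ℝ^d`, uniformly bounded by `M`, invariant under
affine changes of the variable and under `g ↦ g_δ^±`, and such that the Gaussian mean of the
oscillation `g_δ^+ - g_δ^-` is at most `c δ`. -/
structure IsTestClass {d : ℕ} (𝒢 : Set (EuclideanSpace ℝ (Fin d) → ℝ)) (M c : ℝ) : Prop where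
  measurable : ∀ g ∈ 𝒢, Measurable g
  bounded : ∀ g ∈ 𝒢, ∀ x, |g x| ≤ M
  affine : ∀ g ∈ 𝒢, ∀ (A : Matrix (Fin d) (Fin d) ℝ) (b : EuclideanSpace ℝ (Fin d)),
    (fun x => g (Matrix.toEuclideanCLM (𝕜 := ℝ) A x + b)) ∈ 𝒢
  upper_mem : ∀ g ∈ 𝒢, ∀ δ > 0, upperEnv g δ ∈ 𝒢
  lower_mem : ∀ g ∈ 𝒢, ∀ δ > 0, lowerEnv g δ ∈ 𝒢
  oscillation : ∀ g ∈ 𝒢, ∀ δ > 0,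
    ∫ x, (upperEnv g δ x - lowerEnv g δ x) ∂(stdGaussian (EuclideanSpace ℝ (Fin d))) ≤ c * δ

end CWPotts

end

open CWPotts

/-! The proof is a local limit theorem with a rate, followed by a matching of moments.

Write `q = d + 1` and `ρ = N^(1/4)`. Only the vector of counts matters. The probability of a vector
of counts `k` is, up to a factor depending on `N` alone, a product of Stirling prefactors times `exp
(N (H(k/N) - H(m_*)))`; this is exact (`multinomial_mul_exp`, `expect_comp_counts`). The counts of
the last `d` colours parametrize the lattice. Centred and divided by `ρ^3` along their mean and by
`ρ^2` across it, they become a point `ζ` of `ℝ^d` with `T_N = avg ζ` and `V_N = (0, dev ζ)`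
(`TN_VN_eq`).

Transversally to `u` the Hessian of `H` at `m_*` is negative definite (`colorEnergy₂_lowProp_neg`),
so the singularity lies along `u`. There the first three derivatives vanish and the fourth is
negative. A mixed term such as `τ² ν` would survive the scaling, but all colours other than the
first have equal proportions along `x_s`, so terms linear in the zero-sum vector `ν` cancel exactly.
Hence `N (H - H(m_*))` equals `-κ T⁴ - (b/2) ‖V‖²` up to `1/ρ` times a polynomial
(`exists_energy_expansion`, `exists_log_latticeWeight_near`). Away from `m_*` the weights are
exponentially small by compactness. Spreading each weight over a cell turns lattice sums into
integrals, and the resulting step density differs from a multiple of `exp (-κ avg⁴ - (b/2) ‖dev‖²)`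
by at most `(C/ρ) exp (-c ‖ζ‖²)` (`exists_stepWeight_approx`). Under the limiting measure
`refMeasure`, `avg` has a quartic law and `dev` is Gaussian (`map_avg_refMeasure`,
`map_transverse_refMeasure`).

The laws to be compared with carry the moments of the model at size `N`, not the limiting ones. The
quartic law with parameter `a` has fourth moment `a`, and by symmetry between the colours other than
the first, `Σ_N` is a multiple of a fixed projection. Thus the targets are again marginals of some
`refMeasure d κ' b'`. The local limit theorem applied to the moments gives `|κ' - κ| + |b' - b| =
O(1/ρ)`, and the density is Lipschitz in its parameters (`exists_matched_comparison`).

What is left is the mean change of the test function when `ζ` is rounded to a lattice point, which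
is `O(1/ρ)` in each case: by the Lipschitz property, by boundedness of the quartic density for
half-lines, and by the oscillation condition for a test class. For smooth test functions only the
first derivative is used, and for test classes the bound holds without a logarithm. The finitely
many small `N` are absorbed into the constants. -/

noncomputable section

namespace CWPotts

/-! ### Counting configurations -/

/-- The vector of the numbers of spins of each colour. -/
def counts {N q : ℕ} (x : Fin N → Fin q) (r : Fin q) : ℕ :=
  (Finset.univ.filter fun i => x i = r).card

theorem sum_counts {N q : ℕ} (x : Fin N → Fin q) : ∑ r, counts x r = N := by
  have := Finset.card_eq_sum_card_fiberwise (f := x) (s := Finset.univ) (t := Finset.univ)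
    (fun _ _ => Finset.mem_coe.2 (Finset.mem_univ _))
  simpa [counts] using this.symm

theorem counts_mem {N q : ℕ} (x : Fin N → Fin q) :
    counts x ∈ Finset.piAntidiag Finset.univ N := by
  simp [Finset.mem_piAntidiag, sum_counts]

/-- Expanding the `N`-th power of a sum of commuting variables over words and by the multinomial
theorem gives two expressions; the coefficients of the monomial with exponent `k` are compared. -/
theorem card_counts_eq {N q : ℕ} {k : Fin q → ℕ} (hk : k ∈ Finset.piAntidiag Finset.univ N) :
    (Finset.univ.filter fun x : Fin N → Fin q => counts x = k).card =
      Nat.multinomial Finset.univ k := by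
  have h1 : (∑ r : Fin q, (MvPolynomial.X r : MvPolynomial (Fin q) ℕ)) ^ N =
      ∑ x : Fin N → Fin q, MvPolynomial.monomial (Finsupp.equivFunOnFinite.symm (counts x)) 1 := by
    have h0 : (∑ r : Fin q, (MvPolynomial.X r : MvPolynomial (Fin q) ℕ)) ^ N =
        ∏ _i : Fin N, ∑ r : Fin q, MvPolynomial.X r := by simp
    rw [h0, Finset.prod_univ_sum, Fintype.piFinset_univ]
    refine Finset.sum_congr rfl fun x _ => ?_
    rw [MvPolynomial.monomial_eq, MvPolynomial.C_1, one_mul,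
      ← Finset.prod_fiberwise Finset.univ x (fun i => (MvPolynomial.X (x i)))]
    rw [Finsupp.prod_fintype _ _ (by simp)]
    refine Finset.prod_congr rfl fun r _ => ?_
    rw [Finset.prod_congr rfl (g := fun _ => MvPolynomial.X r)
      (fun i hi => by rw [(Finset.mem_filter.1 hi).2])]
    simp [counts]
  have h2 := h1.symm.trans (Finset.sum_pow_eq_sum_piAntidiag Finset.univ
    (fun r : Fin q => (MvPolynomial.X r : MvPolynomial (Fin q) ℕ)) N)
  have h3 := congrArg (MvPolynomial.coeff (Finsupp.equivFunOnFinite.symm k)) h2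
  have hmon : ∀ l : Fin q → ℕ, (Nat.multinomial Finset.univ l : MvPolynomial (Fin q) ℕ) *
      ∏ r, MvPolynomial.X r ^ l r =
      MvPolynomial.monomial (Finsupp.equivFunOnFinite.symm l) (Nat.multinomial Finset.univ l) := by
    intro l
    rw [MvPolynomial.monomial_eq, Finsupp.prod_fintype _ _ (by simp)]
    simp
  simp only [hmon, MvPolynomial.coeff_sum, MvPolynomial.coeff_monomial,
    EmbeddingLike.apply_eq_iff_eq] at h3
  rw [Finset.sum_ite_eq' , if_pos hk] at h3
  rw [Finset.card_filter]
  simpa using h3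

/-- The vector of the proportions associated with a vector of counts. -/
def proportions (N : ℕ) {q : ℕ} (k : Fin q → ℕ) : EuclideanSpace ℝ (Fin q) :=
  WithLp.toLp 2 fun r => (k r : ℝ) / N

theorem proportions_counts {N q : ℕ} (x : Fin N → Fin q) :
    proportions N (counts x) = magnetization x := rfl

/-- The Stirling ratio `(k / e)^k / k!`. -/
def stirlingRatio (k : ℕ) : ℝ := ((k : ℝ) / Real.exp 1) ^ k / k.factorial

/-- The weight of a vector of counts, normalized so that it is of order one at `N m`. -/
def latticeWeight (p : ℕ) (β h : ℝ) (N : ℕ) {q : ℕ} (m : EuclideanSpace ℝ (Fin q))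
    (k : Fin q → ℕ) : ℝ :=
  (∏ r, stirlingRatio (k r) * √N) *
    Real.exp (N * (negFreeEnergy p β h (proportions N k) - negFreeEnergy p β h m))

theorem stirlingRatio_pos (k : ℕ) : 0 < stirlingRatio k := by
  rcases Nat.eq_zero_or_pos k with rfl | hk
  · simp [stirlingRatio]
  · have : (0 : ℝ) < k := by exact_mod_cast hk
    unfold stirlingRatio
    positivity

theorem latticeWeight_pos (p : ℕ) (β h : ℝ) {N : ℕ} (hN : 1 ≤ N) {q : ℕ}
    (m : EuclideanSpace ℝ (Fin q)) (k : Fin q → ℕ) : 0 < latticeWeight p β h N m k := by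
  have : (0 : ℝ) < N := by exact_mod_cast hN
  exact mul_pos (Finset.prod_pos fun r _ => mul_pos (stirlingRatio_pos _) (Real.sqrt_pos.2 this))
    (Real.exp_pos _)

/-- For `k = 0` the conventions `0 log 0 = 0` and `0 ^ 0 = 1` make both sides equal to one, so
boundary points of the simplex need no separate treatment later. -/
theorem exp_neg_mul_log_div {N : ℕ} (hN : 1 ≤ N) (k : ℕ) :
    Real.exp (-(N * ((k : ℝ) / N * Real.log ((k : ℝ) / N)))) = (N : ℝ) ^ k / (k : ℝ) ^ k := by
  have hN0 : (0 : ℝ) < N := by exact_mod_cast hN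
  rcases Nat.eq_zero_or_pos k with rfl | hk
  · simp
  · have hk0 : (0 : ℝ) < k := by exact_mod_cast hk
    rw [← div_pow, ← Real.exp_log (show (0 : ℝ) < (N : ℝ) / k by positivity), ← Real.exp_nat_mul,
      Real.log_div hN0.ne' hk0.ne', Real.log_div hk0.ne' hN0.ne']
    congr 1
    field_simp
    ring

/-- An identity, not an asymptotic formula: the error in Stirling's formula for each `k r` stays
inside `stirlingRatio`. The bracketed factor does not depend on `k` and cancels in expectations. -/
theorem multinomial_mul_exp {p : ℕ} {β h : ℝ} {N q : ℕ} (hN : 1 ≤ N)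
    (m : EuclideanSpace ℝ (Fin q)) {k : Fin q → ℕ} (hk : ∑ r, k r = N) :
    (Nat.multinomial Finset.univ k : ℝ) *
      Real.exp (β * N * ∑ r, proportions N k r ^ p + N * h * ∑ r, firstColor r * proportions N k r)
    = (N.factorial * Real.exp N / (N : ℝ) ^ N / (√N) ^ q * Real.exp (N * negFreeEnergy p β h m)) *
      latticeWeight p β h N m k := by
  have hN0 : (0 : ℝ) < N := by exact_mod_cast hN
  have hs : (0 : ℝ) < √N := Real.sqrt_pos.2 hN0
  have hm : (Nat.multinomial Finset.univ k : ℝ) = N.factorial / ∏ r, ((k r).factorial : ℝ) := by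
    have := Nat.multinomial_spec Finset.univ k
    rw [hk] at this
    rw [eq_div_iff (by positivity), mul_comm]
    exact_mod_cast this
  have he : Real.exp (-∑ r, N * (proportions N k r * Real.log (proportions N k r))) =
      ∏ r, (N : ℝ) ^ k r / (k r : ℝ) ^ k r := by
    rw [← Finset.sum_neg_distrib, Real.exp_sum]
    exact Finset.prod_congr rfl fun r _ => exp_neg_mul_log_div hN (k r)
  have hL : latticeWeight p β h N m k = (∏ r, stirlingRatio (k r) * √N) *
      (Real.exp (β * N * ∑ r, proportions N k r ^ p + N * h * ∑ r, firstColor r * proportions N k r) *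
        (∏ r, (N : ℝ) ^ k r / (k r : ℝ) ^ k r)) / Real.exp (N * negFreeEnergy p β h m) := by
    rw [latticeWeight, ← he, ← Real.exp_add, mul_div_assoc, ← Real.exp_sub]
    congr 2
    simp only [negFreeEnergy, ← Finset.mul_sum]
    ring
  have hp : (∏ r, stirlingRatio (k r) * √N) * (∏ r, (N : ℝ) ^ k r / (k r : ℝ) ^ k r) =
      (√N) ^ q * (N : ℝ) ^ N / Real.exp N / ∏ r, ((k r).factorial : ℝ) := by
    have hN1 : (N : ℝ) ^ N = ∏ r, (N : ℝ) ^ k r := by rw [Finset.prod_pow_eq_pow_sum, hk]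
    have hN2 : Real.exp N = ∏ r, Real.exp 1 ^ k r := by
      rw [Finset.prod_pow_eq_pow_sum, hk, ← Real.exp_nat_mul, mul_one]
    have hN3 : (√N) ^ q = ∏ _r : Fin q, √N := by simp
    rw [hN1, hN2, hN3, ← Finset.prod_mul_distrib, ← Finset.prod_mul_distrib,
      ← Finset.prod_div_distrib, ← Finset.prod_div_distrib]
    refine Finset.prod_congr rfl fun r _ => ?_
    have hkr : (k r : ℝ) ^ k r ≠ 0 := by
      rcases Nat.eq_zero_or_pos (k r) with h0 | h0
      · simp [h0]
      · positivity
    rw [stirlingRatio, div_pow]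
    field_simp
  rw [hL, hm]
  have e1 := (Real.exp_pos (N * negFreeEnergy p β h m)).ne'
  have e2 : (∏ r, ((k r).factorial : ℝ)) ≠ 0 := by positivity
  rw [show ∀ a b c d : ℝ, a * (b * c) / d = (a * c) * b / d by intros; ring, hp]
  field_simp

theorem sum_exp_exponent {p : ℕ} {β h : ℝ} {N q : ℕ} (hN : 1 ≤ N)
    (m : EuclideanSpace ℝ (Fin q)) (G : (Fin q → ℕ) → ℝ) :
    ∑ x : Fin N → Fin q, Real.exp (exponent p β h x) * G (counts x) =
    (N.factorial * Real.exp N / (N : ℝ) ^ N / (√N) ^ q * Real.exp (N * negFreeEnergy p β h m)) *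
      ∑ k ∈ Finset.piAntidiag Finset.univ N, latticeWeight p β h N m k * G k := by
  rw [← Finset.sum_fiberwise_of_maps_to (fun x _ => counts_mem x), Finset.mul_sum]
  refine Finset.sum_congr rfl fun k hk => ?_
  have hk' : ∑ r, k r = N := by simpa [Finset.mem_piAntidiag] using hk
  rw [← mul_assoc, ← multinomial_mul_exp hN m hk', ← card_counts_eq hk]
  rw [Finset.sum_congr rfl (g := fun _ => Real.exp (β * N * ∑ r, proportions N k r ^ p +
    N * h * ∑ r, firstColor r * proportions N k r) * G k)]
  · rw [Finset.sum_const, nsmul_eq_mul]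
    ring
  · intro x hx
    rw [← (Finset.mem_filter.1 hx).2, proportions_counts, exponent]

theorem piAntidiag_univ_nonempty {N q : ℕ} (hq : q ≠ 0) :
    (Finset.piAntidiag (Finset.univ : Finset (Fin q)) N).Nonempty :=
  ⟨_, counts_mem fun _ => ⟨0, Nat.pos_of_ne_zero hq⟩⟩

/-- The reference point `m` is arbitrary: changing it multiplies all the weights by one constant,
which the quotient removes. -/
theorem expect_comp_counts {p : ℕ} {β h : ℝ} {N q : ℕ} (hN : 1 ≤ N) (hq : q ≠ 0)
    (m : EuclideanSpace ℝ (Fin q)) (G : (Fin q → ℕ) → ℝ) :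
    (expect p β h fun x : Fin N → Fin q => G (counts x)) =
      (∑ k ∈ Finset.piAntidiag Finset.univ N, latticeWeight p β h N m k * G k) /
        ∑ k ∈ Finset.piAntidiag Finset.univ N, latticeWeight p β h N m k := by
  have hN0 : (0 : ℝ) < N := by exact_mod_cast hN
  have hs : (0 : ℝ) < √N := Real.sqrt_pos.2 hN0
  have hq0 : (0 : ℝ) < q := by exact_mod_cast Nat.pos_of_ne_zero hq
  have hA := sum_exp_exponent (p := p) (β := β) (h := h) hN m G
  have hB := sum_exp_exponent (p := p) (β := β) (h := h) hN m (fun _ => 1)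
  simp only [mul_one] at hB
  have hpos : 0 < ∑ k ∈ Finset.piAntidiag Finset.univ N, latticeWeight p β h N m k :=
    Finset.sum_pos (fun k _ => latticeWeight_pos p β h hN m k) (piAntidiag_univ_nonempty hq)
  set K := N.factorial * Real.exp N / (N : ℝ) ^ N / (√N) ^ q * Real.exp (N * negFreeEnergy p β h m)
  have hK : 0 < K := by positivity
  have hg : ∀ x : Fin N → Fin q, gibbs p β h x * G (counts x) =
      (Real.exp (exponent p β h x) * G (counts x)) /
        (K * ∑ k ∈ Finset.piAntidiag Finset.univ N, latticeWeight p β h N m k) := by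
    intro x
    rw [gibbs, partitionFn, hB, ← mul_assoc ((q : ℝ) ^ N), mul_inv_cancel₀ (by positivity), one_mul]
    ring
  rw [expect, Finset.sum_congr rfl fun x _ => hg x, ← Finset.sum_div, hA]
  field_simp

theorem gibbs_nonneg {p : ℕ} {β h : ℝ} {N q : ℕ} (x : Fin N → Fin q) : 0 ≤ gibbs p β h x := by
  unfold gibbs partitionFn
  have : 0 ≤ ∑ x : Fin N → Fin q, Real.exp (exponent p β h x) :=
    Finset.sum_nonneg fun _ _ => (Real.exp_pos _).le
  positivity

theorem sum_gibbs {p : ℕ} {β h : ℝ} {N q : ℕ} (hN : 1 ≤ N) (hq : q ≠ 0) :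
    ∑ x : Fin N → Fin q, gibbs p β h x = 1 := by
  have h1 := expect_comp_counts (p := p) (β := β) (h := h) hN hq 0 (fun _ => 1)
  simp only [expect, mul_one] at h1
  rw [h1, div_self]
  exact (Finset.sum_pos (fun k _ => latticeWeight_pos p β h hN 0 k)
    (piAntidiag_univ_nonempty hq)).ne'

theorem gibbs_pos {p : ℕ} {β h : ℝ} {N q : ℕ} (hq : q ≠ 0) (x : Fin N → Fin q) :
    0 < gibbs p β h x := by
  unfold gibbs partitionFn
  have hq0 : (0 : ℝ) < q := by exact_mod_cast Nat.pos_of_ne_zero hq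
  have : 0 < ∑ x : Fin N → Fin q, Real.exp (exponent p β h x) :=
    Finset.sum_pos (fun _ _ => Real.exp_pos _) ⟨x, Finset.mem_univ x⟩
  positivity

/-! ### Stirling's formula -/

/-- The one-step bound `1 / (12 n (n + 1))` telescopes. Letting `j` tend to infinity gives the upper
bound in Stirling's formula with error `1 / (12 n)`. -/
theorem log_stirlingSeq_sub_le (n j : ℕ) (hn : 1 ≤ n) :
    Real.log (Stirling.stirlingSeq n) - Real.log (Stirling.stirlingSeq (n + j)) ≤
      1 / (12 * n) - 1 / (12 * (n + j)) := by
  have hn0 : (0 : ℝ) < n := by exact_mod_cast hn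
  induction j with
  | zero => simp
  | succ j ih =>
    have h1 := Stirling.log_stirlingSeq_sdiff_le (n + j)
    have h2 : 1 / (12 * ((n + j : ℕ) : ℝ) * (((n + j : ℕ) : ℝ) + 1)) =
        1 / (12 * (n + j)) - 1 / (12 * (n + (j + 1 : ℕ))) := by
      push_cast
      field_simp
      ring
    rw [h2] at h1
    have h3 : n + (j + 1) = n + j + 1 := by ring
    rw [h3]
    linarith

theorem log_stirlingSeq_bounds {n : ℕ} (hn : 1 ≤ n) :
    Real.log √Real.pi ≤ Real.log (Stirling.stirlingSeq n) ∧
      Real.log (Stirling.stirlingSeq n) ≤ Real.log √Real.pi + 1 / (12 * n) := by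
  have hn0 : (0 : ℝ) < n := by exact_mod_cast hn
  constructor
  · exact Real.log_le_log (by positivity) (Stirling.sqrt_pi_le_stirlingSeq (by omega))
  · have ht : Filter.Tendsto (fun j : ℕ => Real.log (Stirling.stirlingSeq (n + j))) Filter.atTop
        (nhds (Real.log √Real.pi)) := by
      refine (Real.continuousAt_log (by positivity)).tendsto.comp
        (Stirling.tendsto_stirlingSeq_sqrt_pi.comp ?_)
      exact Filter.tendsto_atTop_mono (fun j => Nat.le_add_left j n) Filter.tendsto_id
    have := le_of_tendsto' (ht.const_sub (Real.log (Stirling.stirlingSeq n)))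
      (fun j => (log_stirlingSeq_sub_le n j hn).trans
        (sub_le_self _ (by positivity : (0 : ℝ) ≤ 1 / (12 * (n + j)))))
    linarith

theorem stirlingRatio_eq {n : ℕ} (hn : 1 ≤ n) :
    Real.log (stirlingRatio n) =
      -Real.log (Stirling.stirlingSeq n) - Real.log (2 * n) / 2 := by
  have hn0 : (0 : ℝ) < n := by exact_mod_cast hn
  rw [Stirling.log_stirlingSeq_formula, stirlingRatio, Real.log_div (by positivity) (by positivity),
    Real.log_pow]
  ring

/-- This crude bound serves far from the maximizer, where some counts may be small or zero and the
asymptotic form of the prefactor is not available. -/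
theorem stirlingRatio_le_one (n : ℕ) : stirlingRatio n ≤ 1 := by
  rcases Nat.eq_zero_or_pos n with rfl | hn
  · simp [stirlingRatio]
  · have hn0 : (1 : ℝ) ≤ n := by exact_mod_cast hn
    rw [← Real.log_nonpos_iff (stirlingRatio_pos n).le, stirlingRatio_eq hn]
    have h1 := (log_stirlingSeq_bounds hn).1
    have h2 : 0 ≤ Real.log √Real.pi :=
      Real.log_nonneg (by rw [Real.one_le_sqrt]; linarith [Real.pi_gt_three])
    have h3 : 0 ≤ Real.log (2 * n) := Real.log_nonneg (by linarith)
    linarith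

/-- Stirling's formula for the prefactor of a single colour. -/
theorem abs_log_stirlingRatio_mul_sqrt_sub_le {N n : ℕ} (hN : 1 ≤ N) (hn : 1 ≤ n) :
    |Real.log (stirlingRatio n * √N) + Real.log (2 * Real.pi * (n / N)) / 2| ≤ 1 / (12 * n) := by
  have hn0 : (0 : ℝ) < n := by exact_mod_cast hn
  have hN0 : (0 : ℝ) < N := by exact_mod_cast hN
  have hpi := Real.pi_pos
  obtain ⟨h1, h2⟩ := log_stirlingSeq_bounds hn
  rw [Real.log_mul (stirlingRatio_pos n).ne' (Real.sqrt_pos.2 hN0).ne', stirlingRatio_eq hn,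
    Real.log_sqrt hN0.le,
    show 2 * Real.pi * ((n : ℝ) / N) = (2 * n) * Real.pi / N by ring,
    Real.log_div (by positivity) (by positivity), Real.log_mul (by positivity) hpi.ne']
  rw [Real.log_sqrt hpi.le] at h1 h2
  rw [abs_le]
  constructor <;> linarith [show (0 : ℝ) ≤ 1 / (12 * n) by positivity]

/-! ### Taylor expansions -/

theorem AnalyticAt.exists_taylor_bound {f : ℝ → ℝ} {x : ℝ} (hf : AnalyticAt ℝ f x) (n : ℕ) :
    ∃ C > 0, ∃ η > 0, ∀ y, |y| ≤ η →
      |f (x + y) - ∑ k ∈ Finset.range n, iteratedDeriv k f x / k.factorial * y ^ k| ≤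
        C * |y| ^ n := by
  have h := hf.hasFPowerSeriesAt.isBigO_sub_partialSum_pow n
  obtain ⟨C, hC, hb⟩ := h.exists_pos
  rw [Asymptotics.isBigOWith_iff] at hb
  obtain ⟨η, hη, hball⟩ := Metric.eventually_nhds_iff.1 hb
  refine ⟨C, hC, η / 2, by positivity, fun y hy => ?_⟩
  have := hball (y := y) (by rw [Real.dist_eq, sub_zero]; linarith)
  simpa [FormalMultilinearSeries.partialSum, FormalMultilinearSeries.ofScalars_apply_eq, mul_comm]
    using this

/-- A function whose expansion starts with a cubic term has no local maximum. -/
theorem eq_zero_of_cubic_le {a C η : ℝ} (hη : 0 < η)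
    (h : ∀ y, |y| ≤ η → a * y ^ 3 ≤ C * |y| ^ 4) : a = 0 := by
  have key : ∀ y, 0 < y → y ≤ η → |a| ≤ C * y := by
    intro y hy hyη
    have h1 := h y (by rwa [abs_of_pos hy])
    have h2 := h (-y) (by rwa [abs_neg, abs_of_pos hy])
    rw [abs_neg] at h2
    rw [abs_of_pos hy] at h1 h2
    have hy3 : 0 < y ^ 3 := by positivity
    have h3 : |a| * y ^ 3 ≤ C * y * y ^ 3 := by
      rcases abs_cases a with ⟨e, -⟩ | ⟨e, -⟩ <;> rw [e] <;> nlinarith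
    exact le_of_mul_le_mul_right h3 hy3
  have hlim : Filter.Tendsto (fun y : ℝ => C * y) (nhdsWithin 0 (Set.Ioi 0)) (nhds 0) := by
    have : Filter.Tendsto (fun y : ℝ => C * y) (nhds 0) (nhds (C * 0)) :=
      (continuous_const.mul continuous_id).tendsto 0
    rw [mul_zero] at this
    exact this.mono_left nhdsWithin_le_nhds
  have : |a| ≤ 0 := by
    refine ge_of_tendsto hlim ?_
    filter_upwards [Ioc_mem_nhdsGT hη] with y hy
    exact key y hy.1 hy.2
  exact abs_nonpos_iff.1 this

theorem nonpos_of_quadratic_le {a C η : ℝ} (hη : 0 < η)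
    (h : ∀ y, |y| ≤ η → a * y ^ 2 ≤ C * |y| ^ 3) : a ≤ 0 := by
  have hlim : Filter.Tendsto (fun y : ℝ => C * y) (nhdsWithin 0 (Set.Ioi 0)) (nhds 0) := by
    have : Filter.Tendsto (fun y : ℝ => C * y) (nhds 0) (nhds (C * 0)) :=
      (continuous_const.mul continuous_id).tendsto 0
    rw [mul_zero] at this
    exact this.mono_left nhdsWithin_le_nhds
  refine ge_of_tendsto hlim ?_
  filter_upwards [Ioc_mem_nhdsGT hη] with y hy
  have h1 := h y (by rw [abs_of_pos hy.1]; exact hy.2)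
  rw [abs_of_pos hy.1] at h1
  have hy2 : 0 < y ^ 2 := pow_pos hy.1 2
  exact le_of_mul_le_mul_right (by linarith [h1, show C * y * y ^ 2 = C * y ^ 3 by ring]) hy2

theorem IsLocalMax.iteratedDeriv_two_nonpos {f : ℝ → ℝ} {x : ℝ} (hf : AnalyticAt ℝ f x)
    (hmax : IsLocalMax f x) : iteratedDeriv 2 f x ≤ 0 := by
  obtain ⟨C, -, η, hη, hb⟩ := AnalyticAt.exists_taylor_bound hf 3
  obtain ⟨ε, hε, hball⟩ := Metric.eventually_nhds_iff.1 hmax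
  have h1 : iteratedDeriv 1 f x = 0 := by rw [iteratedDeriv_one]; exact hmax.deriv_eq_zero
  have : iteratedDeriv 2 f x / 2 ≤ 0 := by
    refine nonpos_of_quadratic_le (C := C) (η := min η (ε / 2)) (by positivity) fun y hy => ?_
    have h2 := (abs_le.1 (hb y (hy.trans (min_le_left _ _)))).1
    have h3 := hball (y := x + y)
      (by rw [Real.dist_eq, add_sub_cancel_left]; linarith [hy.trans (min_le_right η (ε / 2))])
    simp [Finset.sum_range_succ, h1] at h2
    linarith
  linarith

/-- Once the first two derivatives vanish, the maximality leaves a cubic term dominated by a quartic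
one for both signs of the increment. -/
theorem IsLocalMax.iteratedDeriv_three_eq_zero {f : ℝ → ℝ} {x : ℝ} (hf : AnalyticAt ℝ f x)
    (hmax : IsLocalMax f x) (h2 : iteratedDeriv 2 f x = 0) : iteratedDeriv 3 f x = 0 := by
  obtain ⟨C, -, η, hη, hb⟩ := AnalyticAt.exists_taylor_bound hf 4
  obtain ⟨ε, hε, hball⟩ := Metric.eventually_nhds_iff.1 hmax
  have h1 : iteratedDeriv 1 f x = 0 := by rw [iteratedDeriv_one]; exact hmax.deriv_eq_zero
  have : iteratedDeriv 3 f x / (Nat.factorial 3) = 0 := by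
    refine eq_zero_of_cubic_le (C := C) (η := min η (ε / 2)) (by positivity) fun y hy => ?_
    have h2' := (abs_le.1 (hb y (hy.trans (min_le_left _ _)))).1
    have h3 := hball (y := x + y)
      (by rw [Real.dist_eq, add_sub_cancel_left]; linarith [hy.trans (min_le_right η (ε / 2))])
    simp only [Finset.sum_range_succ, h1, h2] at h2'
    simp at h2'
    linarith
  have h6 : ((Nat.factorial 3 : ℕ) : ℝ) ≠ 0 := by positivity
  simpa [h6] using this

/-! ### The single-colour free energy -/

/-- The contribution of one colour to the negative free energy at zero field. -/
def colorEnergy (p : ℕ) (β x : ℝ) : ℝ := β * x ^ p - x * Real.log x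

def colorEnergy₁ (p : ℕ) (β x : ℝ) : ℝ := β * p * x ^ (p - 1) - Real.log x - 1

def colorEnergy₂ (p : ℕ) (β x : ℝ) : ℝ := β * p * (p - 1) * x ^ (p - 2) - 1 / x

/-- For `p = 2` the coefficient `p - 2` vanishes, so the truncated exponent `p - 2 - 1` has no
effect. -/
def colorEnergy₃ (p : ℕ) (β x : ℝ) : ℝ :=
  β * p * (p - 1) * ((p - 2 : ℕ) * x ^ (p - 2 - 1)) + 1 / x ^ 2

theorem hasDerivAt_colorEnergy (p : ℕ) (β : ℝ) {x : ℝ} (hx : 0 < x) :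
    HasDerivAt (colorEnergy p β) (colorEnergy₁ p β x) x := by
  have h := ((hasDerivAt_pow p x).const_mul β).sub
    ((hasDerivAt_id x).mul (Real.hasDerivAt_log hx.ne'))
  refine h.congr_deriv ?_
  simp only [colorEnergy₁, id]
  field_simp
  ring

theorem hasDerivAt_colorEnergy₁ {p : ℕ} (hp : 2 ≤ p) (β : ℝ) {x : ℝ} (hx : 0 < x) :
    HasDerivAt (colorEnergy₁ p β) (colorEnergy₂ p β x) x := by
  have h := (((hasDerivAt_pow (p - 1) x).const_mul (β * p)).sub
    (Real.hasDerivAt_log hx.ne')).sub_const 1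
  refine h.congr_deriv ?_
  rw [colorEnergy₂, Nat.cast_sub (by omega), Nat.sub_sub]
  push_cast
  ring

theorem hasDerivAt_colorEnergy₂ (p : ℕ) (β : ℝ) {x : ℝ} (hx : 0 < x) :
    HasDerivAt (colorEnergy₂ p β) (colorEnergy₃ p β x) x := by
  have h := ((hasDerivAt_pow (p - 2) x).const_mul (β * p * (p - 1))).sub
    (hasDerivAt_inv hx.ne')
  refine (h.congr_of_eventuallyEq ?_).congr_deriv ?_
  · exact Filter.Eventually.of_forall fun y => by simp [colorEnergy₂]
  · simp [colorEnergy₃]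

theorem analyticAt_colorEnergy (p : ℕ) (β : ℝ) {x : ℝ} (hx : 0 < x) :
    AnalyticAt ℝ (colorEnergy p β) x :=
  (analyticAt_const.mul (analyticAt_id.pow p)).sub (analyticAt_id.mul (analyticAt_log hx))

/-- The expansion of the single-colour energy with the quadratic coefficient frozen at `x`. -/
theorem exists_colorEnergy_expansion {p : ℕ} (hp : 2 ≤ p) (β : ℝ) {x : ℝ} (hx : 0 < x) :
    ∃ C > 0, ∃ η > 0, ∀ τ ν, |τ| ≤ η → |ν| ≤ η →
      |colorEnergy p β (x + τ + ν) - colorEnergy p β (x + τ) - colorEnergy₁ p β (x + τ) * ν -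
        colorEnergy₂ p β x / 2 * ν ^ 2| ≤ C * (|τ| + |ν|) * ν ^ 2 := by
  obtain ⟨C, hC, hb⟩ := ((hasDerivAt_colorEnergy₂ p β hx).differentiableAt.isBigO_sub).exists_pos
  rw [Asymptotics.isBigOWith_iff] at hb
  obtain ⟨ε, hε, hball⟩ := Metric.eventually_nhds_iff.1 hb
  -- The bound `ε / 3` keeps `x + τ + y` in the ball where the second derivative is controlled; the
  -- bound `x / 3` keeps it positive.
  refine ⟨C, hC, min (ε / 3) (x / 3), by positivity, fun τ ν hτ hν => ?_⟩
  have hτ1 := hτ.trans (min_le_left _ _)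
  have hτ2 := hτ.trans (min_le_right _ _)
  have hν1 := hν.trans (min_le_left _ _)
  have hν2 := hν.trans (min_le_right _ _)
  have hpos : ∀ y ∈ Set.Icc (-|ν|) |ν|, 0 < x + τ + y := by
    intro y hy
    linarith [hy.1, (abs_le.1 hτ2).1]
  have h0 : (0 : ℝ) ∈ Set.Icc (-|ν|) |ν| := ⟨by linarith [abs_nonneg ν], abs_nonneg ν⟩
  have hνm : ν ∈ Set.Icc (-|ν|) |ν| := ⟨neg_abs_le ν, le_abs_self ν⟩
  have hshift : ∀ y : ℝ, HasDerivAt (fun y => x + τ + y) 1 y := fun y =>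
    (hasDerivAt_id y).const_add _
  -- The mean value inequality is used twice: the bound on the variation of the second derivative
  -- yields the remainder of the first derivative, and that one yields the remainder of the
  -- function.
  have hd1 : ∀ y ∈ Set.Icc (-|ν|) |ν|,
      HasDerivWithinAt (fun y => colorEnergy₁ p β (x + τ + y) - colorEnergy₂ p β x * y)
        (colorEnergy₂ p β (x + τ + y) - colorEnergy₂ p β x) (Set.Icc (-|ν|) |ν|) y := by
    intro y hy
    have := ((hasDerivAt_colorEnergy₁ hp β (hpos y hy)).comp y (hshift y)).sub
      ((hasDerivAt_id y).const_mul (colorEnergy₂ p β x))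
    exact (this.congr_deriv (by simp)).hasDerivWithinAt
  have hb1 : ∀ y ∈ Set.Icc (-|ν|) |ν|,
      ‖colorEnergy₂ p β (x + τ + y) - colorEnergy₂ p β x‖ ≤ C * (|τ| + |ν|) := by
    intro y hy
    have hy' := abs_le.2 hy
    have h1 : |τ + y| ≤ |τ| + |ν| := (abs_add_le _ _).trans (by linarith)
    have := hball (y := x + τ + y)
      (by rw [Real.dist_eq, add_assoc, add_sub_cancel_left]; linarith)
    refine this.trans ?_
    rw [add_assoc, add_sub_cancel_left, Real.norm_eq_abs]
    exact mul_le_mul_of_nonneg_left h1 hC.le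
  have hg1 : ∀ y ∈ Set.Icc (-|ν|) |ν|,
      ‖colorEnergy₁ p β (x + τ + y) - colorEnergy₁ p β (x + τ) - colorEnergy₂ p β x * y‖ ≤
        C * (|τ| + |ν|) * |ν| := by
    intro y hy
    have := (convex_Icc (-|ν|) |ν|).norm_image_sub_le_of_norm_hasDerivWithin_le hd1 hb1 h0 hy
    simp only [add_zero, mul_zero, sub_zero] at this
    rw [sub_right_comm]
    refine this.trans (mul_le_mul_of_nonneg_left ?_ (by positivity))
    exact abs_le.2 hy
  have hd2 : ∀ y ∈ Set.Icc (-|ν|) |ν|,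
      HasDerivWithinAt (fun y => colorEnergy p β (x + τ + y) - colorEnergy₁ p β (x + τ) * y -
          colorEnergy₂ p β x / 2 * y ^ 2)
        (colorEnergy₁ p β (x + τ + y) - colorEnergy₁ p β (x + τ) - colorEnergy₂ p β x * y)
        (Set.Icc (-|ν|) |ν|) y := by
    intro y hy
    have := (((hasDerivAt_colorEnergy p β (hpos y hy)).comp y (hshift y)).sub
      ((hasDerivAt_id y).const_mul (colorEnergy₁ p β (x + τ)))).sub
      ((hasDerivAt_pow 2 y).const_mul (colorEnergy₂ p β x / 2))
    refine (this.congr_deriv ?_).hasDerivWithinAt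
    simp
    ring
  have h := (convex_Icc (-|ν|) |ν|).norm_image_sub_le_of_norm_hasDerivWithin_le hd2 hg1 h0 hνm
  simp only [add_zero, mul_zero, sub_zero, Real.norm_eq_abs] at h
  rw [show C * (|τ| + |ν|) * ν ^ 2 = C * (|τ| + |ν|) * |ν| * |ν| by rw [← sq_abs]; ring]
  convert h using 2
  ring

/-! ### The negative free energy near a type-I special point -/

/-- The proportion of the first colour in `x_s`. -/
def highProp (d : ℕ) (s : ℝ) : ℝ := (1 + d * s) / (d + 1)

/-- The common proportion of the other colours in `x_s`. -/
def lowProp (d : ℕ) (s : ℝ) : ℝ := (1 - s) / (d + 1)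

/-- The vector with first entry `a` and other entries `y`. -/
def colorVec {d : ℕ} (a : ℝ) (y : Fin d → ℝ) : EuclideanSpace ℝ (Fin (d + 1)) :=
  WithLp.toLp 2 (Fin.cons a y : Fin (d + 1) → ℝ)

@[simp] theorem colorVec_zero {d : ℕ} (a : ℝ) (y : Fin d → ℝ) : colorVec a y 0 = a := rfl

@[simp] theorem colorVec_succ {d : ℕ} (a : ℝ) (y : Fin d → ℝ) (i : Fin d) :
    colorVec a y i.succ = y i := rfl

theorem xs_eq_colorVec (d : ℕ) (s : ℝ) :
    xs (d + 1) s = colorVec (highProp d s) fun _ => lowProp d s := by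
  ext r
  refine Fin.cases ?_ (fun i => ?_) r
  · simp [xs, highProp]
  · simp [xs, lowProp]

theorem negFreeEnergy_eq (p : ℕ) (β h : ℝ) {d : ℕ} (t : EuclideanSpace ℝ (Fin (d + 1))) :
    negFreeEnergy p β h t =
      colorEnergy p β (t 0) + h * t 0 + ∑ i : Fin d, colorEnergy p β (t i.succ) := by
  simp only [negFreeEnergy, Fin.sum_univ_succ, colorEnergy, firstColor, Finset.sum_sub_distrib,
    ← Finset.mul_sum]
  simp
  ring

theorem negFreeEnergy_xs (p : ℕ) (β h : ℝ) (d : ℕ) (s : ℝ) :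
    negFreeEnergy p β h (xs (d + 1) s) =
      colorEnergy p β (highProp d s) + h * highProp d s + d * colorEnergy p β (lowProp d s) := by
  rw [negFreeEnergy_eq, xs_eq_colorVec]
  simp

theorem highProp_pos {d : ℕ} {s : ℝ} (hs : 0 ≤ s) : 0 < highProp d s := by
  unfold highProp; positivity

theorem lowProp_pos {d : ℕ} {s : ℝ} (hs : s < 1) : 0 < lowProp d s :=
  div_pos (by linarith) (by positivity)

theorem hasDerivAt_highProp (d : ℕ) (s : ℝ) : HasDerivAt (highProp d) (d / (d + 1)) s := by
  have := (((hasDerivAt_id s).const_mul (d : ℝ)).const_add 1).div_const ((d : ℝ) + 1)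
  exact this.congr_deriv (by simp)

theorem hasDerivAt_lowProp (d : ℕ) (s : ℝ) : HasDerivAt (lowProp d) (-1 / (d + 1)) s := by
  have := ((hasDerivAt_id s).const_sub 1).div_const ((d : ℝ) + 1)
  exact this.congr_deriv (by simp)

theorem eventually_pos_props {d : ℕ} {s : ℝ} (hs : 0 < highProp d s ∧ 0 < lowProp d s) :
    ∀ᶠ s' in nhds s, 0 < highProp d s' ∧ 0 < lowProp d s' :=
  ((hasDerivAt_highProp d s).continuousAt.eventually (lt_mem_nhds hs.1)).and
    ((hasDerivAt_lowProp d s).continuousAt.eventually (lt_mem_nhds hs.2))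

/-- The first three derivatives of the negative free energy along `x_s`. -/
theorem hasDerivAt_negFreeEnergy_xs (p : ℕ) (β h : ℝ) {d : ℕ} {s : ℝ}
    (hs : 0 < highProp d s ∧ 0 < lowProp d s) :
    HasDerivAt (fun s' => negFreeEnergy p β h (xs (d + 1) s'))
      (colorEnergy₁ p β (highProp d s) * (d / (d + 1)) + h * (d / (d + 1)) +
        d * (colorEnergy₁ p β (lowProp d s) * (-1 / (d + 1)))) s := by
  simp only [negFreeEnergy_xs]
  exact (((hasDerivAt_colorEnergy p β hs.1).comp s (hasDerivAt_highProp d s)).add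
    ((hasDerivAt_highProp d s).const_mul h)).add
    (((hasDerivAt_colorEnergy p β hs.2).comp s (hasDerivAt_lowProp d s)).const_mul (d : ℝ))

theorem iteratedDeriv_two_negFreeEnergy_xs {p : ℕ} (hp : 2 ≤ p) (β h : ℝ) {d : ℕ} {s : ℝ}
    (hs : 0 < highProp d s ∧ 0 < lowProp d s) :
    iteratedDeriv 2 (fun s' => negFreeEnergy p β h (xs (d + 1) s')) s =
      d / (d + 1) ^ 2 *
        (d * colorEnergy₂ p β (highProp d s) + colorEnergy₂ p β (lowProp d s)) := by
  have h1 := (eventually_pos_props hs).mono fun s' hs' => (hasDerivAt_negFreeEnergy_xs p β h hs').deriv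
  rw [iteratedDeriv_succ, iteratedDeriv_one, Filter.EventuallyEq.deriv_eq h1]
  have h2 := ((((hasDerivAt_colorEnergy₁ hp β hs.1).comp s (hasDerivAt_highProp d s)).mul_const
    ((d : ℝ) / (d + 1))).add_const (h * ((d : ℝ) / (d + 1)))).add
    ((((hasDerivAt_colorEnergy₁ hp β hs.2).comp s (hasDerivAt_lowProp d s)).mul_const
      (-1 / ((d : ℝ) + 1))).const_mul (d : ℝ))
  refine h2.deriv.trans ?_
  field_simp

theorem iteratedDeriv_three_negFreeEnergy_xs {p : ℕ} (hp : 2 ≤ p) (β h : ℝ) {d : ℕ} {s : ℝ}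
    (hs : 0 < highProp d s ∧ 0 < lowProp d s) :
    iteratedDeriv 3 (fun s' => negFreeEnergy p β h (xs (d + 1) s')) s =
      d / (d + 1) ^ 3 *
        (d ^ 2 * colorEnergy₃ p β (highProp d s) - colorEnergy₃ p β (lowProp d s)) := by
  have h1 := (eventually_pos_props hs).mono fun s' hs' => iteratedDeriv_two_negFreeEnergy_xs hp β h hs'
  rw [iteratedDeriv_succ, Filter.EventuallyEq.deriv_eq h1]
  have h2 := ((((hasDerivAt_colorEnergy₂ p β hs.1).comp s (hasDerivAt_highProp d s)).const_mul
    (d : ℝ)).add ((hasDerivAt_colorEnergy₂ p β hs.2).comp s (hasDerivAt_lowProp d s))).const_mul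
    ((d : ℝ) / (d + 1) ^ 2)
  refine h2.deriv.trans ?_
  field_simp
  ring

theorem analyticAt_negFreeEnergy_xs (p : ℕ) (β h : ℝ) {d : ℕ} {s : ℝ}
    (hs : 0 < highProp d s ∧ 0 < lowProp d s) :
    AnalyticAt ℝ (fun s' => negFreeEnergy p β h (xs (d + 1) s')) s := by
  simp only [negFreeEnergy_xs]
  have h1 : AnalyticAt ℝ (highProp d) s :=
    (analyticAt_const.add (analyticAt_const.mul analyticAt_id)).div analyticAt_const (by positivity)
  have h2 : AnalyticAt ℝ (lowProp d) s :=
    (analyticAt_const.sub analyticAt_id).div analyticAt_const (by positivity)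
  exact (((analyticAt_colorEnergy p β hs.1).fun_comp h1).add (analyticAt_const.mul h1)).add
    (analyticAt_const.mul ((analyticAt_colorEnergy p β hs.2).fun_comp h2))

theorem colorVec_mem_probVectors {d : ℕ} {a : ℝ} {y : Fin d → ℝ} (ha : 0 ≤ a) (hy : ∀ i, 0 ≤ y i)
    (hsum : a + ∑ i, y i = 1) : colorVec a y ∈ probVectors (d + 1) := by
  constructor
  · intro r
    refine Fin.cases ?_ (fun i => ?_) r
    · simpa using ha
    · simpa using hy i
  · simpa [Fin.sum_univ_succ] using hsum

theorem highProp_add (d : ℕ) (s : ℝ) : highProp d s + d * lowProp d s = 1 := by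
  unfold highProp lowProp
  field_simp
  ring

theorem isLocalMax_negFreeEnergy_xs {p : ℕ} {β h : ℝ} {d : ℕ} {s : ℝ}
    (hs : 0 ≤ s) (hs1 : s < 1) (hmax : IsUniqueMaximizer p β h (xs (d + 1) s)) :
    IsLocalMax (fun s' => negFreeEnergy p β h (xs (d + 1) s')) s := by
  filter_upwards [eventually_pos_props (d := d) ⟨highProp_pos hs, lowProp_pos hs1⟩] with s' hs'
  by_cases hx : xs (d + 1) s' = xs (d + 1) s
  · rw [hx]
  · refine (hmax.2 _ ?_ hx).le
    rw [xs_eq_colorVec]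
    exact colorVec_mem_probVectors hs'.1.le (fun _ => hs'.2.le) (by simp [highProp_add])

/-- After multiplication by `x` the second derivative becomes increasing in `x` (for positive `β`),
so its sign can be compared at the two proportions of `x_s`. -/
theorem colorEnergy₂_eq {p : ℕ} (hp : 2 ≤ p) (β : ℝ) {x : ℝ} (hx : 0 < x) :
    x * colorEnergy₂ p β x = β * p * (p - 1) * x ^ (p - 1) - 1 := by
  obtain ⟨k, rfl⟩ : ∃ k, p = k + 2 := ⟨p - 2, by omega⟩
  simp only [colorEnergy₂, show k + 2 - 2 = k by omega, show k + 2 - 1 = k + 1 by omega]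
  field_simp
  ring

theorem colorEnergy₃_eq {p : ℕ} (hp : 2 ≤ p) (β : ℝ) {x : ℝ} (hx : 0 < x) :
    x ^ 2 * colorEnergy₃ p β x = (p - 2) * (β * p * (p - 1) * x ^ (p - 1)) + 1 := by
  obtain ⟨k, rfl⟩ : ∃ k, p = k + 2 := ⟨p - 2, by omega⟩
  rcases Nat.eq_zero_or_pos k with rfl | hk
  · simp [colorEnergy₃]
    field_simp
  obtain ⟨j, rfl⟩ : ∃ j, k = j + 1 := ⟨k - 1, by omega⟩
  simp only [colorEnergy₃, show j + 1 + 2 - 2 = j + 1 by omega,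
    show j + 1 + 2 - 1 = j + 2 by omega]
  push_cast
  field_simp
  ring

/-- In the directions orthogonal to `u` the Hessian is negative definite. -/
theorem IsTypeISpecial.colorEnergy₂_lowProp_neg {p d : ℕ} (hp : 2 ≤ p) (hd : 2 ≤ d) {β h s : ℝ}
    (hβ : 0 < β) (hsp : IsTypeISpecial p (d + 1) β h s) :
    colorEnergy₂ p β (lowProp d s) < 0 := by
  -- Let `f` be the single-colour energy and `v ≤ w` the two proportions. If `f''(v) ≥ 0`,
  -- monotonicity of `x f''(x)` gives `f''(w) ≥ 0`, while maximality along `x_s` gives `d f''(w) +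
  -- f''(v) ≤ 0`. Both then vanish, which forces `v = w`. The third derivative along `x_s` is then a
  -- positive multiple of `(d² - 1) f'''(v)`, which is positive since `d ≥ 2`, although it must
  -- vanish at a degenerate maximum.
  by_contra! hb
  have hv := lowProp_pos (d := d) hsp.lt_one
  have hw := highProp_pos (d := d) hsp.nonneg
  have hd0 : (2 : ℝ) ≤ d := by exact_mod_cast hd
  have hp0 : (2 : ℝ) ≤ p := by exact_mod_cast hp
  have hvw : lowProp d s ≤ highProp d s := by
    unfold lowProp highProp
    have := hsp.nonneg
    gcongr
    nlinarith
  have hmax := isLocalMax_negFreeEnergy_xs hsp.nonneg hsp.lt_one hsp.isUniqueMaximizer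
  have han := analyticAt_negFreeEnergy_xs p β h ⟨hw, hv⟩
  have h2 := IsLocalMax.iteratedDeriv_two_nonpos han hmax
  have e2 := iteratedDeriv_two_negFreeEnergy_xs hp β h ⟨hw, hv⟩
  have ev := colorEnergy₂_eq hp β hv
  have ew := colorEnergy₂_eq hp β hw
  set b := colorEnergy₂ p β (lowProp d s)
  set a := colorEnergy₂ p β (highProp d s)
  have hpow : lowProp d s ^ (p - 1) ≤ highProp d s ^ (p - 1) := pow_le_pow_left₀ hv.le hvw _
  have hK : 0 < β * p * (p - 1) := mul_pos (by positivity) (by linarith)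
  have ha : 0 ≤ a := by
    have : 0 ≤ highProp d s * a := by
      rw [ew]
      have := mul_le_mul_of_nonneg_left hpow hK.le
      nlinarith [mul_nonneg hv.le hb]
    exact nonneg_of_mul_nonneg_right this hw
  have hsum : d * a + b ≤ 0 := by
    rw [e2] at h2
    by_contra! hc
    exact absurd h2 (not_le.2 (mul_pos (by positivity) hc))
  have ha0 : a = 0 := by nlinarith
  have hb0 : b = 0 := by nlinarith
  rw [ha0, mul_zero] at ew
  rw [hb0, mul_zero] at ev
  have hpe : lowProp d s ^ (p - 1) = highProp d s ^ (p - 1) :=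
    mul_left_cancel₀ hK.ne' (by linarith)
  have hwv : lowProp d s = highProp d s :=
    (pow_left_inj₀ hv.le hw.le (by omega)).1 hpe
  have h3 := IsLocalMax.iteratedDeriv_three_eq_zero han hmax (by rw [e2, ha0, hb0]; ring)
  rw [iteratedDeriv_three_negFreeEnergy_xs hp β h ⟨hw, hv⟩, ← hwv] at h3
  have e3 := colorEnergy₃_eq hp β hv
  have hKv : β * p * (p - 1) * lowProp d s ^ (p - 1) = 1 := by linarith
  rw [hKv] at e3
  have hc3 : 0 < colorEnergy₃ p β (lowProp d s) := by
    have : 0 < lowProp d s ^ 2 * colorEnergy₃ p β (lowProp d s) := by rw [e3]; linarith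
    exact pos_of_mul_pos_right this (by positivity)
  have : 0 < (d : ℝ) / (d + 1) ^ 3 *
      (d ^ 2 * colorEnergy₃ p β (lowProp d s) - colorEnergy₃ p β (lowProp d s)) := by
    refine mul_pos (by positivity) ?_
    have : (1 : ℝ) < d ^ 2 := by nlinarith
    nlinarith
  linarith

theorem hessForm_eq (p : ℕ) (β : ℝ) {d : ℕ} (s : ℝ) (t t' : EuclideanSpace ℝ (Fin (d + 1))) :
    hessForm p β (xs (d + 1) s) t t' = colorEnergy₂ p β (highProp d s) * (t 0 * t' 0) +
      ∑ i : Fin d, colorEnergy₂ p β (lowProp d s) * (t i.succ * t' i.succ) := by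
  rw [hessForm, Fin.sum_univ_succ, xs_eq_colorVec]
  simp [colorEnergy₂]

/-- The Hessian degenerates in the direction `u`. -/
theorem IsTypeISpecial.hess_uVec {p d : ℕ} (hp : 2 ≤ p) (hd : 1 ≤ d) {β h s : ℝ}
    (hβ : 0 < β) (hsp : IsTypeISpecial p (d + 1) β h s) :
    d * colorEnergy₂ p β (highProp d s) + colorEnergy₂ p β (lowProp d s) = 0 := by
  obtain ⟨t, ht, ht0, hker⟩ := hsp.isSingular
  have hdr : (0 : ℝ) < d := by exact_mod_cast hd
  -- Testing the kernel vector against `e_i - e_j` and using nondegeneracy in the transverse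
  -- directions shows that its entries at colours other than the first agree. It is therefore a
  -- multiple of `u`, and testing against `u` gives the claim.
  have hconst : ∀ i j : Fin d, t i.succ = t j.succ := by
    intro i j
    by_cases hij : i = j
    · rw [hij]
    have hd2 : 2 ≤ d := by
      by_contra hlt
      have : d = 1 := by omega
      subst this
      exact hij (Subsingleton.elim _ _)
    have h1 := hker (colorVec 0 (Pi.single i 1 - Pi.single j 1)) (by
      simp [zeroSum, Fin.sum_univ_succ])
    rw [hessForm_eq] at h1
    simp only [colorVec_zero, colorVec_succ, mul_zero, zero_add, Pi.sub_apply, ← Finset.mul_sum,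
      mul_sub, Finset.sum_sub_distrib] at h1
    simp only [Pi.single_apply, mul_ite, mul_one, mul_zero, Finset.sum_ite_eq', Finset.mem_univ,
      if_true] at h1
    have hb := (hsp.colorEnergy₂_lowProp_neg hp hd2 hβ).ne
    rw [← mul_sub] at h1
    linarith [(mul_eq_zero.1 h1).resolve_left hb]
  set i₀ : Fin d := ⟨0, hd⟩
  have hsum : t 0 = -(d * t i₀.succ) := by
    have : ∑ r, t r = 0 := ht
    rw [Fin.sum_univ_succ, Finset.sum_congr rfl fun i _ => hconst i i₀] at this
    simp at this
    linarith
  have ht1 : t i₀.succ ≠ 0 := by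
    intro h0
    refine ht0 ?_
    ext r
    refine Fin.cases ?_ (fun i => ?_) r
    · simp [hsum, h0]
    · simp [hconst i i₀, h0]
  have h1 := hker (colorVec (-d) fun _ => 1) (by simp [zeroSum, Fin.sum_univ_succ])
  rw [hessForm_eq, Finset.sum_congr rfl fun i _ => by rw [hconst i i₀], hsum] at h1
  simp at h1
  have : (d * t i₀.succ) *
      (d * colorEnergy₂ p β (highProp d s) + colorEnergy₂ p β (lowProp d s)) = 0 := by
    linarith
  exact (mul_eq_zero.1 this).resolve_left (by positivity)

/-- The quartic expansion of the negative free energy along `u`. -/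
theorem IsTypeISpecial.exists_quartic_expansion {p d : ℕ} (hp : 2 ≤ p) (hd : 1 ≤ d) {β h s : ℝ}
    (hβ : 0 < β) (hsp : IsTypeISpecial p (d + 1) β h s) :
    ∃ κ > 0, ∃ C > 0, ∃ η > 0, ∀ τ, |τ| ≤ η →
      |negFreeEnergy p β h (xs (d + 1) (s - (d + 1) * τ)) - negFreeEnergy p β h (xs (d + 1) s) +
        κ * τ ^ 4| ≤ C * |τ| ^ 5 := by
  have hv := lowProp_pos (d := d) hsp.lt_one
  have hw := highProp_pos (d := d) hsp.nonneg
  have hmax := isLocalMax_negFreeEnergy_xs hsp.nonneg hsp.lt_one hsp.isUniqueMaximizer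
  have han := analyticAt_negFreeEnergy_xs p β h ⟨hw, hv⟩
  have h1 : iteratedDeriv 1 (fun s' => negFreeEnergy p β h (xs (d + 1) s')) s = 0 := by
    rw [iteratedDeriv_one]
    exact hmax.deriv_eq_zero
  have h2 : iteratedDeriv 2 (fun s' => negFreeEnergy p β h (xs (d + 1) s')) s = 0 := by
    rw [iteratedDeriv_two_negFreeEnergy_xs hp β h ⟨hw, hv⟩, hsp.hess_uVec hp hd hβ, mul_zero]
  have h3 := IsLocalMax.iteratedDeriv_three_eq_zero han hmax h2
  obtain ⟨C, hC, η, hη, hb⟩ := AnalyticAt.exists_taylor_bound han 5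
  have h4 := hsp.fourth_deriv_neg
  have hd0 : (0 : ℝ) < d + 1 := by positivity
  -- Replacing `s` by `s - (d + 1) τ` moves `x_s` by exactly `τ u`; this is the origin of the powers
  -- of `d + 1`.
  refine ⟨-iteratedDeriv 4 (fun s' => negFreeEnergy p β h (xs (d + 1) s')) s / 24 * (d + 1) ^ 4,
    mul_pos (div_pos (by linarith) (by norm_num)) (by positivity), C * (d + 1) ^ 5, by positivity,
    η / (d + 1), by positivity, fun τ hτ => ?_⟩
  have hτ' : |-((d + 1) * τ)| ≤ η := by
    rw [abs_neg, abs_mul, abs_of_pos hd0]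
    rwa [le_div_iff₀' hd0] at hτ
  have := hb _ hτ'
  rw [abs_neg, abs_mul, abs_of_pos hd0, mul_pow, ← mul_assoc] at this
  refine le_trans (le_of_eq ?_) this
  congr 1
  simp only [Finset.sum_range_succ, h1, h2, h3, Finset.sum_range_zero, iteratedDeriv_zero]
  norm_num [Nat.factorial]
  rw [show s + -((d + 1) * τ) = s - (d + 1) * τ by ring]
  ring

theorem abs_apply_le_norm {d : ℕ} (ν : EuclideanSpace ℝ (Fin d)) (i : Fin d) : |ν i| ≤ ‖ν‖ := by
  simpa using PiLp.norm_apply_le ν i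

/-- The expansion of the negative free energy at a type-I special point. -/
theorem IsTypeISpecial.exists_energy_expansion {p d : ℕ} (hp : 2 ≤ p) (hd : 1 ≤ d) {β h s : ℝ}
    (hβ : 0 < β) (hsp : IsTypeISpecial p (d + 1) β h s) :
    ∃ κ > 0, ∃ b > 0, ∃ C > 0, ∃ η > 0, ∀ (τ : ℝ) (ν : EuclideanSpace ℝ (Fin d)),
      |τ| ≤ η → ‖ν‖ ≤ η → ∑ i, ν i = 0 →
      |negFreeEnergy p β h (colorVec (highProp d s - d * τ) fun i => lowProp d s + τ + ν i) -
        negFreeEnergy p β h (xs (d + 1) s) + κ * τ ^ 4 + b / 2 * ‖ν‖ ^ 2| ≤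
        C * (|τ| ^ 5 + (|τ| + ‖ν‖) * ‖ν‖ ^ 2) := by
  obtain ⟨κ, hκ, C₁, hC₁, η₁, hη₁, h₁⟩ := hsp.exists_quartic_expansion hp hd hβ
  obtain ⟨C₂, hC₂, η₂, hη₂, h₂⟩ :=
    exists_colorEnergy_expansion hp β (lowProp_pos (d := d) hsp.lt_one)
  have hd0 : (0 : ℝ) < d + 1 := by positivity
  -- For two colours (`d = 1`) there is no transverse direction, `ν` vanishes, and any positive `b`
  -- will do.
  obtain ⟨b, hb, hbν⟩ : ∃ b > 0, ∀ ν : EuclideanSpace ℝ (Fin d), ∑ i, ν i = 0 →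
      colorEnergy₂ p β (lowProp d s) / 2 * ‖ν‖ ^ 2 = -(b / 2 * ‖ν‖ ^ 2) := by
    by_cases hd2 : 2 ≤ d
    · exact ⟨_, neg_pos.2 (hsp.colorEnergy₂_lowProp_neg hp hd2 hβ), fun ν _ => by ring⟩
    · refine ⟨1, one_pos, fun ν hν => ?_⟩
      obtain rfl : d = 1 := by omega
      have : ν = 0 := by
        ext i
        simpa [Subsingleton.elim i 0] using hν
      simp [this]
  refine ⟨κ, hκ, b, hb, C₁ + C₂, by positivity, min η₁ η₂, by positivity, fun τ ν hτ hν hsum => ?_⟩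
  have hsq : ∑ i, ν i ^ 2 = ‖ν‖ ^ 2 := by rw [EuclideanSpace.real_norm_sq_eq]
  -- The path goes first along `u`, then transversally. In the second stage the first derivative is
  -- the same for all colours other than the first, so the terms linear in `ν` sum to zero and no
  -- mixed term of the critical order appears.
  have e1 : negFreeEnergy p β h (colorVec (highProp d s - d * τ) fun i => lowProp d s + τ + ν i) =
      negFreeEnergy p β h (xs (d + 1) (s - (d + 1) * τ)) +
      ∑ i, (colorEnergy p β (lowProp d s + τ + ν i) - colorEnergy p β (lowProp d s + τ)) := by
    rw [negFreeEnergy_eq, negFreeEnergy_xs,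
      show highProp d (s - (d + 1) * τ) = highProp d s - d * τ by unfold highProp; field_simp; ring,
      show lowProp d (s - (d + 1) * τ) = lowProp d s + τ by unfold lowProp; field_simp; ring]
    simp
  have e2 : ∑ i, (colorEnergy p β (lowProp d s + τ + ν i) - colorEnergy p β (lowProp d s + τ)) =
      ∑ i, (colorEnergy p β (lowProp d s + τ + ν i) - colorEnergy p β (lowProp d s + τ) -
        colorEnergy₁ p β (lowProp d s + τ) * ν i - colorEnergy₂ p β (lowProp d s) / 2 * ν i ^ 2) -
        b / 2 * ‖ν‖ ^ 2 := by
    simp only [Finset.sum_sub_distrib, ← Finset.mul_sum, hsum, hsq, hbν ν hsum]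
    ring
  have e3 : |∑ i, (colorEnergy p β (lowProp d s + τ + ν i) - colorEnergy p β (lowProp d s + τ) -
        colorEnergy₁ p β (lowProp d s + τ) * ν i - colorEnergy₂ p β (lowProp d s) / 2 * ν i ^ 2)| ≤
      C₂ * (|τ| + ‖ν‖) * ‖ν‖ ^ 2 := by
    rw [← hsq, Finset.mul_sum]
    refine (Finset.abs_sum_le_sum_abs _ _).trans (Finset.sum_le_sum fun i _ => ?_)
    have hνi := abs_apply_le_norm ν i
    refine (h₂ τ (ν i) (hτ.trans (min_le_right _ _))
      (hνi.trans (hν.trans (min_le_right _ _)))).trans ?_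
    gcongr
  have e4 := h₁ τ (hτ.trans (min_le_left _ _))
  rw [e1, e2]
  set R := ∑ i, (colorEnergy p β (lowProp d s + τ + ν i) - colorEnergy p β (lowProp d s + τ) -
        colorEnergy₁ p β (lowProp d s + τ) * ν i - colorEnergy₂ p β (lowProp d s) / 2 * ν i ^ 2)
  rw [show ∀ a c e f g : ℝ, a + (c - e) - f + g + e = (a - f + g) + c by intros; ring]
  refine (abs_add_le _ _).trans ((add_le_add e4 e3).trans ?_)
  have p1 : 0 ≤ C₂ * |τ| ^ 5 := by positivity
  have p2 : 0 ≤ C₁ * ((|τ| + ‖ν‖) * ‖ν‖ ^ 2) := by positivity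
  linarith

/-! ### Energy gap away from the maximizer. -/

theorem isCompact_probVectors (q : ℕ) : IsCompact (probVectors q) := by
  refine Metric.isCompact_of_isClosed_isBounded ?_ ?_
  · have h1 : IsClosed {t : EuclideanSpace ℝ (Fin q) | ∀ r, 0 ≤ t r} := by
      simp only [Set.ofPred_forall]
      exact isClosed_iInter fun r => isClosed_le continuous_const (by fun_prop)
    exact h1.inter (isClosed_eq (by fun_prop) continuous_const)
  · refine (Metric.isBounded_iff_subset_closedBall 0).2 ⟨1, fun t ht => ?_⟩
    rw [mem_closedBall_zero_iff, ← sq_le_one_iff₀ (norm_nonneg _), EuclideanSpace.real_norm_sq_eq]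
    refine le_trans (Finset.sum_le_sum fun r _ => ?_) ht.2.le
    have : t r ≤ 1 := by
      rw [← ht.2]
      exact Finset.single_le_sum (fun r _ => ht.1 r) (Finset.mem_univ r)
    nlinarith [ht.1 r]

theorem continuous_negFreeEnergy (p : ℕ) (β h : ℝ) (q : ℕ) :
    Continuous (fun t : EuclideanSpace ℝ (Fin q) => negFreeEnergy p β h t) := by
  unfold negFreeEnergy
  have : ∀ r, Continuous fun t : EuclideanSpace ℝ (Fin q) => t r * Real.log (t r) := fun r =>
    Real.continuous_mul_log.comp (by fun_prop)
  fun_prop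

/-- The probability vectors at distance at least `η` from `m` form a compact set; a maximum over it
lies strictly below the global one. -/
theorem IsUniqueMaximizer.exists_gap {p q : ℕ} {β h : ℝ} {m : EuclideanSpace ℝ (Fin q)}
    (hm : IsUniqueMaximizer p β h m) {η : ℝ} (hη : 0 < η) :
    ∃ c > 0, ∀ t ∈ probVectors q, η ≤ ‖t - m‖ →
      negFreeEnergy p β h t - negFreeEnergy p β h m ≤ -c := by
  have hK : IsCompact (probVectors q ∩ {t | η ≤ ‖t - m‖}) :=
    (isCompact_probVectors q).inter_right (isClosed_le continuous_const (by fun_prop))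
  rcases (probVectors q ∩ {t | η ≤ ‖t - m‖}).eq_empty_or_nonempty with he | hne
  · refine ⟨1, one_pos, fun t ht htη => ?_⟩
    have : t ∈ probVectors q ∩ {t | η ≤ ‖t - m‖} := ⟨ht, htη⟩
    simp [he] at this
  · obtain ⟨t₀, ht₀, hmax⟩ := hK.exists_isMaxOn hne (continuous_negFreeEnergy p β h q).continuousOn
    have hne : t₀ ≠ m := by
      rintro rfl
      have := ht₀.2
      simp at this
      linarith
    refine ⟨negFreeEnergy p β h m - negFreeEnergy p β h t₀,
      sub_pos.2 (hm.2 t₀ ht₀.1 hne), fun t ht htη => ?_⟩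
    have : negFreeEnergy p β h t ≤ negFreeEnergy p β h t₀ := hmax ⟨ht, htη⟩
    linarith

/-! ### Longitudinal and transverse coordinates -/

/-- The mean of the coordinates. -/
def avg {d : ℕ} (ζ : EuclideanSpace ℝ (Fin d)) : ℝ := (∑ i, ζ i) / d

/-- The deviation of the coordinates from their mean. -/
def dev {d : ℕ} (ζ : EuclideanSpace ℝ (Fin d)) : EuclideanSpace ℝ (Fin d) :=
  WithLp.toLp 2 fun i => ζ i - avg ζ

@[simp] theorem dev_apply {d : ℕ} (ζ : EuclideanSpace ℝ (Fin d)) (i : Fin d) :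
    dev ζ i = ζ i - avg ζ := rfl

theorem sum_eq_avg {d : ℕ} (hd : 1 ≤ d) (ζ : EuclideanSpace ℝ (Fin d)) :
    ∑ i, ζ i = d * avg ζ := by
  have : (d : ℝ) ≠ 0 := by positivity
  rw [avg]
  field_simp

theorem sum_dev {d : ℕ} (hd : 1 ≤ d) (ζ : EuclideanSpace ℝ (Fin d)) : ∑ i, dev ζ i = 0 := by
  simp [Finset.sum_sub_distrib, sum_eq_avg hd]

theorem norm_sq_eq_avg_dev {d : ℕ} (hd : 1 ≤ d) (ζ : EuclideanSpace ℝ (Fin d)) :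
    ‖ζ‖ ^ 2 = d * avg ζ ^ 2 + ‖dev ζ‖ ^ 2 := by
  rw [EuclideanSpace.real_norm_sq_eq, EuclideanSpace.real_norm_sq_eq]
  simp only [dev_apply, sub_sq, Finset.sum_add_distrib, Finset.sum_sub_distrib, ← Finset.sum_mul,
    ← Finset.mul_sum, sum_eq_avg hd, Finset.sum_const, Finset.card_univ, Fintype.card_fin,
    nsmul_eq_mul]
  ring

theorem abs_avg_le {d : ℕ} (hd : 1 ≤ d) (ζ : EuclideanSpace ℝ (Fin d)) : |avg ζ| ≤ ‖ζ‖ := by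
  have h := norm_sq_eq_avg_dev hd ζ
  have hd1 : (1 : ℝ) ≤ d := by exact_mod_cast hd
  refine abs_le_of_sq_le_sq ?_ (norm_nonneg _)
  nlinarith [sq_nonneg (avg ζ), sq_nonneg ‖dev ζ‖]

theorem norm_dev_le {d : ℕ} (hd : 1 ≤ d) (ζ : EuclideanSpace ℝ (Fin d)) : ‖dev ζ‖ ≤ ‖ζ‖ := by
  have h := norm_sq_eq_avg_dev hd ζ
  refine le_of_abs_le (abs_le_of_sq_le_sq ?_ (norm_nonneg _))
  nlinarith [mul_nonneg (Nat.cast_nonneg (α := ℝ) d) (sq_nonneg (avg ζ))]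

theorem avg_sub {d : ℕ} (ζ ζ' : EuclideanSpace ℝ (Fin d)) : avg (ζ - ζ') = avg ζ - avg ζ' := by
  simp [avg, Finset.sum_sub_distrib, sub_div]

theorem dev_sub {d : ℕ} (ζ ζ' : EuclideanSpace ℝ (Fin d)) : dev (ζ - ζ') = dev ζ - dev ζ' := by
  ext i
  simp [avg_sub]
  ring

theorem continuous_avg {d : ℕ} : Continuous (avg : EuclideanSpace ℝ (Fin d) → ℝ) := by
  unfold avg
  fun_prop

theorem continuous_dev {d : ℕ} :
    Continuous (dev : EuclideanSpace ℝ (Fin d) → EuclideanSpace ℝ (Fin d)) := by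
  refine (PiLp.continuous_toLp 2 _).comp (continuous_pi fun i => ?_)
  exact (by fun_prop : Continuous fun ζ : EuclideanSpace ℝ (Fin d) => ζ i).sub continuous_avg

/-- The coordinates of `y` centred at `ρ⁴ v`, at the scale `ρ³` for the mean and `ρ²` for the
deviations from the mean. -/
def unscale {d : ℕ} (ρ v : ℝ) (y : Fin d → ℝ) : EuclideanSpace ℝ (Fin d) :=
  WithLp.toLp 2 fun i => ((∑ j, y j) / d - ρ ^ 4 * v) / ρ ^ 3 + (y i - (∑ j, y j) / d) / ρ ^ 2

/-- The inverse of `unscale`. -/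
def scale {d : ℕ} (ρ v : ℝ) (ζ : EuclideanSpace ℝ (Fin d)) (i : Fin d) : ℝ :=
  ρ ^ 4 * v + ρ ^ 3 * avg ζ + ρ ^ 2 * (ζ i - avg ζ)

theorem avg_unscale {d : ℕ} (hd : 1 ≤ d) (ρ v : ℝ) (y : Fin d → ℝ) :
    avg (unscale ρ v y) = ((∑ j, y j) / d - ρ ^ 4 * v) / ρ ^ 3 := by
  have : (d : ℝ) ≠ 0 := by positivity
  simp only [avg, unscale, Finset.sum_add_distrib, Finset.sum_const, Finset.card_univ,
    Fintype.card_fin, nsmul_eq_mul, ← Finset.sum_div, Finset.sum_sub_distrib]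
  field_simp
  ring

theorem dev_unscale {d : ℕ} (hd : 1 ≤ d) (ρ v : ℝ) (y : Fin d → ℝ) (i : Fin d) :
    dev (unscale ρ v y) i = (y i - (∑ j, y j) / d) / ρ ^ 2 := by
  rw [dev_apply, avg_unscale hd]
  simp [unscale]

theorem sum_scale {d : ℕ} (hd : 1 ≤ d) (ρ v : ℝ) (ζ : EuclideanSpace ℝ (Fin d)) :
    ∑ i, scale ρ v ζ i = d * (ρ ^ 4 * v + ρ ^ 3 * avg ζ) := by
  simp only [scale, Finset.sum_add_distrib, ← Finset.mul_sum, Finset.sum_sub_distrib,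
    sum_eq_avg hd, Finset.sum_const, Finset.card_univ, Fintype.card_fin, nsmul_eq_mul]
  ring

theorem unscale_scale {d : ℕ} (hd : 1 ≤ d) {ρ : ℝ} (hρ : 0 < ρ) (v : ℝ)
    (ζ : EuclideanSpace ℝ (Fin d)) : unscale ρ v (scale ρ v ζ) = ζ := by
  have : (d : ℝ) ≠ 0 := by positivity
  ext i
  simp only [unscale, sum_scale hd]
  simp only [scale]
  field_simp
  ring

/-- Rounding at unit scale moves a point by `O(ρ⁻²)`. -/
theorem norm_unscale_sub_le {d : ℕ} (hd : 1 ≤ d) {ρ : ℝ} (hρ : 1 ≤ ρ) (v : ℝ) {y y' : Fin d → ℝ}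
    (h : ∀ i, |y i - y' i| ≤ 1) : ‖unscale ρ v y - unscale ρ v y'‖ ≤ 3 * d / ρ ^ 2 := by
  have hd0 : (0 : ℝ) < d := by exact_mod_cast hd
  have hd1 : (1 : ℝ) ≤ d := by exact_mod_cast hd
  have hm : |(∑ j, y j) / d - (∑ j, y' j) / d| ≤ 1 := by
    rw [← sub_div, ← Finset.sum_sub_distrib, abs_div, abs_of_pos hd0, div_le_one hd0]
    refine (Finset.abs_sum_le_sum_abs _ _).trans ((Finset.sum_le_sum fun i _ => h i).trans ?_)
    simp
  have hρ0 : 0 < ρ := by linarith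
  have hent : ∀ i, |(unscale ρ v y - unscale ρ v y') i| ≤ 3 / ρ ^ 2 := by
    intro i
    have e : (unscale ρ v y - unscale ρ v y') i =
        ((∑ j, y j) / d - (∑ j, y' j) / d) / ρ ^ 3 + ((y i - y' i) -
          ((∑ j, y j) / d - (∑ j, y' j) / d)) / ρ ^ 2 := by
      simp only [unscale, PiLp.sub_apply]
      ring
    rw [e]
    have h1 : |((∑ j, y j) / d - (∑ j, y' j) / d) / ρ ^ 3| ≤ 1 / ρ ^ 2 := by
      rw [abs_div, abs_of_pos (by positivity : 0 < ρ ^ 3)]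
      gcongr
      norm_num
    have h2 : |((y i - y' i) - ((∑ j, y j) / d - (∑ j, y' j) / d)) / ρ ^ 2| ≤ 2 / ρ ^ 2 := by
      rw [abs_div, abs_of_pos (by positivity : 0 < ρ ^ 2)]
      gcongr
      exact (abs_sub _ _).trans (by linarith [h i])
    refine (abs_add_le _ _).trans ((add_le_add h1 h2).trans (le_of_eq (by ring)))
  refine abs_le_of_sq_le_sq' ?_ (by positivity) |>.2
  rw [EuclideanSpace.real_norm_sq_eq]
  calc ∑ i, (unscale ρ v y - unscale ρ v y') i ^ 2 ≤ ∑ _i : Fin d, (3 / ρ ^ 2) ^ 2 :=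
        Finset.sum_le_sum fun i _ => sq_le_sq' (by linarith [(abs_le.1 (hent i)).1])
          (abs_le.1 (hent i)).2
    _ = d * (3 / ρ ^ 2) ^ 2 := by simp
    _ ≤ d ^ 2 * (3 / ρ ^ 2) ^ 2 := by gcongr; nlinarith
    _ = (3 * d / ρ ^ 2) ^ 2 := by ring

/-- The longitudinal and transverse coordinates of a vector of counts. -/
def latticePoint {d : ℕ} (ρ v : ℝ) (k : Fin (d + 1) → ℕ) : EuclideanSpace ℝ (Fin d) :=
  unscale ρ v fun i => (k i.succ : ℝ)

theorem proportions_eq {d N : ℕ} (hd : 1 ≤ d) (s : ℝ) {ρ : ℝ} (hρ : 0 < ρ)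
    (hN : ρ ^ 4 = N) {k : Fin (d + 1) → ℕ} (hk : ∑ r, k r = N) :
    proportions N k = colorVec
      (highProp d s - d * (avg (latticePoint ρ (lowProp d s) k) / ρ)) fun i =>
      lowProp d s + avg (latticePoint ρ (lowProp d s) k) / ρ +
        dev (latticePoint ρ (lowProp d s) k) i / ρ ^ 2 := by
  have hd0 : (d : ℝ) ≠ 0 := by positivity
  have hk' : (k 0 : ℝ) = ρ ^ 4 - ∑ i : Fin d, (k i.succ : ℝ) := by
    have : (∑ r, (k r : ℝ)) = N := by exact_mod_cast hk
    rw [Fin.sum_univ_succ] at this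
    linarith
  have hw := highProp_add d s
  ext r
  refine Fin.cases ?_ (fun i => ?_) r
  · simp only [proportions, colorVec_zero, latticePoint, avg_unscale hd, hk', ← hN]
    field_simp
    linear_combination (-ρ ^ 4) * hw
  · simp only [proportions, colorVec_succ, latticePoint, avg_unscale hd, dev_unscale hd, ← hN]
    field_simp
    ring

/-- The lattice points of the simplex are at distance `O(ρ²)`. -/
theorem norm_latticePoint_le {d N : ℕ} (hd : 1 ≤ d) {v ρ : ℝ} (hv : |v| ≤ 1) (hρ : 1 ≤ ρ)
    (hN : ρ ^ 4 = N) {k : Fin (d + 1) → ℕ} (hk : ∑ r, k r = N) :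
    ‖latticePoint ρ v k‖ ≤ 3 * d * ρ ^ 2 := by
  have hd0 : (0 : ℝ) < d := by exact_mod_cast hd
  have hd1 : (1 : ℝ) ≤ d := by exact_mod_cast hd
  have hρ0 : 0 < ρ := by linarith
  have hkr : ∀ i : Fin d, (0 : ℝ) ≤ k i.succ ∧ (k i.succ : ℝ) ≤ ρ ^ 4 := by
    refine fun i => ⟨Nat.cast_nonneg _, ?_⟩
    rw [hN]
    exact_mod_cast hk ▸ Finset.single_le_sum (f := k) (fun _ _ => Nat.zero_le _)
      (Finset.mem_univ i.succ)
  have hm0 : 0 ≤ (∑ j : Fin d, (k j.succ : ℝ)) / d :=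
    div_nonneg (Finset.sum_nonneg fun i _ => (hkr i).1) hd0.le
  have hm1 : (∑ j : Fin d, (k j.succ : ℝ)) / d ≤ ρ ^ 4 := by
    rw [div_le_iff₀ hd0]
    refine (Finset.sum_le_sum fun i _ => (hkr i).2).trans ?_
    simp [mul_comm]
  have hent : ∀ i, |latticePoint ρ v k i| ≤ 3 * ρ ^ 2 := by
    intro i
    simp only [latticePoint, unscale]
    have h1 : |((∑ j : Fin d, (k j.succ : ℝ)) / d - ρ ^ 4 * v) / ρ ^ 3| ≤ 2 * ρ ^ 2 := by
      rw [abs_div, abs_of_pos (by positivity : 0 < ρ ^ 3), div_le_iff₀ (by positivity)]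
      refine (abs_sub _ _).trans ?_
      rw [abs_of_nonneg hm0, abs_mul, abs_of_pos (by positivity : 0 < ρ ^ 4)]
      have : ρ ^ 4 * |v| ≤ ρ ^ 4 * 1 := by gcongr
      have : ρ ^ 4 * 1 ≤ ρ ^ 4 * ρ := by gcongr
      nlinarith
    have h2 : |((k i.succ : ℝ) - (∑ j : Fin d, (k j.succ : ℝ)) / d) / ρ ^ 2| ≤ ρ ^ 2 := by
      rw [abs_div, abs_of_pos (by positivity : 0 < ρ ^ 2), div_le_iff₀ (by positivity), abs_le]
      have : ρ ^ 2 * ρ ^ 2 = ρ ^ 4 := by ring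
      constructor <;> linarith [(hkr i).1, (hkr i).2]
    exact (abs_add_le _ _).trans (by linarith)
  refine abs_le_of_sq_le_sq' ?_ (by positivity) |>.2
  rw [EuclideanSpace.real_norm_sq_eq]
  calc ∑ i, latticePoint ρ v k i ^ 2 ≤ ∑ _i : Fin d, (3 * ρ ^ 2) ^ 2 :=
        Finset.sum_le_sum fun i _ => sq_le_sq' (by linarith [(abs_le.1 (hent i)).1])
          (abs_le.1 (hent i)).2
    _ = d * (3 * ρ ^ 2) ^ 2 := by simp
    _ ≤ d ^ 2 * (3 * ρ ^ 2) ^ 2 := by gcongr; nlinarith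
    _ = (3 * d * ρ ^ 2) ^ 2 := by ring

/-! ### Elementary estimates with Gaussian envelopes -/

/-- An error on the logarithm of a density is turned into an error on the density; the price is that
both densities need an envelope. -/
theorem abs_exp_sub_exp_le (x y : ℝ) :
    |Real.exp x - Real.exp y| ≤ |x - y| * (Real.exp x + Real.exp y) := by
  wlog hxy : y ≤ x generalizing x y
  · rw [abs_sub_comm, abs_sub_comm x, add_comm]
    exact this y x (le_of_not_ge hxy)
  have h1 := Real.add_one_le_exp (y - x)
  have h2 : Real.exp y = Real.exp x * Real.exp (y - x) := by rw [← Real.exp_add]; ring_nf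
  rw [abs_of_nonneg (sub_nonneg.2 (Real.exp_le_exp.2 hxy)), abs_of_nonneg (sub_nonneg.2 hxy)]
  nlinarith [Real.exp_pos x, mul_nonneg (sub_nonneg.2 hxy) (Real.exp_pos y).le]

/-- The power is dominated by `exp (1 + r)`, and completing the square absorbs the linear exponent
into half of the Gaussian one. Repeated use explains the shrinking constants in the envelopes below.
-/
theorem exists_pow_mul_exp_neg_sq_le {c : ℝ} (hc : 0 < c) (n : ℕ) :
    ∃ C > 0, ∀ r, 0 ≤ r → (1 + r) ^ n * Real.exp (-(c * r ^ 2)) ≤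
      C * Real.exp (-(c / 2 * r ^ 2)) := by
  refine ⟨n.factorial * Real.exp (1 + 1 / (2 * c)), by positivity, fun r hr => ?_⟩
  have h1 := Real.pow_div_factorial_le_exp (1 + r) (by linarith) n
  rw [div_le_iff₀ (by positivity)] at h1
  calc (1 + r) ^ n * Real.exp (-(c * r ^ 2))
      ≤ (Real.exp (1 + r) * n.factorial) * Real.exp (-(c * r ^ 2)) := by gcongr
    _ = n.factorial * Real.exp (1 + r + -(c * r ^ 2)) := by rw [Real.exp_add (1 + r)]; ring
    _ ≤ n.factorial * Real.exp (1 + 1 / (2 * c) + -(c / 2 * r ^ 2)) := by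
        gcongr ?_ * Real.exp ?_
        have : 0 ≤ (c / 2) * (r - 1 / c) ^ 2 := by positivity
        have e : (c / 2) * (r - 1 / c) ^ 2 = c / 2 * r ^ 2 - r + 1 / (2 * c) := by
          field_simp
          ring
        linarith
    _ = _ := by rw [Real.exp_add (1 + 1 / (2 * c))]; ring

/-- From `‖x‖² ≤ 2 ‖y‖² + 2 D²`. It transports an envelope at a lattice point to the points of its
cell. -/
theorem exp_neg_norm_sq_shift {E : Type*} [SeminormedAddCommGroup E] {c D : ℝ} (hc : 0 < c)
    {x y : E} (h : ‖x - y‖ ≤ D) :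
    Real.exp (-(c * ‖y‖ ^ 2)) ≤ Real.exp (c * D ^ 2) * Real.exp (-(c / 2 * ‖x‖ ^ 2)) := by
  rw [← Real.exp_add]
  refine Real.exp_le_exp.2 ?_
  have h1 : ‖x‖ ≤ ‖y‖ + D := by
    have := norm_add_le (x - y) y
    rw [sub_add_cancel] at this
    linarith
  have h2 : ‖x‖ ^ 2 ≤ 2 * ‖y‖ ^ 2 + 2 * D ^ 2 := by
    have : ‖x‖ ^ 2 ≤ (‖y‖ + D) ^ 2 := pow_le_pow_left₀ (norm_nonneg _) h1 2
    nlinarith [sq_nonneg (‖y‖ - D)]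
  nlinarith

/-! ### The limiting density -/

/-- The unnormalized limiting density. -/
def refWeight {d : ℕ} (κ b : ℝ) (ζ : EuclideanSpace ℝ (Fin d)) : ℝ :=
  Real.exp (-(κ * avg ζ ^ 4 + b / 2 * ‖dev ζ‖ ^ 2))

theorem refWeight_pos {d : ℕ} (κ b : ℝ) (ζ : EuclideanSpace ℝ (Fin d)) : 0 < refWeight κ b ζ :=
  Real.exp_pos _

theorem continuous_refWeight {d : ℕ} (κ b : ℝ) :
    Continuous (refWeight κ b : EuclideanSpace ℝ (Fin d) → ℝ) := by
  have h1 := continuous_avg (d := d)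
  have h2 := continuous_dev (d := d)
  unfold refWeight
  fun_prop

/-- The inequality `(T² - 1)² ≥ 0` bounds the quartic term from below by a quadratic one, so that
Gaussian envelopes suffice throughout. -/
theorem quartic_form_ge {d : ℕ} (hd : 1 ≤ d) {κ b : ℝ} (hκ : 0 < κ)
    (ζ : EuclideanSpace ℝ (Fin d)) :
    min (2 * κ / d) (b / 2) * ‖ζ‖ ^ 2 - κ ≤ κ * avg ζ ^ 4 + b / 2 * ‖dev ζ‖ ^ 2 := by
  have hd0 : (0 : ℝ) < d := by exact_mod_cast hd
  rw [norm_sq_eq_avg_dev hd, mul_add]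
  have h1 : min (2 * κ / d) (b / 2) * (d * avg ζ ^ 2) ≤ 2 * κ / d * (d * avg ζ ^ 2) := by
    gcongr
    exact min_le_left _ _
  have h2 : min (2 * κ / d) (b / 2) * ‖dev ζ‖ ^ 2 ≤ b / 2 * ‖dev ζ‖ ^ 2 := by
    gcongr
    exact min_le_right _ _
  have h3 : 2 * κ / d * (d * avg ζ ^ 2) = 2 * κ * avg ζ ^ 2 := by field_simp
  have h4 : 0 ≤ κ * (avg ζ ^ 2 - 1) ^ 2 := by positivity
  nlinarith

/-- Gaussian envelopes of the limiting densities, uniform in the parameters. -/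
theorem exists_refWeight_le {d : ℕ} (hd : 1 ≤ d) {κ₀ b₀ : ℝ} (hκ₀ : 0 < κ₀) (hb₀ : 0 < b₀) :
    ∃ c > 0, ∃ C > 0, ∀ κ b : ℝ, κ₀ ≤ κ → b₀ ≤ b → ∀ ζ : EuclideanSpace ℝ (Fin d),
      refWeight κ b ζ ≤ C * Real.exp (-(c * ‖ζ‖ ^ 2)) := by
  have hd0 : (0 : ℝ) < d := by exact_mod_cast hd
  refine ⟨min (2 * κ₀ / d) (b₀ / 2), by positivity, Real.exp κ₀, Real.exp_pos _,
    fun κ b hκ hb ζ => ?_⟩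
  rw [← Real.exp_add]
  refine Real.exp_le_exp.2 ?_
  have h1 := quartic_form_ge hd (b := b₀) hκ₀ ζ
  have h2 : κ₀ * avg ζ ^ 4 ≤ κ * avg ζ ^ 4 := by gcongr
  have h3 : b₀ / 2 * ‖dev ζ‖ ^ 2 ≤ b / 2 * ‖dev ζ‖ ^ 2 := by gcongr
  linarith

/-! ### The weights of the lattice points -/

theorem abs_log_sub_log_le {x m : ℝ} (hm : 0 < m) (hx : m / 2 ≤ x) :
    |Real.log x - Real.log m| ≤ 2 / m * |x - m| := by
  have hx0 : 0 < x := by linarith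
  have h1 : Real.log x - Real.log m ≤ 2 / m * |x - m| := by
    rw [← Real.log_div hx0.ne' hm.ne']
    have := Real.log_le_sub_one_of_pos (div_pos hx0 hm)
    have e : x / m - 1 = 1 / m * (x - m) := by field_simp
    rw [e] at this
    have h3 : 1 / m * (x - m) ≤ 2 / m * |x - m| :=
      calc 1 / m * (x - m) ≤ 1 / m * |x - m| := by
            gcongr
            exact le_abs_self _
        _ ≤ _ := by
            gcongr
            norm_num
    linarith
  have h2 : Real.log m - Real.log x ≤ 2 / m * |x - m| := by
    rw [← Real.log_div hm.ne' hx0.ne']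
    have := Real.log_le_sub_one_of_pos (div_pos hm hx0)
    have e : m / x - 1 = 1 / x * (m - x) := by field_simp
    rw [e] at this
    have h3 : 1 / x * (m - x) ≤ 2 / m * |x - m| := by
      have : 1 / x ≤ 2 / m := by
        rw [div_le_div_iff₀ hx0 hm]
        linarith
      calc 1 / x * (m - x) ≤ 1 / x * |x - m| := by
            gcongr
            rw [abs_sub_comm]
            exact le_abs_self _
        _ ≤ _ := by gcongr
    linarith
  exact abs_le.2 ⟨by linarith, h1⟩

theorem abs_log_stirlingRatio_sub_le {N n : ℕ} (hN : 1 ≤ N) {m : ℝ} (hm : 0 < m)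
    (h : |(n : ℝ) / N - m| ≤ m / 2) :
    |Real.log (stirlingRatio n * √N) + Real.log (2 * Real.pi * m) / 2| ≤
      1 / m * (1 / N + |(n : ℝ) / N - m|) := by
  have hN0 : (0 : ℝ) < N := by exact_mod_cast hN
  have hx : m / 2 ≤ (n : ℝ) / N := by linarith [(abs_le.1 h).1]
  have hn0 : (0 : ℝ) < n := by
    by_contra hn
    have : (n : ℝ) = 0 := le_antisymm (not_lt.1 hn) (Nat.cast_nonneg n)
    rw [this, zero_div] at hx
    linarith
  have hn : 1 ≤ n := by exact_mod_cast hn0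
  have h1 := abs_log_stirlingRatio_mul_sqrt_sub_le hN hn
  have h2 := abs_log_sub_log_le hm hx
  have hpi := Real.pi_pos
  have hS := stirlingRatio_pos n
  rw [Real.log_mul (by positivity : 2 * Real.pi ≠ 0) (by positivity)] at h1
  rw [Real.log_mul (by positivity : 2 * Real.pi ≠ 0) hm.ne']
  have h3 : 1 / (12 * (n : ℝ)) ≤ 1 / m * (1 / N) := by
    rw [div_mul_div_comm, one_mul]
    refine one_div_le_one_div_of_le (by positivity) ?_
    rw [le_div_iff₀ hN0] at hx
    linarith
  rw [show 1 / m * (1 / (N : ℝ) + |(n : ℝ) / N - m|) =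
    1 / m * (1 / N) + (2 / m * |(n : ℝ) / N - m|) / 2 by ring]
  rw [abs_le] at h1 h2 ⊢
  constructor <;> linarith [h1.1, h1.2, h2.1, h2.2]

/-- The logarithm of the limit of the Stirling prefactors. -/
def logPrefactor (d : ℕ) (s : ℝ) : ℝ := -∑ r, Real.log (2 * Real.pi * xs (d + 1) s r) / 2

theorem log_latticeWeight (p : ℕ) (β h : ℝ) {N : ℕ} (hN : 1 ≤ N) {q : ℕ}
    (m : EuclideanSpace ℝ (Fin q)) (k : Fin q → ℕ) :
    Real.log (latticeWeight p β h N m k) = ∑ r, Real.log (stirlingRatio (k r) * √N) +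
      N * (negFreeEnergy p β h (proportions N k) - negFreeEnergy p β h m) := by
  have hN0 : (0 : ℝ) < N := by exact_mod_cast hN
  have : ∀ r, 0 < stirlingRatio (k r) * √N := fun r =>
    mul_pos (stirlingRatio_pos _) (Real.sqrt_pos.2 hN0)
  rw [latticeWeight, Real.log_mul (Finset.prod_pos fun r _ => this r).ne' (Real.exp_pos _).ne',
    Real.log_exp, Real.log_prod fun r _ => (this r).ne']

set_option maxHeartbeats 1000000 in
/-- The weights near the maximizer. -/
theorem IsTypeISpecial.exists_log_latticeWeight_near {p d : ℕ} (hp : 2 ≤ p) (hd : 1 ≤ d)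
    {β h s : ℝ} (hβ : 0 < β) (hsp : IsTypeISpecial p (d + 1) β h s) :
    ∃ κ > 0, ∃ b > 0, ∃ C > 0, ∃ η > 0, ∀ (N : ℕ) (ρ : ℝ), 1 ≤ ρ → ρ ^ 4 = N →
      ∀ k : Fin (d + 1) → ℕ, ∑ r, k r = N →
      |avg (latticePoint ρ (lowProp d s) k)| ≤ η * ρ →
      ‖dev (latticePoint ρ (lowProp d s) k)‖ ≤ η * ρ ^ 2 →
      |Real.log (latticeWeight p β h N (xs (d + 1) s) k) - (logPrefactor d s -
        (κ * avg (latticePoint ρ (lowProp d s) k) ^ 4 +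
          b / 2 * ‖dev (latticePoint ρ (lowProp d s) k)‖ ^ 2))| ≤
        C / ρ * (1 + ‖latticePoint ρ (lowProp d s) k‖) ^ 5 ∧
      Real.log (latticeWeight p β h N (xs (d + 1) s) k) ≤ C -
        (κ / 2 * avg (latticePoint ρ (lowProp d s) k) ^ 4 +
          b / 4 * ‖dev (latticePoint ρ (lowProp d s) k)‖ ^ 2) := by
  obtain ⟨κ, hκ, b, hb, C₁, hC₁, η₁, hη₁, hexp⟩ := hsp.exists_energy_expansion hp hd hβ
  have hv := lowProp_pos (d := d) hsp.lt_one
  have hw := highProp_pos (d := d) hsp.nonneg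
  have hd0 : (0 : ℝ) < d := by exact_mod_cast hd
  have hd1 : (1 : ℝ) ≤ d := by exact_mod_cast hd
  obtain ⟨m₀, hm₀, hm₀v, hm₀w⟩ : ∃ m₀ > 0, m₀ ≤ lowProp d s ∧ m₀ ≤ highProp d s :=
    ⟨min (lowProp d s) (highProp d s), lt_min hv hw, min_le_left _ _, min_le_right _ _⟩
  -- The four constraints on `η`: the energy expansion is valid, each proportion stays within half
  -- of its limit, and the error of the expansion costs at most half of the quartic term and half of
  -- the quadratic term.
  set η := min η₁ (min (m₀ / (4 * d)) (min (κ / (2 * C₁)) (b / (8 * C₁)))) with hη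
  have hη0 : 0 < η := by positivity
  have hη1 : η ≤ η₁ := min_le_left _ _
  have hη2 : η ≤ m₀ / (4 * d) := (min_le_right _ _).trans (min_le_left _ _)
  have hη3 : η ≤ κ / (2 * C₁) :=
    (min_le_right _ _).trans ((min_le_right _ _).trans (min_le_left _ _))
  have hη4 : η ≤ b / (8 * C₁) :=
    (min_le_right _ _).trans ((min_le_right _ _).trans (min_le_right _ _))
  have hη2' : 4 * (d * η) ≤ m₀ := by
    rw [le_div_iff₀ (by positivity)] at hη2
    linarith
  have hη3' : C₁ * η ≤ κ / 2 := by
    rw [le_div_iff₀ (by positivity)] at hη3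
    linarith
  have hη4' : 2 * (C₁ * η) ≤ b / 4 := by
    rw [le_div_iff₀ (by positivity)] at hη4
    linarith
  set K := (d + 1) / m₀ * d with hK
  have hK0 : 0 < K := by positivity
  refine ⟨κ, hκ, b, hb, 3 * K + 3 * C₁ + |logPrefactor d s| + K * (1 + 2 * η), by positivity, η, hη0,
    fun N ρ hρ hN k hk hT hV => ?_⟩
  have hρ0 : 0 < ρ := by linarith
  have hN1 : (1 : ℝ) ≤ N := by rw [← hN]; exact one_le_pow₀ hρ
  have hN1' : 1 ≤ N := by exact_mod_cast hN1
  set ζ := latticePoint ρ (lowProp d s) k with hζ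
  set T := avg ζ with hTdef
  set V := dev ζ with hVdef
  set τ := T / ρ with hτdef
  set ν := (ρ ^ 2)⁻¹ • V with hνdef
  have hνi : ∀ i, ν i = V i / ρ ^ 2 := fun i => by
    simp only [hνdef, PiLp.smul_apply, smul_eq_mul]
    ring
  have hτ : |τ| = |T| / ρ := by rw [hτdef, abs_div, abs_of_pos hρ0]
  have hν : ‖ν‖ = ‖V‖ / ρ ^ 2 := by
    rw [hνdef, norm_smul, norm_inv, Real.norm_of_nonneg (by positivity)]
    ring
  have hτη : |τ| ≤ η := by rw [hτ, div_le_iff₀ hρ0]; exact hT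
  have hνη : ‖ν‖ ≤ η := by rw [hν, div_le_iff₀ (by positivity)]; exact hV
  have hν0 : ∑ i, ν i = 0 := by
    simp only [hνi, ← Finset.sum_div]
    rw [sum_dev hd, zero_div]
  have hprop : proportions N k =
      colorVec (highProp d s - d * τ) fun i => lowProp d s + τ + ν i := by
    rw [proportions_eq hd s hρ0 hN hk]
    simp only [hνi]
    rfl
  -- the Stirling prefactor
  have hdiff : ∀ r, |(k r : ℝ) / N - xs (d + 1) s r| ≤ d * (|τ| + ‖ν‖) := by
    intro r
    have e : (k r : ℝ) / N = proportions N k r := rfl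
    rw [e, hprop, xs_eq_colorVec]
    have hτν : |τ| + ‖ν‖ ≤ d * (|τ| + ‖ν‖) :=
      le_mul_of_one_le_left (by positivity) hd1
    refine Fin.cases ?_ (fun i => ?_) r
    · simp only [colorVec_zero]
      rw [sub_sub_cancel_left, abs_neg, abs_mul, abs_of_pos hd0]
      gcongr
      linarith [norm_nonneg ν]
    · simp only [colorVec_succ]
      rw [show lowProp d s + τ + ν i - lowProp d s = τ + ν i by ring]
      exact ((abs_add_le _ _).trans (by linarith [abs_apply_le_norm ν i])).trans hτν
  have hxs : ∀ r, m₀ ≤ xs (d + 1) s r := by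
    intro r
    rw [xs_eq_colorVec]
    refine Fin.cases ?_ (fun i => ?_) r
    · simpa using hm₀w
    · simpa using hm₀v
  have hpre : |∑ r, Real.log (stirlingRatio (k r) * √N) - logPrefactor d s| ≤
      K * (1 / N + (|τ| + ‖ν‖)) := by
    rw [logPrefactor, sub_neg_eq_add, ← Finset.sum_add_distrib]
    refine (Finset.abs_sum_le_sum_abs _ _).trans ?_
    have : ∀ r ∈ Finset.univ, |Real.log (stirlingRatio (k r) * √N) +
        Real.log (2 * Real.pi * xs (d + 1) s r) / 2| ≤
        1 / m₀ * d * (1 / N + (|τ| + ‖ν‖)) := by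
      intro r _
      have hmr : 0 < xs (d + 1) s r := hm₀.trans_le (hxs r)
      refine (abs_log_stirlingRatio_sub_le hN1' hmr ?_).trans ?_
      · refine (hdiff r).trans ?_
        have : d * (|τ| + ‖ν‖) ≤ d * (η + η) := by gcongr
        linarith [hxs r]
      · calc 1 / xs (d + 1) s r * (1 / N + |(k r : ℝ) / N - xs (d + 1) s r|)
            ≤ 1 / m₀ * (1 / N + d * (|τ| + ‖ν‖)) := by
              gcongr
              · exact hxs r
              · exact hdiff r
          _ ≤ 1 / m₀ * (d * (1 / N) + d * (|τ| + ‖ν‖)) := by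
              gcongr
              exact le_mul_of_one_le_left (by positivity) hd1
          _ = _ := by ring
    refine (Finset.sum_le_sum this).trans (le_of_eq ?_)
    simp [hK]
    ring
  have hener := hexp τ ν (hτη.trans hη1) (hνη.trans hη1) hν0
  rw [← hprop] at hener
  rw [log_latticeWeight p β h hN1']
  set S := ∑ r, Real.log (stirlingRatio (k r) * √N)
  set D := negFreeEnergy p β h (proportions N k) - negFreeEnergy p β h (xs (d + 1) s)
  -- The scales `τ = T / ρ` and `ν = V / ρ²` are those for which `N τ⁴` and `N ‖ν‖²` are of order
  -- one.
  have hscaled : N * (κ * τ ^ 4 + b / 2 * ‖ν‖ ^ 2) = κ * T ^ 4 + b / 2 * ‖V‖ ^ 2 := by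
    rw [hν, hτdef, ← hN]
    field_simp
  have hmain : |N * D + (κ * T ^ 4 + b / 2 * ‖V‖ ^ 2)| ≤
      N * (C₁ * (|τ| ^ 5 + (|τ| + ‖ν‖) * ‖ν‖ ^ 2)) := by
    rw [← hscaled, ← mul_add, abs_mul, abs_of_pos (by linarith : (0 : ℝ) < N), ← add_assoc]
    gcongr
  have hTζ : |T| ≤ ‖ζ‖ := abs_avg_le hd ζ
  have hVζ : ‖V‖ ≤ ‖ζ‖ := norm_dev_le hd ζ
  have hζ0 := norm_nonneg ζ
  set R := 1 + ‖ζ‖ with hR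
  have hR1 : 1 ≤ R := by linarith
  have hTR : |T| ≤ R := by linarith
  have hVR : ‖V‖ ≤ R := by linarith
  have hR5 : ∀ j ≤ 5, R ^ j ≤ R ^ 5 := fun j hj => pow_le_pow_right₀ hR1 hj
  have hτρ : |τ| ≤ R / ρ := by rw [hτ]; gcongr
  have hνρ : ‖ν‖ ≤ R / ρ := by
    rw [hν]
    have : ρ ≤ ρ ^ 2 := by nlinarith
    gcongr
  -- The accurate bound: `N |τ|⁵ = |T|⁵ / ρ`, the mixed error gains a factor `1 / ρ` as well, and so
  -- does the Stirling prefactor, at the cost of at most a fifth power of `1 + ‖ζ‖`.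
  constructor
  · have e1 : K * (1 / N + (|τ| + ‖ν‖)) ≤ 3 * K / ρ * R ^ 5 := by
      have h1 : 1 / (N : ℝ) ≤ R ^ 5 / ρ := by
        rw [← hN]
        have h1 : (1 : ℝ) ≤ R ^ 5 := one_le_pow₀ hR1
        have h2 : ρ ≤ ρ ^ 4 := le_self_pow₀ hρ (by norm_num)
        gcongr
      have h2 : R / ρ ≤ R ^ 5 / ρ := by
        have := hR5 1 (by norm_num)
        rw [pow_one] at this
        gcongr
      calc K * (1 / N + (|τ| + ‖ν‖)) ≤ K * (R ^ 5 / ρ + (R ^ 5 / ρ + R ^ 5 / ρ)) := by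
            gcongr <;> linarith
        _ = _ := by ring
    have e2 : N * (C₁ * (|τ| ^ 5 + (|τ| + ‖ν‖) * ‖ν‖ ^ 2)) ≤ 3 * C₁ / ρ * R ^ 5 := by
      have h1 : N * |τ| ^ 5 ≤ R ^ 5 / ρ := by
        rw [hτ, ← hN, show ρ ^ 4 * (|T| / ρ) ^ 5 = |T| ^ 5 / ρ by field_simp]
        gcongr
      have h2 : N * ((|τ| + ‖ν‖) * ‖ν‖ ^ 2) ≤ 2 * (R ^ 5 / ρ) := by
        rw [← hN]
        have : (|τ| + ‖ν‖) ≤ 2 * (R / ρ) := by linarith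
        calc ρ ^ 4 * ((|τ| + ‖ν‖) * ‖ν‖ ^ 2) ≤ ρ ^ 4 * (2 * (R / ρ) * ‖ν‖ ^ 2) := by gcongr
          _ = 2 * (R / ρ) * ‖V‖ ^ 2 := by rw [hν]; field_simp
          _ ≤ 2 * (R / ρ) * R ^ 2 := by gcongr
          _ = 2 * (R ^ 3 / ρ) := by ring
          _ ≤ 2 * (R ^ 5 / ρ) := by
            gcongr 2 * (?_ / ρ)
            exact hR5 3 (by norm_num)
      calc N * (C₁ * (|τ| ^ 5 + (|τ| + ‖ν‖) * ‖ν‖ ^ 2)) =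
            C₁ * (N * |τ| ^ 5 + N * ((|τ| + ‖ν‖) * ‖ν‖ ^ 2)) := by ring
        _ ≤ C₁ * (R ^ 5 / ρ + 2 * (R ^ 5 / ρ)) := by gcongr
        _ = _ := by ring
    have e3 : |S + N * D - (logPrefactor d s - (κ * T ^ 4 + b / 2 * ‖V‖ ^ 2))| ≤
        3 * K / ρ * R ^ 5 + 3 * C₁ / ρ * R ^ 5 := by
      rw [show S + N * D - (logPrefactor d s - (κ * T ^ 4 + b / 2 * ‖V‖ ^ 2)) =
        (S - logPrefactor d s) + (N * D + (κ * T ^ 4 + b / 2 * ‖V‖ ^ 2)) by ring]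
      exact (abs_add_le _ _).trans (add_le_add (hpre.trans e1) (hmain.trans e2))
    refine e3.trans ?_
    rw [← add_mul, ← add_div]
    refine mul_le_mul_of_nonneg_right (div_le_div_of_nonneg_right ?_ hρ0.le) (by positivity)
    linarith [abs_nonneg (logPrefactor d s), mul_pos hK0 (by linarith : 0 < 1 + 2 * η)]
  -- The crude bound, without polynomial loss: on the whole neighbourhood the error is at most a
  -- constant plus half of the main terms, which preserves the decay where the accurate bound is
  -- useless.
  · have e1 : K * (1 / N + (|τ| + ‖ν‖)) ≤ K * (1 + 2 * η) := by
      have : 1 / (N : ℝ) ≤ 1 := by rw [div_le_one (by linarith)]; exact hN1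
      gcongr
      linarith
    have e2 : N * (C₁ * (|τ| ^ 5 + (|τ| + ‖ν‖) * ‖ν‖ ^ 2)) ≤
        κ / 2 * T ^ 4 + b / 4 * ‖V‖ ^ 2 := by
      have h1 : N * (C₁ * |τ| ^ 5) ≤ κ / 2 * T ^ 4 := by
        have hT4 : |T| ^ 4 = T ^ 4 := by rw [← abs_pow, abs_of_nonneg (by positivity)]
        calc N * (C₁ * |τ| ^ 5) = C₁ * |τ| * (N * |τ| ^ 4) := by ring
          _ = C₁ * |τ| * T ^ 4 := by
            rw [hτ, ← hN, ← hT4]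
            field_simp
          _ ≤ C₁ * η * T ^ 4 := by gcongr
          _ ≤ _ := by gcongr
      have h2 : N * (C₁ * ((|τ| + ‖ν‖) * ‖ν‖ ^ 2)) ≤ b / 4 * ‖V‖ ^ 2 := by
        calc N * (C₁ * ((|τ| + ‖ν‖) * ‖ν‖ ^ 2)) = C₁ * (|τ| + ‖ν‖) * (N * ‖ν‖ ^ 2) := by ring
          _ = C₁ * (|τ| + ‖ν‖) * ‖V‖ ^ 2 := by
            rw [hν, ← hN]
            field_simp
          _ ≤ C₁ * (η + η) * ‖V‖ ^ 2 := by gcongr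
          _ ≤ _ := by
            gcongr
            linarith
      linarith
    have h1 := (abs_le.1 (hpre.trans e1)).2
    have h2 := (abs_le.1 (hmain.trans e2)).2
    have h3 := le_abs_self (logPrefactor d s)
    linarith

theorem latticeWeight_le (p : ℕ) (β h : ℝ) {N q : ℕ} {ρ : ℝ} (hN : ρ ^ 4 = N)
    (m : EuclideanSpace ℝ (Fin q)) (k : Fin q → ℕ) :
    latticeWeight p β h N m k ≤ ρ ^ (2 * q) *
      Real.exp (ρ ^ 4 * (negFreeEnergy p β h (proportions N k) - negFreeEnergy p β h m)) := by
  have hs : √(N : ℝ) = ρ ^ 2 := by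
    rw [← hN, show ρ ^ 4 = (ρ ^ 2) ^ 2 by ring, Real.sqrt_sq (by positivity)]
  rw [latticeWeight, hN, hs]
  refine mul_le_mul_of_nonneg_right ?_ (Real.exp_pos _).le
  calc ∏ r, stirlingRatio (k r) * ρ ^ 2 ≤ ∏ _r : Fin q, ρ ^ 2 := by
        refine Finset.prod_le_prod
          (fun r _ => mul_nonneg (stirlingRatio_pos _).le (by positivity)) fun r _ => ?_
        exact mul_le_of_le_one_left (by positivity) (stirlingRatio_le_one _)
    _ = _ := by simp [← pow_mul]

theorem proportions_mem {N q : ℕ} (hN : 1 ≤ N) {k : Fin q → ℕ} (hk : ∑ r, k r = N) :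
    proportions N k ∈ probVectors q := by
  have hN0 : (0 : ℝ) < N := by exact_mod_cast hN
  refine ⟨fun r => div_nonneg (Nat.cast_nonneg _) hN0.le, ?_⟩
  simp only [proportions]
  rw [← Finset.sum_div, ← Nat.cast_sum, hk, div_self hN0.ne']

/-- The weights far from the maximizer are exponentially small. -/
theorem IsTypeISpecial.exists_latticeWeight_far {p d : ℕ} (hd : 1 ≤ d)
    {β h s : ℝ} (hsp : IsTypeISpecial p (d + 1) β h s) {η : ℝ} (hη : 0 < η) :
    ∃ c > 0, ∃ C > 0, ∀ (N : ℕ) (ρ : ℝ), 1 ≤ ρ → ρ ^ 4 = N →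
      ∀ k : Fin (d + 1) → ℕ, ∑ r, k r = N →
      (η * ρ < |avg (latticePoint ρ (lowProp d s) k)| ∨
      η * ρ ^ 2 < ‖dev (latticePoint ρ (lowProp d s) k)‖) →
      latticeWeight p β h N (xs (d + 1) s) k ≤
        C / ρ * Real.exp (-(c * ‖latticePoint ρ (lowProp d s) k‖ ^ 2)) := by
  obtain ⟨c₀, hc₀, hgap⟩ := hsp.isUniqueMaximizer.exists_gap hη
  have hd0 : (0 : ℝ) < d := by exact_mod_cast hd
  have hd1 : (1 : ℝ) ≤ d := by exact_mod_cast hd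
  obtain ⟨C₁, hC₁, habs⟩ := exists_pow_mul_exp_neg_sq_le (half_pos hc₀) (2 * (d + 1) + 1)
  refine ⟨c₀ / (18 * d ^ 2), by positivity, C₁, hC₁, fun N ρ hρ hN k hk hfar => ?_⟩
  have hρ0 : 0 < ρ := by linarith
  have hN1 : 1 ≤ N := by
    have : (1 : ℝ) ≤ N := by rw [← hN]; exact one_le_pow₀ hρ
    exact_mod_cast this
  have hv := lowProp_pos (d := d) hsp.lt_one
  have hv1 : |lowProp d s| ≤ 1 := by
    rw [abs_of_pos hv]
    have := highProp_add d s
    have := highProp_pos (d := d) hsp.nonneg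
    nlinarith
  have hnorm := norm_latticePoint_le hd hv1 hρ hN hk
  have hprop := proportions_eq hd s hρ0 hN hk
  set ζ := latticePoint ρ (lowProp d s) k
  -- A large mean displaces the first proportion by `d |τ|`. A large deviation is felt through the
  -- other colours: the cross terms with the mean cancel because the deviations sum to zero.
  have hdist : η ≤ ‖proportions N k - xs (d + 1) s‖ := by
    rcases hfar with hT | hV
    · refine le_trans ?_ (abs_apply_le_norm _ 0)
      rw [hprop, xs_eq_colorVec]
      simp only [PiLp.sub_apply, colorVec_zero]
      rw [sub_sub_cancel_left, abs_neg, abs_mul, abs_of_pos hd0, abs_div, abs_of_pos hρ0]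
      have : η ≤ |avg ζ| / ρ := by rw [le_div_iff₀ hρ0]; exact hT.le
      nlinarith
    · refine abs_le_of_sq_le_sq' ?_ (norm_nonneg _) |>.2
      have h1 : ‖dev ζ‖ ^ 2 / ρ ^ 4 ≤ ‖proportions N k - xs (d + 1) s‖ ^ 2 := by
        rw [EuclideanSpace.real_norm_sq_eq, EuclideanSpace.real_norm_sq_eq, hprop, xs_eq_colorVec,
          Fin.sum_univ_succ]
        simp only [PiLp.sub_apply, colorVec_zero, colorVec_succ]
        have e : ∀ i, (lowProp d s + avg ζ / ρ + dev ζ i / ρ ^ 2 - lowProp d s) ^ 2 =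
            (avg ζ / ρ) ^ 2 + 2 * (avg ζ / ρ) / ρ ^ 2 * dev ζ i + dev ζ i ^ 2 / ρ ^ 4 := by
          intro i
          field_simp
          ring
        simp only [e, Finset.sum_add_distrib, ← Finset.mul_sum, sum_dev hd, Finset.sum_div]
        have : 0 ≤ ∑ _i : Fin d, (avg ζ / ρ) ^ 2 := Finset.sum_nonneg fun _ _ => sq_nonneg _
        have := sq_nonneg (highProp d s - d * (avg ζ / ρ) - highProp d s)
        linarith
      refine le_trans ?_ h1
      rw [le_div_iff₀ (by positivity)]
      calc η ^ 2 * ρ ^ 4 = (η * ρ ^ 2) ^ 2 := by ring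
        _ ≤ ‖dev ζ‖ ^ 2 := pow_le_pow_left₀ (by positivity) hV.le 2
  have hgap' := hgap _ (proportions_mem hN1 hk) hdist
  refine (latticeWeight_le p β h hN _ k).trans ?_
  -- Half of the factor `exp (-c₀ N)` pays for the prefactor and for the extra `1 / ρ`. The other
  -- half is at most a Gaussian in `ζ`, because `‖ζ‖ ≤ 3 d ρ²` on the lattice; this is where `18 d²`
  -- comes from.
  have h1 : ρ ^ (2 * (d + 1)) * ρ * Real.exp (-(c₀ / 2 * (ρ ^ 2) ^ 2)) ≤ C₁ := by
    have h2 := habs (ρ ^ 2) (by positivity)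
    have h3 : ρ ^ (2 * (d + 1)) * ρ ≤ (1 + ρ ^ 2) ^ (2 * (d + 1) + 1) := by
      rw [← pow_succ]
      exact pow_le_pow_left₀ hρ0.le (by nlinarith) _
    have h4 : C₁ * Real.exp (-(c₀ / 2 / 2 * (ρ ^ 2) ^ 2)) ≤ C₁ * 1 := by
      gcongr
      rw [Real.exp_le_one_iff]
      have : 0 ≤ c₀ / 2 / 2 * (ρ ^ 2) ^ 2 := by positivity
      linarith
    calc _ ≤ (1 + ρ ^ 2) ^ (2 * (d + 1) + 1) * Real.exp (-(c₀ / 2 * (ρ ^ 2) ^ 2)) := by gcongr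
      _ ≤ C₁ := by linarith
  have h5 : c₀ / (18 * d ^ 2) * ‖ζ‖ ^ 2 ≤ c₀ / 2 * ρ ^ 4 := by
    calc c₀ / (18 * d ^ 2) * ‖ζ‖ ^ 2 ≤ c₀ / (18 * d ^ 2) * (3 * d * ρ ^ 2) ^ 2 := by gcongr
      _ = _ := by field_simp; ring
  calc ρ ^ (2 * (d + 1)) *
        Real.exp (ρ ^ 4 * (negFreeEnergy p β h (proportions N k) -
          negFreeEnergy p β h (xs (d + 1) s)))
      ≤ ρ ^ (2 * (d + 1)) * Real.exp (ρ ^ 4 * (-c₀)) := by gcongr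
    _ = (ρ ^ (2 * (d + 1)) * ρ * Real.exp (-(c₀ / 2 * (ρ ^ 2) ^ 2))) / ρ *
        Real.exp (-(c₀ / 2 * ρ ^ 4)) := by
      have : Real.exp (ρ ^ 4 * (-c₀)) =
          Real.exp (-(c₀ / 2 * (ρ ^ 2) ^ 2)) * Real.exp (-(c₀ / 2 * ρ ^ 4)) := by
        rw [← Real.exp_add]
        ring_nf
      rw [this]
      field_simp
    _ ≤ C₁ / ρ * Real.exp (-(c₀ / (18 * d ^ 2) * ‖ζ‖ ^ 2)) := by gcongr

/-- Pointwise approximation of the weights by the limiting density. -/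
theorem IsTypeISpecial.exists_latticeWeight_approx {p d : ℕ} (hp : 2 ≤ p) (hd : 1 ≤ d)
    {β h s : ℝ} (hβ : 0 < β) (hsp : IsTypeISpecial p (d + 1) β h s) :
    ∃ κ > 0, ∃ b > 0, ∃ c > 0, ∃ C > 0, ∀ (N : ℕ) (ρ : ℝ), 1 ≤ ρ → ρ ^ 4 = N →
      ∀ k : Fin (d + 1) → ℕ, ∑ r, k r = N →
      |latticeWeight p β h N (xs (d + 1) s) k - Real.exp (logPrefactor d s) *
        refWeight κ b (latticePoint ρ (lowProp d s) k)| ≤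
        C / ρ * Real.exp (-(c * ‖latticePoint ρ (lowProp d s) k‖ ^ 2)) := by
  obtain ⟨κ, hκ, b, hb, C₁, hC₁, η, hη, hnear⟩ := hsp.exists_log_latticeWeight_near hp hd hβ
  obtain ⟨c₂, hc₂, C₂, hC₂, hfar⟩ := hsp.exists_latticeWeight_far hd hη
  obtain ⟨c₃, hc₃, C₃, hC₃, href⟩ := exists_refWeight_le hd (κ₀ := κ / 2) (b₀ := b / 2)
    (by positivity) (by positivity)
  obtain ⟨C₄, hC₄, habs⟩ := exists_pow_mul_exp_neg_sq_le hc₃ 5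
  set A := Real.exp (logPrefactor d s) with hA
  have hA0 : 0 < A := Real.exp_pos _
  set c := min c₂ (c₃ / 2) with hc
  refine ⟨κ, hκ, b, hb, c, by positivity, C₁ * (Real.exp C₁ + A) * C₃ * C₄ + (C₂ + A * C₃ * C₄ / η),
    by positivity, fun N ρ hρ hN k hk => ?_⟩
  have hρ0 : 0 < ρ := by linarith
  have hN1 : 1 ≤ N := by
    have : (1 : ℝ) ≤ N := by rw [← hN]; exact one_le_pow₀ hρ
    exact_mod_cast this
  have hWpos := latticeWeight_pos p β h hN1 (xs (d + 1) s) k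
  have hn := hnear N ρ hρ hN k hk
  have hf := hfar N ρ hρ hN k hk
  set ζ := latticePoint ρ (lowProp d s) k
  set W := latticeWeight p β h N (xs (d + 1) s) k
  have hc₂' : Real.exp (-(c₂ * ‖ζ‖ ^ 2)) ≤ Real.exp (-(c * ‖ζ‖ ^ 2)) := by
    gcongr
    exact min_le_left _ _
  have hc₃' : Real.exp (-(c₃ / 2 * ‖ζ‖ ^ 2)) ≤ Real.exp (-(c * ‖ζ‖ ^ 2)) := by
    gcongr
    exact min_le_right _ _
  have hab := (habs ‖ζ‖ (norm_nonneg _)).trans (mul_le_mul_of_nonneg_left hc₃' hC₄.le)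
  have hr1 := href κ b (by linarith) (by linarith) ζ
  by_cases hcase : |avg ζ| ≤ η * ρ ∧ ‖dev ζ‖ ≤ η * ρ ^ 2
  · obtain ⟨h1, h2⟩ := hn hcase.1 hcase.2
    have hW : W = Real.exp (Real.log W) := (Real.exp_log hWpos).symm
    have hR : A * refWeight κ b ζ =
        Real.exp (logPrefactor d s - (κ * avg ζ ^ 4 + b / 2 * ‖dev ζ‖ ^ 2)) := by
      rw [refWeight, hA, ← Real.exp_add]
      ring_nf
    have hW2 : W ≤ Real.exp C₁ * (C₃ * Real.exp (-(c₃ * ‖ζ‖ ^ 2))) := by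
      refine le_trans ?_ (mul_le_mul_of_nonneg_left
        (href (κ / 2) (b / 2) le_rfl le_rfl ζ) (Real.exp_pos _).le)
      rw [hW, refWeight, ← Real.exp_add]
      refine Real.exp_le_exp.2 (h2.trans (le_of_eq ?_))
      ring
    have h3 := abs_exp_sub_exp_le (Real.log W)
      (logPrefactor d s - (κ * avg ζ ^ 4 + b / 2 * ‖dev ζ‖ ^ 2))
    rw [← hW, ← hR] at h3
    calc |W - A * refWeight κ b ζ|
        ≤ C₁ / ρ * (1 + ‖ζ‖) ^ 5 * (Real.exp C₁ * (C₃ * Real.exp (-(c₃ * ‖ζ‖ ^ 2))) +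
          A * (C₃ * Real.exp (-(c₃ * ‖ζ‖ ^ 2)))) := by
          refine h3.trans ?_
          have : 0 ≤ A * refWeight κ b ζ := (mul_pos hA0 (refWeight_pos κ b ζ)).le
          gcongr
      _ = (C₁ * (Real.exp C₁ + A) * C₃) / ρ *
          ((1 + ‖ζ‖) ^ 5 * Real.exp (-(c₃ * ‖ζ‖ ^ 2))) := by ring
      _ ≤ (C₁ * (Real.exp C₁ + A) * C₃) / ρ * (C₄ * Real.exp (-(c * ‖ζ‖ ^ 2))) := by gcongr
      _ = (C₁ * (Real.exp C₁ + A) * C₃ * C₄) / ρ * Real.exp (-(c * ‖ζ‖ ^ 2)) := by ring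
      _ ≤ _ := by
          gcongr
          have : 0 < C₂ + A * C₃ * C₄ / η := by positivity
          linarith
  · have hcase' : η * ρ < |avg ζ| ∨ η * ρ ^ 2 < ‖dev ζ‖ := by
      by_contra! hcon
      exact hcase hcon
    have h1 := (hf hcase').trans
      (mul_le_mul_of_nonneg_left hc₂' (by positivity : 0 ≤ C₂ / ρ))
    have hζ : η * ρ ≤ ‖ζ‖ := by
      rcases hcase' with h2 | h2
      · exact h2.le.trans (abs_avg_le hd ζ)
      · refine le_trans ?_ (h2.le.trans (norm_dev_le hd ζ))
        gcongr
        nlinarith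
    have h2 : A * refWeight κ b ζ ≤ (A * C₃ * C₄ / η) / ρ * Real.exp (-(c * ‖ζ‖ ^ 2)) := by
      -- Far from the maximizer `‖ζ‖ ≥ η ρ`, so this factor can be inserted freely; it provides the
      -- `1 / ρ`, and its numerator is absorbed by the envelope.
      have h3 : 1 ≤ (1 + ‖ζ‖) ^ 5 / (η * ρ) := by
        rw [one_le_div (by positivity)]
        have h0 := norm_nonneg ζ
        have : 1 + ‖ζ‖ ≤ (1 + ‖ζ‖) ^ 5 := le_self_pow₀ (by linarith) (by norm_num)
        linarith
      calc A * refWeight κ b ζ ≤ A * (C₃ * Real.exp (-(c₃ * ‖ζ‖ ^ 2))) * 1 := by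
            rw [mul_one]; gcongr
        _ ≤ A * (C₃ * Real.exp (-(c₃ * ‖ζ‖ ^ 2))) * ((1 + ‖ζ‖) ^ 5 / (η * ρ)) := by gcongr
        _ = A * C₃ / η / ρ * ((1 + ‖ζ‖) ^ 5 * Real.exp (-(c₃ * ‖ζ‖ ^ 2))) := by
            field_simp
        _ ≤ A * C₃ / η / ρ * (C₄ * Real.exp (-(c * ‖ζ‖ ^ 2))) := by gcongr
        _ = _ := by ring
    have h3 : 0 < A * refWeight κ b ζ := mul_pos hA0 (refWeight_pos κ b ζ)
    have h4 : |W - A * refWeight κ b ζ| ≤ W + A * refWeight κ b ζ :=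
      abs_le.2 ⟨by linarith, by linarith⟩
    calc |W - A * refWeight κ b ζ| ≤ (C₂ + A * C₃ * C₄ / η) / ρ * Real.exp (-(c * ‖ζ‖ ^ 2)) := by
          refine h4.trans ((add_le_add h1 h2).trans (le_of_eq (by ring)))
      _ ≤ _ := by
          have : 0 < C₁ * (Real.exp C₁ + A) * C₃ * C₄ := by positivity
          refine mul_le_mul_of_nonneg_right (div_le_div_of_nonneg_right ?_ hρ0.le) (Real.exp_pos _).le
          linarith

/-- The limiting densities vary by `O(δ)` at distance `δ`. -/
theorem exists_refWeight_sub_le {d : ℕ} (hd : 1 ≤ d) {κ b : ℝ} (hκ : 0 < κ) (hb : 0 < b) (D : ℝ) :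
    ∃ c > 0, ∃ C > 0, ∀ (δ : ℝ) (ζ ζ' : EuclideanSpace ℝ (Fin d)), ‖ζ - ζ'‖ ≤ δ → δ ≤ D →
      |refWeight κ b ζ - refWeight κ b ζ'| ≤ C * δ * Real.exp (-(c * ‖ζ‖ ^ 2)) := by
  obtain ⟨c₃, hc₃, C₃, hC₃, href⟩ := exists_refWeight_le hd hκ hb
  obtain ⟨C₄, hC₄, habs⟩ := exists_pow_mul_exp_neg_sq_le (half_pos hc₃) 3
  set E := Real.exp (c₃ * D ^ 2)
  set K := κ * 4 * (1 + |D|) ^ 3 + b / 2 * (2 * (1 + |D|)) with hK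
  refine ⟨c₃ / 2 / 2, by positivity, K * (C₃ * (1 + E)) * C₄, by positivity,
    fun δ ζ ζ' hδ hD => ?_⟩
  have hδ0 : 0 ≤ δ := (norm_nonneg _).trans hδ
  have hT : |avg ζ - avg ζ'| ≤ δ := by
    rw [← avg_sub]
    exact (abs_avg_le hd _).trans hδ
  have hV : |‖dev ζ‖ - ‖dev ζ'‖| ≤ δ := by
    refine (abs_norm_sub_norm_le _ _).trans ?_
    rw [← dev_sub]
    exact (norm_dev_le hd _).trans hδ
  have hδD : δ ≤ |D| := hD.trans (le_abs_self D)
  have hζ0 := norm_nonneg ζ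
  have hζ' : ‖ζ'‖ ≤ ‖ζ‖ + |D| := by
    have := norm_le_norm_add_norm_sub' ζ' ζ
    rw [norm_sub_rev] at this
    linarith
  have hR : ‖ζ‖ ≤ (1 + |D|) * (1 + ‖ζ‖) := by nlinarith [abs_nonneg D]
  have hR' : ‖ζ'‖ ≤ (1 + |D|) * (1 + ‖ζ‖) := by nlinarith [abs_nonneg D]
  set R := (1 + |D|) * (1 + ‖ζ‖) with hRdef
  have hR0 : 0 ≤ R := by positivity
  have t1 : |avg ζ| ≤ R := (abs_avg_le hd _).trans hR
  have t2 : |avg ζ'| ≤ R := (abs_avg_le hd _).trans hR'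
  have t3 : ‖dev ζ‖ ≤ R := (norm_dev_le hd _).trans hR
  have t4 : ‖dev ζ'‖ ≤ R := (norm_dev_le hd _).trans hR'
  have h1 : |avg ζ ^ 4 - avg ζ' ^ 4| ≤ δ * (4 * R ^ 3) := by
    rw [show avg ζ ^ 4 - avg ζ' ^ 4 = (avg ζ - avg ζ') * (avg ζ ^ 3 + avg ζ ^ 2 * avg ζ' +
      avg ζ * avg ζ' ^ 2 + avg ζ' ^ 3) by ring, abs_mul]
    gcongr
    refine (abs_add_le _ _).trans ((add_le_add_left ((abs_add_le _ _).trans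
      (add_le_add_left (abs_add_le _ _) _)) _).trans ?_)
    simp only [abs_mul, abs_pow]
    calc |avg ζ| ^ 3 + |avg ζ| ^ 2 * |avg ζ'| + |avg ζ| * |avg ζ'| ^ 2 + |avg ζ'| ^ 3
        ≤ R ^ 3 + R ^ 2 * R + R * R ^ 2 + R ^ 3 := by gcongr
      _ = 4 * R ^ 3 := by ring
  have h2 : |‖dev ζ‖ ^ 2 - ‖dev ζ'‖ ^ 2| ≤ δ * (2 * R) := by
    rw [sq_sub_sq, mul_comm, abs_mul, abs_of_nonneg (by positivity : 0 ≤ ‖dev ζ‖ + ‖dev ζ'‖)]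
    gcongr
    linarith
  have h3 : |-(κ * avg ζ ^ 4 + b / 2 * ‖dev ζ‖ ^ 2) - -(κ * avg ζ' ^ 4 + b / 2 * ‖dev ζ'‖ ^ 2)| ≤
      K * δ * (1 + ‖ζ‖) ^ 3 := by
    rw [show -(κ * avg ζ ^ 4 + b / 2 * ‖dev ζ‖ ^ 2) - -(κ * avg ζ' ^ 4 + b / 2 * ‖dev ζ'‖ ^ 2) =
      -(κ * (avg ζ ^ 4 - avg ζ' ^ 4) + b / 2 * (‖dev ζ‖ ^ 2 - ‖dev ζ'‖ ^ 2)) by ring, abs_neg]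
    refine (abs_add_le _ _).trans ?_
    rw [abs_mul, abs_mul, abs_of_pos hκ, abs_of_pos (half_pos hb)]
    have h4 : (1 + ‖ζ‖) ≤ (1 + ‖ζ‖) ^ 3 := le_self_pow₀ (by linarith) (by norm_num)
    calc κ * |avg ζ ^ 4 - avg ζ' ^ 4| + b / 2 * |‖dev ζ‖ ^ 2 - ‖dev ζ'‖ ^ 2|
        ≤ κ * (δ * (4 * R ^ 3)) + b / 2 * (δ * (2 * R)) := by gcongr
      _ = κ * 4 * (1 + |D|) ^ 3 * δ * (1 + ‖ζ‖) ^ 3 + b / 2 * (2 * (1 + |D|)) * δ * (1 + ‖ζ‖) := by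
          rw [hRdef]; ring
      _ ≤ κ * 4 * (1 + |D|) ^ 3 * δ * (1 + ‖ζ‖) ^ 3 +
          b / 2 * (2 * (1 + |D|)) * δ * (1 + ‖ζ‖) ^ 3 := by gcongr
      _ = _ := by rw [hK]; ring
  have h4 := exp_neg_norm_sq_shift hc₃ (hδ.trans hD)
  have h5 : refWeight κ b ζ ≤ C₃ * Real.exp (-(c₃ / 2 * ‖ζ‖ ^ 2)) := by
    refine (href κ b le_rfl le_rfl ζ).trans ?_
    gcongr
    linarith
  have h6 : refWeight κ b ζ' ≤ C₃ * (E * Real.exp (-(c₃ / 2 * ‖ζ‖ ^ 2))) :=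
    (href κ b le_rfl le_rfl ζ').trans (by gcongr)
  have h7 := habs ‖ζ‖ hζ0
  calc |refWeight κ b ζ - refWeight κ b ζ'|
      ≤ K * δ * (1 + ‖ζ‖) ^ 3 * (C₃ * Real.exp (-(c₃ / 2 * ‖ζ‖ ^ 2)) +
        C₃ * (E * Real.exp (-(c₃ / 2 * ‖ζ‖ ^ 2)))) :=
        (abs_exp_sub_exp_le _ _).trans
          (mul_le_mul h3 (add_le_add h5 h6) (by positivity) (by positivity))
    _ = K * (C₃ * (1 + E)) * δ * ((1 + ‖ζ‖) ^ 3 * Real.exp (-(c₃ / 2 * ‖ζ‖ ^ 2))) := by ring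
    _ ≤ K * (C₃ * (1 + E)) * δ * (C₄ * Real.exp (-(c₃ / 2 / 2 * ‖ζ‖ ^ 2))) := by gcongr
    _ = _ := by ring

/-- The limiting densities are Lipschitz functions of their parameters. -/
theorem exists_refWeight_param_sub_le {d : ℕ} (hd : 1 ≤ d) {κ₀ b₀ : ℝ} (hκ₀ : 0 < κ₀)
    (hb₀ : 0 < b₀) : ∃ c > 0, ∃ C > 0, ∀ κ b κ' b' : ℝ, κ₀ ≤ κ → b₀ ≤ b → κ₀ ≤ κ' → b₀ ≤ b' →
      ∀ ζ : EuclideanSpace ℝ (Fin d), |refWeight κ b ζ - refWeight κ' b' ζ| ≤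
        C * (|κ - κ'| + |b - b'|) * Real.exp (-(c * ‖ζ‖ ^ 2)) := by
  obtain ⟨c₃, hc₃, C₃, hC₃, href⟩ := exists_refWeight_le hd hκ₀ hb₀
  obtain ⟨C₄, hC₄, habs⟩ := exists_pow_mul_exp_neg_sq_le hc₃ 4
  refine ⟨c₃ / 2, by positivity, 2 * C₃ * C₄, by positivity, fun κ b κ' b' hκ hb hκ' hb' ζ => ?_⟩
  have hζ0 := norm_nonneg ζ
  have h1 : avg ζ ^ 4 ≤ (1 + ‖ζ‖) ^ 4 := by
    have := abs_avg_le hd ζ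
    rw [← abs_of_nonneg (by positivity : 0 ≤ avg ζ ^ 4), abs_pow]
    gcongr
    linarith
  have h2 : ‖dev ζ‖ ^ 2 ≤ (1 + ‖ζ‖) ^ 4 := by
    have h3 : ‖dev ζ‖ ≤ 1 + ‖ζ‖ := by linarith [norm_dev_le hd ζ]
    calc ‖dev ζ‖ ^ 2 ≤ (1 + ‖ζ‖) ^ 2 := by gcongr
      _ ≤ (1 + ‖ζ‖) ^ 4 := pow_le_pow_right₀ (by linarith) (by norm_num)
  have h3 : |-(κ * avg ζ ^ 4 + b / 2 * ‖dev ζ‖ ^ 2) - -(κ' * avg ζ ^ 4 + b' / 2 * ‖dev ζ‖ ^ 2)| ≤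
      (|κ - κ'| + |b - b'|) * (1 + ‖ζ‖) ^ 4 := by
    rw [show -(κ * avg ζ ^ 4 + b / 2 * ‖dev ζ‖ ^ 2) - -(κ' * avg ζ ^ 4 + b' / 2 * ‖dev ζ‖ ^ 2) =
      -((κ - κ') * avg ζ ^ 4 + (b - b') * (‖dev ζ‖ ^ 2 / 2)) by ring, abs_neg]
    refine (abs_add_le _ _).trans ?_
    rw [abs_mul, abs_mul, abs_of_nonneg (by positivity : 0 ≤ avg ζ ^ 4),
      abs_of_nonneg (by positivity : 0 ≤ ‖dev ζ‖ ^ 2 / 2), add_mul]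
    gcongr
    linarith [sq_nonneg ‖dev ζ‖]
  calc |refWeight κ b ζ - refWeight κ' b' ζ|
      ≤ (|κ - κ'| + |b - b'|) * (1 + ‖ζ‖) ^ 4 * (C₃ * Real.exp (-(c₃ * ‖ζ‖ ^ 2)) +
        C₃ * Real.exp (-(c₃ * ‖ζ‖ ^ 2))) :=
        (abs_exp_sub_exp_le _ _).trans (mul_le_mul h3
          (add_le_add (href κ b hκ hb ζ) (href κ' b' hκ' hb' ζ)) (by positivity) (by positivity))
    _ = 2 * C₃ * (|κ - κ'| + |b - b'|) * ((1 + ‖ζ‖) ^ 4 * Real.exp (-(c₃ * ‖ζ‖ ^ 2))) := by ring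
    _ ≤ 2 * C₃ * (|κ - κ'| + |b - b'|) * (C₄ * Real.exp (-(c₃ / 2 * ‖ζ‖ ^ 2))) :=
        mul_le_mul_of_nonneg_left (habs ‖ζ‖ hζ0) (by positivity)
    _ = _ := by ring

/-! ### Cells -/

/-- The cell of the points that are rounded down to `k`. -/
def cell {d : ℕ} (ρ v : ℝ) (k : Fin (d + 1) → ℕ) : Set (EuclideanSpace ℝ (Fin d)) :=
  {ζ | ∀ i, ⌊scale ρ v ζ i⌋ = (k i.succ : ℤ)}

/-- The lattice point of the cell of a point. -/
def roundPt {d : ℕ} (ρ v : ℝ) (ζ : EuclideanSpace ℝ (Fin d)) : EuclideanSpace ℝ (Fin d) :=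
  unscale ρ v fun i => (⌊scale ρ v ζ i⌋ : ℝ)

/-- The step function whose value on each cell is the weight of the lattice point. -/
def stepWeight {d : ℕ} (ρ v : ℝ) (N : ℕ) (W : (Fin (d + 1) → ℕ) → ℝ)
    (ζ : EuclideanSpace ℝ (Fin d)) : ℝ :=
  ∑ k ∈ Finset.piAntidiag Finset.univ N, (cell ρ v k).indicator (fun _ => W k) ζ

theorem roundPt_of_mem_cell {d : ℕ} {ρ v : ℝ} {k : Fin (d + 1) → ℕ}
    {ζ : EuclideanSpace ℝ (Fin d)} (h : ζ ∈ cell ρ v k) : roundPt ρ v ζ = latticePoint ρ v k := by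
  unfold roundPt latticePoint
  congr 1
  ext i
  rw [h i]
  simp

theorem norm_sub_roundPt_le {d : ℕ} (hd : 1 ≤ d) {ρ : ℝ} (hρ : 1 ≤ ρ) (v : ℝ)
    (ζ : EuclideanSpace ℝ (Fin d)) : ‖ζ - roundPt ρ v ζ‖ ≤ 3 * d / ρ ^ 2 := by
  have h := norm_unscale_sub_le hd hρ v (y := scale ρ v ζ)
    (y' := fun i => (⌊scale ρ v ζ i⌋ : ℝ)) fun i => by
      rw [abs_le]
      constructor <;> linarith [Int.floor_le (scale ρ v ζ i), Int.lt_floor_add_one (scale ρ v ζ i)]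
  rwa [unscale_scale hd (by linarith : 0 < ρ) v ζ] at h

/-- A cell fixes only the last `d` counts; the first one is recovered from the total `N`. -/
theorem cell_injective {d N : ℕ} {ρ v : ℝ} {k k' : Fin (d + 1) → ℕ} (hk : ∑ r, k r = N)
    (hk' : ∑ r, k' r = N) {ζ : EuclideanSpace ℝ (Fin d)} (h : ζ ∈ cell ρ v k)
    (h' : ζ ∈ cell ρ v k') : k = k' := by
  have hs : ∀ i : Fin d, k i.succ = k' i.succ := fun i => by
    have := (h i).symm.trans (h' i)
    exact_mod_cast this
  rw [Fin.sum_univ_succ] at hk hk'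
  rw [Finset.sum_congr rfl fun i _ => hs i] at hk
  ext r
  refine Fin.cases ?_ (fun i => hs i) r
  omega

theorem mem_piAntidiag_univ {q N : ℕ} {k : Fin q → ℕ} :
    k ∈ Finset.piAntidiag Finset.univ N ↔ ∑ r, k r = N := by
  simp [Finset.mem_piAntidiag]

theorem stepWeight_of_mem_cell {d N : ℕ} {ρ v : ℝ} (W : (Fin (d + 1) → ℕ) → ℝ)
    {k : Fin (d + 1) → ℕ} (hk : ∑ r, k r = N) {ζ : EuclideanSpace ℝ (Fin d)}
    (h : ζ ∈ cell ρ v k) : stepWeight ρ v N W ζ = W k := by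
  rw [stepWeight, Finset.sum_eq_single k]
  · rw [Set.indicator_of_mem h]
  · intro k' hk' hne
    refine Set.indicator_of_notMem (fun h' => hne ?_) _
    exact cell_injective (mem_piAntidiag_univ.1 hk') hk h' h
  · intro hn
    exact absurd (mem_piAntidiag_univ.2 hk) hn

theorem stepWeight_eq_zero {d N : ℕ} {ρ v : ℝ} (W : (Fin (d + 1) → ℕ) → ℝ)
    {ζ : EuclideanSpace ℝ (Fin d)}
    (h : ∀ k : Fin (d + 1) → ℕ, ∑ r, k r = N → ζ ∉ cell ρ v k) : stepWeight ρ v N W ζ = 0 :=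
  Finset.sum_eq_zero fun k hk => Set.indicator_of_notMem (h k (mem_piAntidiag_univ.1 hk)) _

/-- The points outside all the cells are far from the origin. -/
theorem norm_ge_of_not_mem_cell {d N : ℕ} (hd : 1 ≤ d) {ρ v : ℝ} (hρ : 1 ≤ ρ) (hN : ρ ^ 4 = N)
    {ζ : EuclideanSpace ℝ (Fin d)}
    (h : ∀ k : Fin (d + 1) → ℕ, ∑ r, k r = N → ζ ∉ cell ρ v k) :
    min (v / 3) ((1 - d * v) / d) * ρ ≤ ‖ζ‖ := by
  have hd0 : (0 : ℝ) < d := by exact_mod_cast hd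
  have hρ0 : 0 < ρ := by linarith
  have hT := abs_avg_le hd ζ
  -- A point outside all the cells has either a negative floor or floors of total more than `N`. In
  -- the first case some coordinate has dropped by `ρ⁴ v`, in the second the mean has risen by at
  -- least `ρ⁴ (1 - d v) / d`; both displacements are of order `ρ` after rescaling.
  by_cases hneg : ∃ i, ⌊scale ρ v ζ i⌋ < 0
  · obtain ⟨i, hi⟩ := hneg
    have hi' : scale ρ v ζ i < 0 := by
      have := Int.lt_floor_add_one (scale ρ v ζ i)
      have h1 : (⌊scale ρ v ζ i⌋ : ℝ) + 1 ≤ 0 := by exact_mod_cast hi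
      linarith
    have hV := abs_apply_le_norm ζ i
    have h1 : v / 3 * ρ ≤ ‖ζ‖ := by
      rw [scale] at hi'
      have e1 : -(ρ ^ 3 * avg ζ) ≤ ρ ^ 3 * ‖ζ‖ := by
        nlinarith [(abs_le.1 hT).1, pow_pos hρ0 3]
      have e2 : -(ρ ^ 2 * (ζ i - avg ζ)) ≤ ρ ^ 2 * (2 * ‖ζ‖) := by
        nlinarith [(abs_le.1 hT).2, (abs_le.1 hV).1, pow_pos hρ0 2]
      have e3 : ρ ^ 2 * (2 * ‖ζ‖) ≤ ρ ^ 3 * (2 * ‖ζ‖) := by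
        gcongr
        norm_num
      have e4 : ρ ^ 3 * (v * ρ) ≤ ρ ^ 3 * (3 * ‖ζ‖) := by
        rw [show ρ ^ 3 * (v * ρ) = ρ ^ 4 * v by ring]
        linarith
      have := le_of_mul_le_mul_left e4 (pow_pos hρ0 3)
      linarith
    exact (mul_le_mul_of_nonneg_right (min_le_left _ _) hρ0.le).trans h1
  · push Not at hneg
    have hsum : (N : ℤ) < ∑ i, ⌊scale ρ v ζ i⌋ := by
      by_contra! hle
      set y : Fin d → ℕ := fun i => ⌊scale ρ v ζ i⌋.toNat
      have hy : ∀ i, (y i : ℤ) = ⌊scale ρ v ζ i⌋ := fun i => Int.toNat_of_nonneg (hneg i)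
      have hle' : ∑ i, y i ≤ N := by
        have : (∑ i, (y i : ℤ)) ≤ N := by
          rw [Finset.sum_congr rfl fun i _ => hy i]
          exact hle
        exact_mod_cast this
      refine h (Fin.cons (N - ∑ i, y i) y) ?_ fun i => ?_
      · rw [Fin.sum_univ_succ]
        simp
        omega
      · simp [hy]
    have h1 : ρ ^ 4 ≤ d * (ρ ^ 4 * v + ρ ^ 3 * avg ζ) := by
      rw [hN, ← hN, ← sum_scale hd, hN]
      have : (N : ℝ) ≤ ∑ i, (⌊scale ρ v ζ i⌋ : ℝ) := by exact_mod_cast hsum.le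
      exact this.trans (Finset.sum_le_sum fun i _ => Int.floor_le _)
    have h2 : (1 - d * v) / d * ρ ≤ ‖ζ‖ := by
      have e : ρ ^ 3 * ((1 - d * v) * ρ) ≤ ρ ^ 3 * (d * avg ζ) := by
        rw [show ρ ^ 3 * ((1 - d * v) * ρ) = ρ ^ 4 - d * (ρ ^ 4 * v) by ring]
        linarith
      have := le_of_mul_le_mul_left e (pow_pos hρ0 3)
      rw [div_mul_eq_mul_div, div_le_iff₀ hd0]
      nlinarith [(abs_le.1 hT).2]
    exact (mul_le_mul_of_nonneg_right (min_le_right _ _) hρ0.le).trans h2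

/-- Approximation of the step weight by the limiting density. -/
theorem IsTypeISpecial.exists_stepWeight_approx {p d : ℕ} (hp : 2 ≤ p) (hd : 1 ≤ d)
    {β h s : ℝ} (hβ : 0 < β) (hsp : IsTypeISpecial p (d + 1) β h s) :
    ∃ κ > 0, ∃ b > 0, ∃ c > 0, ∃ C > 0, ∀ (N : ℕ) (ρ : ℝ), 1 ≤ ρ → ρ ^ 4 = N →
      ∀ ζ : EuclideanSpace ℝ (Fin d),
      |stepWeight ρ (lowProp d s) N (latticeWeight p β h N (xs (d + 1) s)) ζ -
        Real.exp (logPrefactor d s) * refWeight κ b ζ| ≤ C / ρ * Real.exp (-(c * ‖ζ‖ ^ 2)) := by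
  obtain ⟨κ, hκ, b, hb, c₁, hc₁, C₁, hC₁, h₁⟩ := hsp.exists_latticeWeight_approx hp hd hβ
  obtain ⟨c₂, hc₂, C₂, hC₂, h₂⟩ := exists_refWeight_sub_le hd hκ hb (3 * d)
  obtain ⟨c₃, hc₃, C₃, hC₃, h₃⟩ := exists_refWeight_le hd hκ hb
  obtain ⟨C₄, hC₄, habs⟩ := exists_pow_mul_exp_neg_sq_le hc₃ 1
  have hd0 : (0 : ℝ) < d := by exact_mod_cast hd
  have hv := lowProp_pos (d := d) hsp.lt_one
  have hw : 0 < 1 - d * lowProp d s := by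
    linarith [highProp_add d s, highProp_pos (d := d) hsp.nonneg]
  set v := lowProp d s
  set A := Real.exp (logPrefactor d s)
  have hA0 : 0 < A := Real.exp_pos _
  set c := min (c₁ / 2) (min c₂ (c₃ / 2)) with hc
  have hcc₁ : c ≤ c₁ / 2 := min_le_left _ _
  have hcc₂ : c ≤ c₂ := (min_le_right _ _).trans (min_le_left _ _)
  have hcc₃ : c ≤ c₃ / 2 := (min_le_right _ _).trans (min_le_right _ _)
  set r₀ := min (v / 3) ((1 - d * v) / d)
  have hr₀ : 0 < r₀ := by positivity
  refine ⟨κ, hκ, b, hb, c, by positivity, (C₁ * Real.exp (c₁ * (3 * d) ^ 2) + A * (C₂ * (3 * d))) +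
    A * C₃ * C₄ / r₀, by positivity, fun N ρ hρ hN ζ => ?_⟩
  have hρ0 : 0 < ρ := by linarith
  -- Inside a cell the weight is compared with the limiting density at the lattice point, and the
  -- latter with its value at `ζ`. Outside the cells the step function vanishes, and the limiting
  -- density is itself `O(1/ρ)` since `‖ζ‖` is at least `r₀ ρ`.
  by_cases hcell : ∃ k : Fin (d + 1) → ℕ, ∑ r, k r = N ∧ ζ ∈ cell ρ v k
  · obtain ⟨k, hk, hζ⟩ := hcell
    rw [stepWeight_of_mem_cell _ hk hζ]
    have hround := norm_sub_roundPt_le hd hρ v ζ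
    rw [roundPt_of_mem_cell hζ] at hround
    have hρ2 : 3 * d / ρ ^ 2 ≤ 3 * d / ρ := by
      gcongr
      nlinarith
    have hle3 : 3 * d / ρ ^ 2 ≤ 3 * d := div_le_self (by positivity) (one_le_pow₀ hρ)
    have e1 := h₁ N ρ hρ hN k hk
    have e2 := h₂ (3 * d / ρ ^ 2) ζ (latticePoint ρ v k) hround hle3
    have e3 := exp_neg_norm_sq_shift hc₁ (hround.trans hle3)
    have e4 : Real.exp (-(c₁ / 2 * ‖ζ‖ ^ 2)) ≤ Real.exp (-(c * ‖ζ‖ ^ 2)) := by gcongr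
    have e5 : Real.exp (-(c₂ * ‖ζ‖ ^ 2)) ≤ Real.exp (-(c * ‖ζ‖ ^ 2)) := by gcongr
    set W := latticeWeight p β h N (xs (d + 1) s) k
    calc |W - A * refWeight κ b ζ|
        = |(W - A * refWeight κ b (latticePoint ρ v k)) -
          A * (refWeight κ b ζ - refWeight κ b (latticePoint ρ v k))| := by ring_nf
      _ ≤ |W - A * refWeight κ b (latticePoint ρ v k)| +
          |A * (refWeight κ b ζ - refWeight κ b (latticePoint ρ v k))| := abs_sub _ _
      _ ≤ C₁ / ρ * (Real.exp (c₁ * (3 * d) ^ 2) * Real.exp (-(c * ‖ζ‖ ^ 2))) +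
          A * (C₂ * (3 * d / ρ) * Real.exp (-(c * ‖ζ‖ ^ 2))) := by
          rw [abs_mul, abs_of_pos hA0]
          refine add_le_add (e1.trans ?_) (mul_le_mul_of_nonneg_left (e2.trans ?_) hA0.le)
          · refine mul_le_mul_of_nonneg_left (e3.trans ?_) (by positivity)
            gcongr
          · gcongr
      _ = (C₁ * Real.exp (c₁ * (3 * d) ^ 2) + A * (C₂ * (3 * d))) / ρ *
          Real.exp (-(c * ‖ζ‖ ^ 2)) := by ring
      _ ≤ _ := by
          refine mul_le_mul_of_nonneg_right (div_le_div_of_nonneg_right ?_ hρ0.le)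
            (Real.exp_pos _).le
          have : 0 < A * C₃ * C₄ / r₀ := by positivity
          linarith
  · push Not at hcell
    rw [stepWeight_eq_zero _ hcell, zero_sub, abs_neg,
      abs_of_pos (mul_pos hA0 (refWeight_pos κ b ζ))]
    have hfar := norm_ge_of_not_mem_cell hd hρ hN hcell
    have h0 := norm_nonneg ζ
    have h6 : 1 ≤ (1 + ‖ζ‖) ^ 1 / (r₀ * ρ) := by
      rw [one_le_div (by positivity)]
      linarith
    have e4 : Real.exp (-(c₃ / 2 * ‖ζ‖ ^ 2)) ≤ Real.exp (-(c * ‖ζ‖ ^ 2)) := by gcongr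
    calc A * refWeight κ b ζ ≤ A * (C₃ * Real.exp (-(c₃ * ‖ζ‖ ^ 2))) * 1 := by
          rw [mul_one]
          gcongr
          exact h₃ κ b le_rfl le_rfl ζ
      _ ≤ A * (C₃ * Real.exp (-(c₃ * ‖ζ‖ ^ 2))) * ((1 + ‖ζ‖) ^ 1 / (r₀ * ρ)) := by gcongr
      _ = A * C₃ / r₀ / ρ * ((1 + ‖ζ‖) ^ 1 * Real.exp (-(c₃ * ‖ζ‖ ^ 2))) := by field_simp
      _ ≤ A * C₃ / r₀ / ρ * (C₄ * Real.exp (-(c * ‖ζ‖ ^ 2))) := by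
          refine mul_le_mul_of_nonneg_left ((habs _ h0).trans ?_) (by positivity)
          gcongr
      _ = (A * C₃ * C₄ / r₀) / ρ * Real.exp (-(c * ‖ζ‖ ^ 2)) := by ring
      _ ≤ _ := by
          refine mul_le_mul_of_nonneg_right (div_le_div_of_nonneg_right ?_ hρ0.le)
            (Real.exp_pos _).le
          have : 0 < C₁ * Real.exp (c₁ * (3 * d) ^ 2) + A * (C₂ * (3 * d)) := by positivity
          linarith

/-! ### Sums over the lattice as integrals -/

theorem measurable_scale {d : ℕ} (ρ v : ℝ) (i : Fin d) :
    Measurable fun ζ : EuclideanSpace ℝ (Fin d) => scale ρ v ζ i := by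
  have := (continuous_avg (d := d)).measurable
  unfold scale
  fun_prop

theorem measurable_roundPt {d : ℕ} (ρ v : ℝ) :
    Measurable (roundPt ρ v : EuclideanSpace ℝ (Fin d) → EuclideanSpace ℝ (Fin d)) := by
  have h : Measurable fun ζ : EuclideanSpace ℝ (Fin d) =>
      fun i : Fin d => (⌊scale ρ v ζ i⌋ : ℝ) :=
    measurable_pi_lambda _ fun i =>
      (measurable_from_top (f := fun n : ℤ => (n : ℝ))).comp (measurable_scale ρ v i).floor
  have h2 : Continuous fun y : Fin d → ℝ => unscale ρ v y := by
    unfold unscale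
    refine (PiLp.continuous_toLp 2 _).comp (continuous_pi fun i => ?_)
    fun_prop
  exact h2.measurable.comp h

theorem measurableSet_cell {d : ℕ} (ρ v : ℝ) (k : Fin (d + 1) → ℕ) :
    MeasurableSet (cell ρ v k) := by
  have : cell ρ v k = ⋂ i : Fin d, {ζ | ⌊scale ρ v ζ i⌋ = (k i.succ : ℤ)} := by
    ext ζ
    simp [cell]
  rw [this]
  exact MeasurableSet.iInter fun i =>
    (measurable_scale ρ v i).floor (measurableSet_singleton (k i.succ : ℤ))

theorem measurable_stepWeight {d : ℕ} (ρ v : ℝ) (N : ℕ) (W : (Fin (d + 1) → ℕ) → ℝ) :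
    Measurable (stepWeight ρ v N W) :=
  Finset.measurable_sum _ fun k _ => measurable_const.indicator (measurableSet_cell ρ v k)

/-- All cells are preimages of translated unit cubes under one invertible linear map. Their common
volume cancels in expectations and is not computed. -/
theorem exists_volume_cell {d : ℕ} (hd : 1 ≤ d) {ρ : ℝ} (hρ : 0 < ρ) (v : ℝ) :
    ∃ V > 0, ∀ k : Fin (d + 1) → ℕ,
      volume (cell ρ v k : Set (EuclideanSpace ℝ (Fin d))) = ENNReal.ofReal V := by
  have havg : ∀ x y : EuclideanSpace ℝ (Fin d), avg (x + y) = avg x + avg y := fun x y => by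
    simp [avg, Finset.sum_add_distrib, add_div]
  have havg' : ∀ (a : ℝ) (x : EuclideanSpace ℝ (Fin d)), avg (a • x) = a * avg x := fun a x => by
    simp [avg, ← Finset.mul_sum, mul_div_assoc]
  let L : EuclideanSpace ℝ (Fin d) →ₗ[ℝ] EuclideanSpace ℝ (Fin d) :=
    { toFun := fun ζ => WithLp.toLp 2 fun i => ρ ^ 3 * avg ζ + ρ ^ 2 * (ζ i - avg ζ)
      map_add' := fun x y => by
        ext i
        simp [havg]
        ring
      map_smul' := fun a x => by
        ext i
        simp [havg']
        ring }
  have hLs : ∀ ζ i, scale ρ v ζ i = ρ ^ 4 * v + L ζ i := fun ζ i => by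
    simp only [L, scale, LinearMap.coe_mk, AddHom.coe_mk]
    ring
  have hinj : Function.Injective L := by
    intro x y hxy
    have : scale ρ v x = scale ρ v y := by
      ext i
      rw [hLs, hLs, hxy]
    rw [← unscale_scale hd hρ v x, this, unscale_scale hd hρ v y]
  have hdet : LinearMap.det L ≠ 0 := by
    intro h0
    have := LinearMap.bot_lt_ker_of_det_eq_zero h0
    rw [LinearMap.ker_eq_bot.2 hinj] at this
    exact lt_irrefl _ this
  refine ⟨|(LinearMap.det L)⁻¹|, by positivity, fun k => ?_⟩
  have hcell : cell ρ v k = L ⁻¹' ((WithLp.ofLp : EuclideanSpace ℝ (Fin d) → Fin d → ℝ) ⁻¹'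
      Set.pi Set.univ fun i : Fin d =>
        Set.Ico ((k i.succ : ℝ) - ρ ^ 4 * v) (k i.succ - ρ ^ 4 * v + 1)) := by
    ext ζ
    simp only [cell, Set.mem_ofPred_eq, Set.mem_preimage, Set.mem_pi, Set.mem_univ, true_imp_iff,
      Set.mem_Ico, Int.floor_eq_iff, hLs, Int.cast_natCast]
    refine forall_congr' fun i => ?_
    constructor <;> rintro ⟨h1, h2⟩ <;> constructor <;> linarith
  rw [hcell, Measure.addHaar_preimage_linearMap _ hdet,
    (PiLp.volume_preserving_ofLp (Fin d)).measure_preimage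
      (MeasurableSet.univ_pi fun i => measurableSet_Ico).nullMeasurableSet, Real.volume_pi_Ico]
  simp

theorem exists_integral_stepWeight_mul {d : ℕ} (hd : 1 ≤ d) {ρ : ℝ} (hρ : 0 < ρ) (v : ℝ) (N : ℕ)
    (W : (Fin (d + 1) → ℕ) → ℝ) :
    ∃ V > 0, ∀ G : EuclideanSpace ℝ (Fin d) → ℝ,
      ∫ ζ, stepWeight ρ v N W ζ * G (roundPt ρ v ζ) =
        V * ∑ k ∈ Finset.piAntidiag Finset.univ N, W k * G (latticePoint ρ v k) := by
  obtain ⟨V, hV, hvol⟩ := exists_volume_cell hd hρ v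
  refine ⟨V, hV, fun G => ?_⟩
  have e : ∀ ζ, stepWeight ρ v N W ζ * G (roundPt ρ v ζ) =
      ∑ k ∈ Finset.piAntidiag Finset.univ N,
        (cell ρ v k).indicator (fun _ => W k * G (latticePoint ρ v k)) ζ := by
    intro ζ
    rw [stepWeight, Finset.sum_mul]
    refine Finset.sum_congr rfl fun k _ => ?_
    by_cases h : ζ ∈ cell ρ v k
    · rw [Set.indicator_of_mem h, Set.indicator_of_mem h, roundPt_of_mem_cell h]
    · rw [Set.indicator_of_notMem h, Set.indicator_of_notMem h, zero_mul]
  simp only [e]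
  rw [integral_finsetSum, Finset.mul_sum]
  · refine Finset.sum_congr rfl fun k _ => ?_
    rw [integral_indicator_const _ (measurableSet_cell ρ v k), Measure.real, hvol k,
      ENNReal.toReal_ofReal hV.le, smul_eq_mul]
  · intro k _
    rw [integrable_indicator_iff (measurableSet_cell ρ v k)]
    refine integrableOn_const ?_
    rw [hvol k]
    exact ENNReal.ofReal_ne_top

/-- The expectation of a function of the coordinates as a ratio of integrals. -/
theorem expect_eq_integral {p d N : ℕ} (hd : 1 ≤ d) (hN : 1 ≤ N) {β h ρ : ℝ} (hρ : 0 < ρ) (v : ℝ)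
    (m : EuclideanSpace ℝ (Fin (d + 1))) (G : EuclideanSpace ℝ (Fin d) → ℝ) :
    (expect p β h fun x : Fin N → Fin (d + 1) => G (latticePoint ρ v (counts x))) =
      (∫ ζ, stepWeight ρ v N (latticeWeight p β h N m) ζ * G (roundPt ρ v ζ)) /
        ∫ ζ, stepWeight ρ v N (latticeWeight p β h N m) ζ := by
  obtain ⟨V, hV, hint⟩ := exists_integral_stepWeight_mul hd hρ v N (latticeWeight p β h N m)
  have h1 := hint fun _ => 1
  simp only [mul_one] at h1
  rw [expect_comp_counts hN (by omega) m fun k => G (latticePoint ρ v k), hint G, h1,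
    mul_div_mul_left _ _ hV.ne']

/-! ### Probability measures with unnormalized densities -/

/-- The probability measure with density proportional to `f`. -/
def normalized {E : Type*} [MeasureSpace E] (f : E → ℝ) : Measure E :=
  volume.withDensity fun x => ENNReal.ofReal (f x / ∫ y, f y)

section normalized

variable {E : Type*} [MeasureSpace E] {f : E → ℝ}

theorem isProbabilityMeasure_normalized (hf : Integrable f) (h0 : ∀ x, 0 ≤ f x)
    (hpos : 0 < ∫ x, f x) : IsProbabilityMeasure (normalized f) := by
  constructor
  rw [normalized, withDensity_apply _ MeasurableSet.univ, Measure.restrict_univ,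
    ← ofReal_integral_eq_lintegral_ofReal (hf.div_const _)
      (Filter.Eventually.of_forall fun x => div_nonneg (h0 x) hpos.le),
    integral_div, div_self hpos.ne', ENNReal.ofReal_one]

theorem lintegral_ofReal_mul_eq (hm : Measurable f)
    (hpos : 0 < ∫ x, f x) {g : E → ENNReal} (hg : Measurable g) :
    ∫⁻ x, ENNReal.ofReal (f x) * g x =
      ENNReal.ofReal (∫ x, f x) * ∫⁻ x, g x ∂(normalized f) := by
  rw [normalized, lintegral_withDensity_eq_lintegral_mul _ (by fun_prop) hg,
    ← lintegral_const_mul _ (by fun_prop)]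
  refine lintegral_congr fun x => ?_
  rw [Pi.mul_apply, ← mul_assoc, ← ENNReal.ofReal_mul hpos.le, mul_div_cancel₀ _ hpos.ne']

theorem integral_normalized (hm : Measurable f) (h0 : ∀ x, 0 ≤ f x)
    (hpos : 0 < ∫ x, f x) (g : E → ℝ) :
    ∫ x, g x ∂(normalized f) = (∫ x, f x * g x) / ∫ x, f x := by
  rw [normalized, integral_withDensity_eq_integral_toReal_smul (by fun_prop)
    (Filter.Eventually.of_forall fun x => ENNReal.ofReal_lt_top), ← integral_div]
  refine integral_congr_ae (Filter.Eventually.of_forall fun x => ?_)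
  simp only [smul_eq_mul]
  rw [ENNReal.toReal_ofReal (div_nonneg (h0 x) hpos.le)]
  ring

theorem integrable_normalized_iff (hm : Measurable f) (h0 : ∀ x, 0 ≤ f x)
    (hpos : 0 < ∫ x, f x) (g : E → ℝ) :
    Integrable g (normalized f) ↔ Integrable fun x => f x * g x := by
  rw [normalized, integrable_withDensity_iff_integrable_smul' (by fun_prop)
    (Filter.Eventually.of_forall fun x => ENNReal.ofReal_lt_top)]
  have e : (fun x => (ENNReal.ofReal (f x / ∫ y, f y)).toReal • g x) =
      fun x => (∫ y, f y)⁻¹ * (f x * g x) := by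
    ext x
    rw [ENNReal.toReal_ofReal (div_nonneg (h0 x) hpos.le), smul_eq_mul]
    ring
  rw [e]
  exact integrable_const_mul_iff (IsUnit.mk0 _ (inv_pos.2 hpos).ne') _

end normalized

/-- Evaluation on the whole space shows that the factor is one. It allows laws to be identified
without computing normalizing constants. -/
theorem measure_eq_of_proportional {E : Type*} [MeasurableSpace E] {μ ν : Measure E}
    [IsProbabilityMeasure μ] [IsProbabilityMeasure ν] (c : ENNReal)
    (h : ∀ S, MeasurableSet S → μ S = c * ν S) : μ = ν := by
  have hc := h Set.univ MeasurableSet.univ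
  rw [measure_univ, measure_univ, mul_one] at hc
  ext S hS
  rw [h S hS, ← hc, one_mul]

theorem quarticLaw_eq_normalized (a : ℝ) :
    quarticLaw a = normalized fun y : ℝ => Real.exp (-y ^ 4 / (4 * a)) := rfl

/-! ### Gaussian integrals -/

section gaussian

variable {E : Type*} [NormedAddCommGroup E] [InnerProductSpace ℝ E] [FiniteDimensional ℝ E]
  [MeasurableSpace E] [BorelSpace E]

theorem integrable_exp_neg_norm_sq {c : ℝ} (hc : 0 < c) :
    Integrable fun x : E => Real.exp (-(c * ‖x‖ ^ 2)) := by
  have h := (GaussianFourier.integrable_cexp_neg_mul_sq_norm_add (V := E)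
    (b := (c : ℂ)) (by simpa using hc) 0 0).norm
  refine h.congr (Filter.Eventually.of_forall fun x => ?_)
  simp only [Complex.norm_exp]
  norm_cast
  simp

theorem integral_exp_neg_norm_sq_pos {c : ℝ} (hc : 0 < c) :
    0 < ∫ x : E, Real.exp (-(c * ‖x‖ ^ 2)) :=
  integral_exp_pos (integrable_exp_neg_norm_sq hc)

theorem isProbabilityMeasure_gaussian {c : ℝ} (hc : 0 < c) :
    IsProbabilityMeasure (normalized fun x : E => Real.exp (-(c * ‖x‖ ^ 2))) :=
  isProbabilityMeasure_normalized (integrable_exp_neg_norm_sq hc) (fun _ => (Real.exp_pos _).le)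
    (integral_exp_neg_norm_sq_pos hc)

theorem charFun_gaussian {c : ℝ} (hc : 0 < c) (t : E) :
    charFun (normalized fun x : E => Real.exp (-(c * ‖x‖ ^ 2))) t =
      Complex.exp (-(‖t‖ ^ 2 / (4 * c) : ℝ)) := by
  have hpos := integral_exp_neg_norm_sq_pos (E := E) hc
  have hZ := GaussianFourier.integral_cexp_neg_mul_sq_norm_add (V := E) (b := (c : ℂ))
    (by simpa using hc) 0 0
  have hI := GaussianFourier.integral_cexp_neg_mul_sq_norm_add (V := E) (b := (c : ℂ))
    (by simpa using hc) Complex.I t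
  have hZ' : ((∫ x : E, Real.exp (-(c * ‖x‖ ^ 2)) : ℝ) : ℂ) =
      (Real.pi / c) ^ (Module.finrank ℝ E / 2 : ℂ) := by
    rw [← integral_complex_ofReal]
    simpa using hZ
  rw [charFun_apply, normalized, integral_withDensity_eq_integral_toReal_smul (by fun_prop)
    (Filter.Eventually.of_forall fun x => ENNReal.ofReal_lt_top)]
  have e : ∀ x : E, (ENNReal.ofReal (Real.exp (-(c * ‖x‖ ^ 2)) /
      ∫ y : E, Real.exp (-(c * ‖y‖ ^ 2)))).toReal • Complex.exp (inner ℝ x t * Complex.I) =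
      Complex.exp (-c * ‖x‖ ^ 2 + Complex.I * inner ℝ t x) /
        ((∫ x : E, Real.exp (-(c * ‖x‖ ^ 2)) : ℝ) : ℂ) := by
    intro x
    rw [ENNReal.toReal_ofReal (by positivity), Complex.real_smul, Complex.exp_add,
      real_inner_comm]
    push_cast
    ring_nf
  simp only [e]
  rw [integral_div, hI, hZ', mul_div_cancel_left₀]
  · congr 1
    push_cast
    rw [Complex.I_sq]
    ring
  · rw [← hZ']
    exact_mod_cast hpos.ne'

end gaussian

/-! ### The limiting measure -/

theorem inner_eq_sum {d : ℕ} (x y : EuclideanSpace ℝ (Fin d)) :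
    inner ℝ x y = ∑ i, x i * y i := by
  simp [PiLp.inner_apply, mul_comm]

/-- The vector representing `avg`. -/
def avgVec (d : ℕ) : EuclideanSpace ℝ (Fin d) := WithLp.toLp 2 fun _ => 1 / (d : ℝ)

theorem inner_avgVec {d : ℕ} (ζ : EuclideanSpace ℝ (Fin d)) : inner ℝ ζ (avgVec d) = avg ζ := by
  rw [inner_eq_sum, avg, avgVec, Finset.sum_div]
  simp [div_eq_mul_inv]

theorem norm_avgVec_sq {d : ℕ} (hd : 1 ≤ d) : ‖avgVec d‖ ^ 2 = 1 / d := by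
  have : (d : ℝ) ≠ 0 := by positivity
  rw [EuclideanSpace.real_norm_sq_eq, avgVec]
  simp
  field_simp

theorem inner_dev_left {d : ℕ} (hd : 1 ≤ d) (x y : EuclideanSpace ℝ (Fin d)) :
    inner ℝ (dev x) y = inner ℝ x (dev y) := by
  simp only [inner_eq_sum, dev_apply, sub_mul, mul_sub, Finset.sum_sub_distrib, ← Finset.mul_sum,
    ← Finset.sum_mul, sum_eq_avg hd]
  ring

theorem avg_dev {d : ℕ} (hd : 1 ≤ d) (x : EuclideanSpace ℝ (Fin d)) : avg (dev x) = 0 := by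
  rw [avg, sum_dev hd, zero_div]

theorem dev_dev {d : ℕ} (hd : 1 ≤ d) (x : EuclideanSpace ℝ (Fin d)) : dev (dev x) = dev x := by
  ext i
  rw [dev_apply, avg_dev hd, sub_zero]

theorem inner_avgVec_dev {d : ℕ} (hd : 1 ≤ d) (x : EuclideanSpace ℝ (Fin d)) :
    inner ℝ (avgVec d) (dev x) = 0 := by
  rw [real_inner_comm, inner_avgVec, avg_dev hd]

/-- The centred Gaussian measure with covariance `b⁻¹`. -/
def gaussMeasure (d : ℕ) (b : ℝ) : Measure (EuclideanSpace ℝ (Fin d)) :=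
  normalized fun x => Real.exp (-(b / 2 * ‖x‖ ^ 2))

theorem charFun_gaussMeasure {d : ℕ} {b : ℝ} (hb : 0 < b) (t : EuclideanSpace ℝ (Fin d)) :
    charFun (gaussMeasure d b) t = Complex.exp (-(‖t‖ ^ 2 / (2 * b) : ℝ)) := by
  rw [gaussMeasure, charFun_gaussian (half_pos hb), show 4 * (b / 2) = 2 * b by ring]

theorem isProbabilityMeasure_gaussMeasure {d : ℕ} {b : ℝ} (hb : 0 < b) :
    IsProbabilityMeasure (gaussMeasure d b) :=
  isProbabilityMeasure_gaussian (half_pos hb)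

/-- Here `t'` is the image of `t` under the adjoint of `f`, for the linear maps to which this is
applied. -/
theorem charFun_map_eq {E F : Type*} [NormedAddCommGroup E] [InnerProductSpace ℝ E]
    [MeasurableSpace E] [BorelSpace E] [SecondCountableTopology E]
    [NormedAddCommGroup F] [InnerProductSpace ℝ F] [MeasurableSpace F] [BorelSpace F]
    [SecondCountableTopology F]
    (μ : Measure E) {f : E → F} (hf : Measurable f) (t : F) (t' : E)
    (h : ∀ x, inner ℝ (f x) t = inner ℝ x t') : charFun (μ.map f) t = charFun μ t' := by
  rw [charFun_apply, charFun_apply, integral_map hf.aemeasurable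
    (Measurable.aestronglyMeasurable (by fun_prop))]
  simp only [h]

theorem map_avg_gaussMeasure {d : ℕ} (hd : 1 ≤ d) {b : ℝ} (hb : 0 < b) :
    (gaussMeasure d b).map avg = normalized fun t : ℝ => Real.exp (-(b * d / 2 * ‖t‖ ^ 2)) := by
  have hd0 : (0 : ℝ) < d := by exact_mod_cast hd
  have := isProbabilityMeasure_gaussMeasure (d := d) hb
  have := isProbabilityMeasure_gaussian (E := ℝ) (c := b * d / 2) (by positivity)
  have := Measure.isProbabilityMeasure_map (μ := gaussMeasure d b)
    (continuous_avg (d := d)).measurable.aemeasurable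
  refine Measure.ext_of_charFun (funext fun t => ?_)
  rw [charFun_gaussian (by positivity),
    charFun_map_eq _ continuous_avg.measurable t (t • avgVec d), charFun_gaussMeasure hb]
  · rw [norm_smul, mul_pow, norm_avgVec_sq hd]
    congr 3
    field_simp
    ring
  · intro x
    rw [inner_smul_right, inner_avgVec]
    simp

/-- The vectors representing `avg` and `dev` are orthogonal, so by Pythagoras the characteristic
function of the pair factorizes. -/
theorem indepFun_avg_dev {d : ℕ} (hd : 1 ≤ d) {b : ℝ} (hb : 0 < b) :
    IndepFun avg dev (gaussMeasure d b) := by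
  have hma := (continuous_avg (d := d)).measurable
  have hmd := (continuous_dev (d := d)).measurable
  have := isProbabilityMeasure_gaussMeasure (d := d) hb
  rw [indepFun_iff_charFun_prod hma.aemeasurable hmd.aemeasurable]
  intro t
  rw [charFun_map_eq _ (by fun_prop) t (t.fst • avgVec d + dev t.snd),
    charFun_map_eq _ hma _ (t.fst • avgVec d), charFun_map_eq _ hmd _ (dev t.snd),
    charFun_gaussMeasure hb, charFun_gaussMeasure hb, charFun_gaussMeasure hb, ← Complex.exp_add,
    norm_add_sq_real, inner_smul_left, inner_avgVec_dev hd]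
  · congr 1
    push_cast
    simp
    ring
  · exact fun x => inner_dev_left hd x _
  · intro x
    rw [inner_smul_right, inner_avgVec]
    simp
  · intro x
    rw [inner_add_right, inner_smul_right, inner_avgVec, WithLp.prod_inner_apply,
      inner_dev_left hd]
    simp

/-- The limiting density is a rotation-invariant Gaussian reweighted by a function of `avg` alone.
With the independence of `avg` and `dev` this replaces a change of variables to longitudinal and
transverse coordinates. -/
theorem refWeight_eq_mul {d : ℕ} (hd : 1 ≤ d) (κ b : ℝ) (ζ : EuclideanSpace ℝ (Fin d)) :
    refWeight κ b ζ = Real.exp (-(b / 2 * ‖ζ‖ ^ 2)) *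
      Real.exp (-(κ * avg ζ ^ 4) + b * d / 2 * avg ζ ^ 2) := by
  rw [refWeight, ← Real.exp_add, norm_sq_eq_avg_dev hd ζ]
  ring_nf

theorem integrable_refWeight {d : ℕ} (hd : 1 ≤ d) {κ b : ℝ} (hκ : 0 < κ) (hb : 0 < b) :
    Integrable (refWeight κ b : EuclideanSpace ℝ (Fin d) → ℝ) := by
  obtain ⟨c, hc, C, hC, h⟩ := exists_refWeight_le hd hκ hb
  refine ((integrable_exp_neg_norm_sq hc).const_mul C).mono'
    (continuous_refWeight κ b).aestronglyMeasurable (Filter.Eventually.of_forall fun x => ?_)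
  rw [Real.norm_of_nonneg (refWeight_pos κ b x).le]
  exact h κ b le_rfl le_rfl x

theorem integral_refWeight_pos {d : ℕ} (hd : 1 ≤ d) {κ b : ℝ} (hκ : 0 < κ) (hb : 0 < b) :
    0 < ∫ ζ : EuclideanSpace ℝ (Fin d), refWeight κ b ζ :=
  integral_exp_pos (integrable_refWeight hd hκ hb)

/-- The limiting probability measure. -/
def refMeasure (d : ℕ) (κ b : ℝ) : Measure (EuclideanSpace ℝ (Fin d)) := normalized (refWeight κ b)

theorem isProbabilityMeasure_refMeasure {d : ℕ} (hd : 1 ≤ d) {κ b : ℝ} (hκ : 0 < κ) (hb : 0 < b) :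
    IsProbabilityMeasure (refMeasure d κ b) :=
  isProbabilityMeasure_normalized (integrable_refWeight hd hκ hb) (fun _ => (refWeight_pos _ _ _).le)
    (integral_refWeight_pos hd hκ hb)

theorem refMeasure_apply {d : ℕ} (hd : 1 ≤ d) {κ b : ℝ} (hκ : 0 < κ) (hb : 0 < b)
    {S : Set (EuclideanSpace ℝ (Fin d))} (hS : MeasurableSet S) :
    refMeasure d κ b S = (ENNReal.ofReal (∫ ζ : EuclideanSpace ℝ (Fin d), refWeight κ b ζ))⁻¹ *
      ENNReal.ofReal (∫ ζ : EuclideanSpace ℝ (Fin d), Real.exp (-(b / 2 * ‖ζ‖ ^ 2))) *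
      ∫⁻ ζ, ENNReal.ofReal (Real.exp (-(κ * avg ζ ^ 4) + b * d / 2 * avg ζ ^ 2)) *
        S.indicator 1 ζ ∂(gaussMeasure d b) := by
  have hpos := integral_refWeight_pos (d := d) hd hκ hb
  have hma := (continuous_avg (d := d)).measurable
  have h1 := lintegral_ofReal_mul_eq (continuous_refWeight (d := d) κ b).measurable
    hpos (g := S.indicator 1)
    (measurable_one.indicator hS)
  have h2 := lintegral_ofReal_mul_eq (E := EuclideanSpace ℝ (Fin d))
    (f := fun x => Real.exp (-(b / 2 * ‖x‖ ^ 2))) (by fun_prop)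
    (integral_exp_neg_norm_sq_pos (half_pos hb))
    (g := fun ζ => ENNReal.ofReal (Real.exp (-(κ * avg ζ ^ 4) + b * d / 2 * avg ζ ^ 2)) *
        S.indicator 1 ζ) (Measurable.mul (by fun_prop) (measurable_one.indicator hS))
  rw [lintegral_indicator_one hS] at h1
  rw [mul_assoc, gaussMeasure, ← h2, refMeasure]
  rw [← ENNReal.mul_right_inj (a := ENNReal.ofReal (∫ ζ : EuclideanSpace ℝ (Fin d),
    refWeight κ b ζ)) (by simpa using hpos) ENNReal.ofReal_ne_top, ← h1, ← mul_assoc,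
    ENNReal.mul_inv_cancel (by simpa using hpos) ENNReal.ofReal_ne_top, one_mul]
  refine lintegral_congr fun ζ => ?_
  rw [← mul_assoc, ← ENNReal.ofReal_mul (Real.exp_pos _).le, ← refWeight_eq_mul hd]

/-- The reweighting depends only on `avg`, which is independent of `dev` under the Gaussian measure,
so it changes the law of `dev` only by a constant factor. -/
theorem map_dev_refMeasure {d : ℕ} (hd : 1 ≤ d) {κ b : ℝ} (hκ : 0 < κ) (hb : 0 < b) :
    (refMeasure d κ b).map dev = (gaussMeasure d b).map dev := by
  have hma := (continuous_avg (d := d)).measurable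
  have hmd := (continuous_dev (d := d)).measurable
  have := isProbabilityMeasure_gaussMeasure (d := d) hb
  have := isProbabilityMeasure_refMeasure hd hκ hb
  have := Measure.isProbabilityMeasure_map (μ := gaussMeasure d b) hmd.aemeasurable
  have := Measure.isProbabilityMeasure_map (μ := refMeasure d κ b) hmd.aemeasurable
  refine measure_eq_of_proportional
    ((ENNReal.ofReal (∫ ζ : EuclideanSpace ℝ (Fin d), refWeight κ b ζ))⁻¹ *
      ENNReal.ofReal (∫ ζ : EuclideanSpace ℝ (Fin d), Real.exp (-(b / 2 * ‖ζ‖ ^ 2))) *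
      ∫⁻ ζ, ENNReal.ofReal (Real.exp (-(κ * avg ζ ^ 4) + b * d / 2 * avg ζ ^ 2))
        ∂(gaussMeasure d b)) fun S hS => ?_
  rw [Measure.map_apply hmd hS, Measure.map_apply hmd hS, refMeasure_apply hd hκ hb (hmd hS),
    mul_assoc _ (∫⁻ _, _ ∂_)]
  congr 1
  have hind : IndepFun (fun ζ => ENNReal.ofReal (Real.exp (-(κ * avg ζ ^ 4) +
      b * d / 2 * avg ζ ^ 2))) (fun ζ => S.indicator (1 : EuclideanSpace ℝ (Fin d) → ENNReal) (dev ζ))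
      (gaussMeasure d b) :=
    (indepFun_avg_dev hd hb).comp
      (φ := fun t => ENNReal.ofReal (Real.exp (-(κ * t ^ 4) + b * d / 2 * t ^ 2)))
      (ψ := S.indicator (1 : EuclideanSpace ℝ (Fin d) → ENNReal)) (by fun_prop) (measurable_one.indicator hS)
  have h := lintegral_mul_eq_lintegral_mul_lintegral_of_indepFun (by fun_prop)
    ((measurable_one.indicator hS).comp hmd) hind
  have e : ∫⁻ ζ, S.indicator (1 : EuclideanSpace ℝ (Fin d) → ENNReal) (dev ζ) ∂(gaussMeasure d b) =
      gaussMeasure d b (dev ⁻¹' S) := by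
    rw [← lintegral_indicator_one (hmd hS)]
    rfl
  rw [← e]
  exact h

/-- Under the Gaussian measure `avg` has density proportional to `exp (-b d t² / 2)`; the
reweighting cancels this factor and leaves `exp (-κ t⁴)`. -/
theorem map_avg_refMeasure {d : ℕ} (hd : 1 ≤ d) {κ b : ℝ} (hκ : 0 < κ) (hb : 0 < b) :
    (refMeasure d κ b).map avg = quarticLaw (1 / (4 * κ)) := by
  have hd0 : (0 : ℝ) < d := by exact_mod_cast hd
  have hma := (continuous_avg (d := d)).measurable
  have := isProbabilityMeasure_gaussMeasure (d := d) hb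
  have := isProbabilityMeasure_refMeasure hd hκ hb
  have := isProbabilityMeasure_quarticLaw (a := 1 / (4 * κ)) (by positivity)
  have := Measure.isProbabilityMeasure_map (μ := refMeasure d κ b) hma.aemeasurable
  have hq : ∀ t : ℝ, -t ^ 4 / (4 * (1 / (4 * κ))) = -(κ * t ^ 4) := fun t => by
    field_simp
  have hposq : 0 < ∫ t : ℝ, Real.exp (-t ^ 4 / (4 * (1 / (4 * κ)))) :=
    integral_exp_pos (integrable_exp_quartic (by positivity))
  have hpos1 := integral_exp_neg_norm_sq_pos (E := ℝ) (c := b * d / 2) (by positivity)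
  refine measure_eq_of_proportional
    ((ENNReal.ofReal (∫ ζ : EuclideanSpace ℝ (Fin d), refWeight κ b ζ))⁻¹ *
      ENNReal.ofReal (∫ ζ : EuclideanSpace ℝ (Fin d), Real.exp (-(b / 2 * ‖ζ‖ ^ 2))) *
      ((ENNReal.ofReal (∫ t : ℝ, Real.exp (-(b * d / 2 * ‖t‖ ^ 2))))⁻¹ *
        ENNReal.ofReal (∫ t : ℝ, Real.exp (-t ^ 4 / (4 * (1 / (4 * κ))))))) fun S hS => ?_
  rw [Measure.map_apply hma hS, refMeasure_apply hd hκ hb (hma hS), mul_assoc _ (_⁻¹ * _)]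
  congr 1
  have e1 : ∫⁻ ζ, ENNReal.ofReal (Real.exp (-(κ * avg ζ ^ 4) + b * d / 2 * avg ζ ^ 2)) *
        (avg ⁻¹' S).indicator 1 ζ ∂(gaussMeasure d b) =
      ∫⁻ t, ENNReal.ofReal (Real.exp (-(κ * t ^ 4) + b * d / 2 * t ^ 2)) *
        S.indicator 1 t ∂((gaussMeasure d b).map avg) := by
    have hm : Measurable fun t : ℝ => ENNReal.ofReal (Real.exp (-(κ * t ^ 4) + b * d / 2 * t ^ 2)) *
        S.indicator 1 t := Measurable.mul (by fun_prop) (measurable_one.indicator hS)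
    rw [lintegral_map hm hma]
    rfl
  have h2 := lintegral_ofReal_mul_eq (E := ℝ)
    (f := fun x => Real.exp (-(b * d / 2 * ‖x‖ ^ 2))) (by fun_prop)
    hpos1
    (g := fun t => ENNReal.ofReal (Real.exp (-(κ * t ^ 4) + b * d / 2 * t ^ 2)) *
        S.indicator 1 t) (Measurable.mul (by fun_prop) (measurable_one.indicator hS))
  have h3 := lintegral_ofReal_mul_eq (E := ℝ)
    (f := fun t => Real.exp (-t ^ 4 / (4 * (1 / (4 * κ))))) (by fun_prop)
    hposq (g := S.indicator 1) (measurable_one.indicator hS)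
  rw [lintegral_indicator_one hS, ← quarticLaw_eq_normalized] at h3
  rw [e1, map_avg_gaussMeasure hd hb, mul_assoc, ← h3,
    ← ENNReal.mul_right_inj (a := ENNReal.ofReal (∫ t : ℝ, Real.exp (-(b * d / 2 * ‖t‖ ^ 2))))
      (by simpa using hpos1) ENNReal.ofReal_ne_top, ← h2, ← mul_assoc,
    ENNReal.mul_inv_cancel (by simpa using hpos1) ENNReal.ofReal_ne_top, one_mul]
  refine lintegral_congr fun t => ?_
  rw [← mul_assoc, ← ENNReal.ofReal_mul (Real.exp_pos _).le, ← Real.exp_add, hq,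
    Real.norm_eq_abs, sq_abs]
  ring_nf

/-! ### The transverse Gaussian law -/

/-- The coordinates of the colours other than the first one. -/
def tailVec {d : ℕ} (x : EuclideanSpace ℝ (Fin (d + 1))) : EuclideanSpace ℝ (Fin d) :=
  WithLp.toLp 2 fun i => x i.succ

/-- The transverse part of the vector of proportions with rescaled coordinates `ζ`. -/
def transverse {d : ℕ} (ζ : EuclideanSpace ℝ (Fin d)) : EuclideanSpace ℝ (Fin (d + 1)) :=
  colorVec 0 (dev ζ)

/-- The orthogonal projection onto the zero-sum vectors orthogonal to `u`. -/
def transverseProj (d : ℕ) : Matrix (Fin (d + 1)) (Fin (d + 1)) ℝ :=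
  Matrix.of fun i j => if i = 0 ∨ j = 0 then 0 else (if i = j then 1 else 0) - 1 / (d : ℝ)

theorem continuous_transverse {d : ℕ} :
    Continuous (transverse : EuclideanSpace ℝ (Fin d) → EuclideanSpace ℝ (Fin (d + 1))) := by
  unfold transverse colorVec
  refine (PiLp.continuous_toLp 2 _).comp (continuous_pi fun i => ?_)
  refine Fin.cases ?_ (fun i => ?_) i
  · exact continuous_const
  · simp only [Fin.cons_succ]
    exact (PiLp.continuous_apply 2 _ i).comp continuous_dev

theorem norm_transverse {d : ℕ} (ζ : EuclideanSpace ℝ (Fin d)) : ‖transverse ζ‖ = ‖dev ζ‖ := by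
  simp [EuclideanSpace.norm_eq, Fin.sum_univ_succ, transverse]

theorem transverse_sub {d : ℕ} (ζ ζ' : EuclideanSpace ℝ (Fin d)) :
    transverse ζ - transverse ζ' = transverse (ζ - ζ') := by
  ext i
  refine Fin.cases ?_ (fun i => ?_) i
  · simp [transverse]
  · simp [transverse, avg_sub]
    ring

theorem inner_transverse {d : ℕ} (hd : 1 ≤ d) (ζ : EuclideanSpace ℝ (Fin d))
    (x : EuclideanSpace ℝ (Fin (d + 1))) :
    inner ℝ (transverse ζ) x = inner ℝ ζ (dev (tailVec x)) := by
  rw [← inner_dev_left hd, inner_eq_sum, inner_eq_sum, Fin.sum_univ_succ]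
  simp [transverse, tailVec]

theorem toEuclideanCLM_transverseProj {d : ℕ} (x : EuclideanSpace ℝ (Fin (d + 1))) :
    Matrix.toEuclideanCLM (𝕜 := ℝ) (transverseProj d) x = transverse (tailVec x) := by
  ext i
  rw [Matrix.ofLp_toEuclideanCLM]
  refine Fin.cases ?_ (fun i => ?_) i
  · simp [Matrix.mulVec, dotProduct, transverseProj, transverse]
  · simp [Matrix.mulVec, dotProduct, transverseProj, transverse, Fin.sum_univ_succ, sub_mul,
      Finset.sum_sub_distrib, avg, tailVec, ← Finset.mul_sum, Finset.sum_ite_eq]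
    ring

theorem transverseProj_transpose (d : ℕ) : (transverseProj d).transpose = transverseProj d := by
  ext i j
  simp only [Matrix.transpose_apply, transverseProj, Matrix.of_apply, or_comm, eq_comm]

theorem dotProduct_transverseProj {d : ℕ} (hd : 1 ≤ d) (x : EuclideanSpace ℝ (Fin (d + 1))) :
    (WithLp.ofLp x) ⬝ᵥ (transverseProj d).mulVec (WithLp.ofLp x) = ‖dev (tailVec x)‖ ^ 2 := by
  have h := inner_transverse hd (tailVec x) x
  rw [← toEuclideanCLM_transverseProj, inner_eq_sum] at h
  rw [← real_inner_self_eq_norm_sq, inner_dev_left hd, dev_dev hd, ← h]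
  simp [dotProduct, mul_comm]

theorem posSemidef_transverseProj {d : ℕ} (hd : 1 ≤ d) {r : ℝ} (hr : 0 ≤ r) :
    (r • transverseProj d).PosSemidef := by
  refine Matrix.PosSemidef.of_dotProduct_mulVec_nonneg ?_ fun x => ?_
  · ext i j
    have := congrFun (congrFun (transverseProj_transpose d) i) j
    simp only [Matrix.transpose_apply] at this
    simp [Matrix.conjTranspose_apply, this]
  · have := dotProduct_transverseProj hd (WithLp.toLp 2 x)
    simp only [star_trivial, Matrix.smul_mulVec, dotProduct_smul, smul_eq_mul]
    simp only at this
    rw [this]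
    positivity

theorem charFun_multivariateGaussian_transverse {d : ℕ} (hd : 1 ≤ d) {r : ℝ} (hr : 0 ≤ r)
    (x : EuclideanSpace ℝ (Fin (d + 1))) :
    charFun (multivariateGaussian 0 (r • transverseProj d)) x =
      Complex.exp (-(r * ‖dev (tailVec x)‖ ^ 2 / 2 : ℝ)) := by
  rw [charFun_multivariateGaussian (posSemidef_transverseProj hd hr), Matrix.smul_mulVec,
    dotProduct_smul, dotProduct_transverseProj hd]
  simp

theorem map_transverse_refMeasure {d : ℕ} (hd : 1 ≤ d) {κ b : ℝ} (hκ : 0 < κ) (hb : 0 < b) :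
    (refMeasure d κ b).map transverse = multivariateGaussian 0 (b⁻¹ • transverseProj d) := by
  have hmd := (continuous_dev (d := d)).measurable
  have hmt := (continuous_transverse (d := d)).measurable
  have := isProbabilityMeasure_gaussMeasure (d := d) hb
  have := Measure.isProbabilityMeasure_map (μ := gaussMeasure d b) hmt.aemeasurable
  have e : (transverse : EuclideanSpace ℝ (Fin d) → _) = transverse ∘ dev := by
    ext ζ
    simp [transverse, dev_dev hd]
  have h : (refMeasure d κ b).map transverse = (gaussMeasure d b).map transverse := by
    rw [e, ← Measure.map_map hmt hmd, map_dev_refMeasure hd hκ hb, Measure.map_map hmt hmd]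
  rw [h]
  refine Measure.ext_of_charFun (funext fun x => ?_)
  rw [charFun_multivariateGaussian_transverse hd (inv_pos.2 hb).le,
    charFun_map_eq _ hmt x (dev (tailVec x)) fun ζ => inner_transverse hd ζ x,
    charFun_gaussMeasure hb]
  congr 3
  field_simp

/-- The projection is symmetric and idempotent, so the image has covariance `σ²` times it. This
presents the degenerate transverse law as a matrix image of the standard Gaussian, as the affine
invariance of a test class requires. -/
theorem map_stdGaussian_transverse {d : ℕ} (hd : 1 ≤ d) (σ : ℝ) :
    (stdGaussian (EuclideanSpace ℝ (Fin (d + 1)))).map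
      (Matrix.toEuclideanCLM (𝕜 := ℝ) (σ • transverseProj d)) =
      multivariateGaussian 0 (σ ^ 2 • transverseProj d) := by
  have hm : Measurable (Matrix.toEuclideanCLM (𝕜 := ℝ) (σ • transverseProj d)) := by fun_prop
  have := Measure.isProbabilityMeasure_map
    (μ := stdGaussian (EuclideanSpace ℝ (Fin (d + 1)))) hm.aemeasurable
  refine Measure.ext_of_charFun (funext fun x => ?_)
  rw [charFun_multivariateGaussian_transverse hd (sq_nonneg σ),
    charFun_map_eq _ hm x (σ • transverse (tailVec x)), charFun_stdGaussian, norm_smul,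
    norm_transverse]
  · have e : -((‖σ‖ * ‖dev (tailVec x)‖ : ℝ) : ℂ) ^ 2 / 2 =
        ((-(‖σ‖ ^ 2 * ‖dev (tailVec x)‖ ^ 2 / 2) : ℝ) : ℂ) := by
      push_cast
      ring
    rw [e, Real.norm_eq_abs, sq_abs]
    norm_cast
  · intro y
    rw [map_smul, _root_.smul_apply, toEuclideanCLM_transverseProj, inner_smul_left,
      inner_smul_right, inner_transverse hd, real_inner_comm (transverse (tailVec x)) y,
      inner_transverse hd, ← inner_dev_left hd, real_inner_comm]
    simp

/-! ### Comparison of ratios of integrals -/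

theorem integrable_pow_mul_exp_neg_norm_sq {E : Type*} [NormedAddCommGroup E]
    [InnerProductSpace ℝ E] [FiniteDimensional ℝ E] [MeasurableSpace E] [BorelSpace E] {c : ℝ}
    (hc : 0 < c) (n : ℕ) :
    Integrable fun x : E => (1 + ‖x‖) ^ n * Real.exp (-(c * ‖x‖ ^ 2)) := by
  obtain ⟨C, hC, h⟩ := exists_pow_mul_exp_neg_sq_le hc n
  refine ((integrable_exp_neg_norm_sq (half_pos hc)).const_mul C).mono' (by fun_prop)
    (Filter.Eventually.of_forall fun x => ?_)
  rw [Real.norm_of_nonneg (by positivity)]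
  exact h ‖x‖ (norm_nonneg x)

/-- The difference splits into a change of weight in the numerator, a change of weight in the
denominator, and a change of test function. The envelope `e` with the polynomial factor `P` controls
the first two. The third is left as an integral, because its size depends on the kind of test
function. -/
theorem abs_ratio_sub_ratio_le {E : Type*} [MeasurableSpace E] {μ : Measure E}
    {W W₀ G G₀ P e : E → ℝ} {ε B C₀ L : ℝ} (hε : 0 ≤ ε) (hB : 0 ≤ B) (hC₀ : 0 ≤ C₀) (hL : 0 < L)
    (hW : Measurable W) (hW₀ : Measurable W₀) (hG : Measurable G) (hG₀ : Measurable G₀)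
    (hP : ∀ x, 1 ≤ P x) (he : ∀ x, 0 ≤ e x) (hWW₀ : ∀ x, |W x - W₀ x| ≤ ε * e x)
    (hW₀nn : ∀ x, 0 ≤ W₀ x) (hW₀e : ∀ x, W₀ x ≤ C₀ * e x)
    (hGP : ∀ x, |G x| ≤ B * P x) (hG₀P : ∀ x, |G₀ x| ≤ B * P x)
    (hie : Integrable e μ) (hiP : Integrable (fun x => P x * e x) μ)
    (hLW : L ≤ ∫ x, W x ∂μ) (hLW₀ : L ≤ ∫ x, W₀ x ∂μ) :
    |(∫ x, W x * G x ∂μ) / (∫ x, W x ∂μ) - (∫ x, W₀ x * G₀ x ∂μ) / ∫ x, W₀ x ∂μ| ≤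
      ε * B * ((∫ x, P x * e x ∂μ) / L + C₀ * (∫ x, P x * e x ∂μ) ^ 2 / L ^ 2) +
        (∫ x, W₀ x * |G x - G₀ x| ∂μ) / ∫ x, W₀ x ∂μ := by
  set J := ∫ x, P x * e x ∂μ with hJ
  have heP : ∀ x, e x ≤ P x * e x := fun x => le_mul_of_one_le_left (he x) (hP x)
  have hJe : ∫ x, e x ∂μ ≤ J := integral_mono hie hiP heP
  have hJ0 : 0 ≤ J := (integral_nonneg he).trans hJe
  have hiW₀ : Integrable W₀ μ := (hie.const_mul C₀).mono' hW₀.aestronglyMeasurable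
    (Filter.Eventually.of_forall fun x => by
      rw [Real.norm_of_nonneg (hW₀nn x)]
      exact hW₀e x)
  have hiD : Integrable (fun x => W x - W₀ x) μ :=
    (hie.const_mul ε).mono' (hW.sub hW₀).aestronglyMeasurable
      (Filter.Eventually.of_forall fun x => hWW₀ x)
  have hiW : Integrable W μ := by
    have := hiD.add hiW₀
    refine this.congr (Filter.Eventually.of_forall fun x => ?_)
    simp
  have hDG : ∀ x, ‖(W x - W₀ x) * G x‖ ≤ ε * B * (P x * e x) := fun x => by
    rw [norm_mul]
    calc _ ≤ (ε * e x) * (B * P x) :=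
          mul_le_mul (hWW₀ x) (hGP x) (abs_nonneg _) (mul_nonneg hε (he x))
      _ = _ := by ring
  have hW₀F : ∀ F : E → ℝ, (∀ x, |F x| ≤ B * P x) → ∀ x, ‖W₀ x * F x‖ ≤ C₀ * B * (P x * e x) :=
      fun F hF x => by
    rw [norm_mul, Real.norm_of_nonneg (hW₀nn x)]
    calc _ ≤ (C₀ * e x) * (B * P x) :=
          mul_le_mul (hW₀e x) (hF x) (abs_nonneg _) (mul_nonneg hC₀ (he x))
      _ = _ := by ring
  have hiDG : Integrable (fun x => (W x - W₀ x) * G x) μ :=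
    (hiP.const_mul _).mono' ((hW.sub hW₀).mul hG).aestronglyMeasurable
      (Filter.Eventually.of_forall hDG)
  have hiW₀G : Integrable (fun x => W₀ x * G x) μ :=
    (hiP.const_mul _).mono' (hW₀.mul hG).aestronglyMeasurable
      (Filter.Eventually.of_forall (hW₀F G hGP))
  have hiW₀G₀ : Integrable (fun x => W₀ x * G₀ x) μ :=
    (hiP.const_mul _).mono' (hW₀.mul hG₀).aestronglyMeasurable
      (Filter.Eventually.of_forall (hW₀F G₀ hG₀P))
  have b1 : |∫ x, (W x - W₀ x) * G x ∂μ| ≤ ε * B * J := by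
    rw [hJ, ← integral_const_mul]
    exact norm_integral_le_of_norm_le (hiP.const_mul _) (Filter.Eventually.of_forall hDG)
  have b2 : |∫ x, W₀ x * G x ∂μ| ≤ C₀ * B * J := by
    rw [hJ, ← integral_const_mul]
    exact norm_integral_le_of_norm_le (hiP.const_mul _)
      (Filter.Eventually.of_forall (hW₀F G hGP))
  have b3 : |(∫ x, W₀ x ∂μ) - ∫ x, W x ∂μ| ≤ ε * J := by
    rw [abs_sub_comm, ← integral_sub hiW hiW₀]
    refine (norm_integral_le_of_norm_le (f := fun x => W x - W₀ x) (hie.const_mul ε)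
      (Filter.Eventually.of_forall hWW₀)).trans ?_
    rw [integral_const_mul]
    gcongr
  have b4 : |∫ x, W₀ x * (G x - G₀ x) ∂μ| ≤ ∫ x, W₀ x * |G x - G₀ x| ∂μ := by
    refine (abs_integral_le_integral_abs).trans (le_of_eq ?_)
    congr 1 with x
    rw [abs_mul, abs_of_nonneg (hW₀nn x)]
  have s1 : ∫ x, W x * G x ∂μ = (∫ x, (W x - W₀ x) * G x ∂μ) + ∫ x, W₀ x * G x ∂μ := by
    rw [← integral_add hiDG hiW₀G]
    congr 1 with x
    ring
  have s2 : ∫ x, W₀ x * (G x - G₀ x) ∂μ = (∫ x, W₀ x * G x ∂μ) - ∫ x, W₀ x * G₀ x ∂μ := by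
    rw [← integral_sub hiW₀G hiW₀G₀]
    congr 1 with x
    ring
  set w := ∫ x, W x ∂μ
  set w₀ := ∫ x, W₀ x ∂μ
  set α := ∫ x, (W x - W₀ x) * G x ∂μ
  set γ := ∫ x, W₀ x * G x ∂μ
  have hw : 0 < w := hL.trans_le hLW
  have hw₀ : 0 < w₀ := hL.trans_le hLW₀
  have key : (∫ x, W x * G x ∂μ) / w - (∫ x, W₀ x * G₀ x ∂μ) / w₀ =
      α / w + γ * (w₀ - w) / (w * w₀) + (∫ x, W₀ x * (G x - G₀ x) ∂μ) / w₀ := by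
    rw [s1, s2]
    field_simp
    ring
  rw [key]
  have c1 : |α / w| ≤ ε * B * J / L := by
    rw [abs_div, abs_of_pos hw]
    gcongr
  have c2 : |γ * (w₀ - w) / (w * w₀)| ≤ (C₀ * B * J) * (ε * J) / L ^ 2 := by
    rw [abs_div, abs_mul, abs_of_pos (mul_pos hw hw₀), sq]
    gcongr
  have c3 : |(∫ x, W₀ x * (G x - G₀ x) ∂μ) / w₀| ≤ (∫ x, W₀ x * |G x - G₀ x| ∂μ) / w₀ := by
    rw [abs_div, abs_of_pos hw₀]
    gcongr
  have e1 : ε * B * (J / L + C₀ * J ^ 2 / L ^ 2) =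
      ε * B * J / L + (C₀ * B * J) * (ε * J) / L ^ 2 := by ring
  rw [e1]
  exact (abs_add_three _ _ _).trans (add_le_add (add_le_add c1 c2) c3)

/-- Comparison of the law of the rescaled counts with the limiting law, for all parameters near
the limiting ones. -/
def HasLocalLimit (p d : ℕ) (β h s κ b ρ₀ K : ℝ) : Prop :=
  ∀ (N : ℕ) (ρ : ℝ), 1 ≤ ρ → ρ₀ ≤ ρ → ρ ^ 4 = N →
    ∀ κ' ∈ Set.Icc (κ / 2) (2 * κ), ∀ b' ∈ Set.Icc (b / 2) (2 * b),
    ∀ G G₀ : EuclideanSpace ℝ (Fin d) → ℝ, Measurable G → Measurable G₀ → ∀ B : ℝ,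
    (∀ ζ, |G ζ| ≤ B * (1 + ‖ζ‖) ^ 4) → (∀ ζ, |G₀ ζ| ≤ B * (1 + ‖ζ‖) ^ 4) →
    |(expect p β h fun x : Fin N → Fin (d + 1) => G (latticePoint ρ (lowProp d s) (counts x))) -
        ∫ ζ, G₀ ζ ∂(refMeasure d κ' b')| ≤
      K * B * (1 / ρ + |κ' - κ| + |b' - b|) +
        ∫ ζ, |G (roundPt ρ (lowProp d s) ζ) - G₀ ζ| ∂(refMeasure d κ' b')

theorem refWeight_anti {d : ℕ} {κ b κ' b' : ℝ} (hκ : κ ≤ κ') (hb : b ≤ b')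
    (ζ : EuclideanSpace ℝ (Fin d)) : refWeight κ' b' ζ ≤ refWeight κ b ζ := by
  refine Real.exp_le_exp.2 ?_
  have : 0 ≤ avg ζ ^ 4 := by positivity
  gcongr

theorem integral_refMeasure {d : ℕ} (hd : 1 ≤ d) {κ b : ℝ} (hκ : 0 < κ) (hb : 0 < b)
    (g : EuclideanSpace ℝ (Fin d) → ℝ) :
    ∫ ζ, g ζ ∂(refMeasure d κ b) = (∫ ζ, refWeight κ b ζ * g ζ) /
      ∫ ζ : EuclideanSpace ℝ (Fin d), refWeight κ b ζ :=
  integral_normalized (continuous_refWeight κ b).measurable (fun _ => (refWeight_pos _ _ _).le)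
    (integral_refWeight_pos hd hκ hb) g

theorem integrable_refMeasure {d : ℕ} (hd : 1 ≤ d) {κ b : ℝ} (hκ : 0 < κ) (hb : 0 < b)
    {g : EuclideanSpace ℝ (Fin d) → ℝ} (hg : Measurable g) (B : ℝ) (n : ℕ)
    (h : ∀ ζ, |g ζ| ≤ B * (1 + ‖ζ‖) ^ n) : Integrable g (refMeasure d κ b) := by
  obtain ⟨c, hc, C, hC, href⟩ := exists_refWeight_le hd hκ hb
  rw [refMeasure, integrable_normalized_iff (continuous_refWeight κ b).measurable
    (fun _ => (refWeight_pos _ _ _).le) (integral_refWeight_pos hd hκ hb)]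
  refine ((integrable_pow_mul_exp_neg_norm_sq hc n).const_mul (C * B)).mono'
    ((continuous_refWeight κ b).measurable.mul hg).aestronglyMeasurable
    (Filter.Eventually.of_forall fun x => ?_)
  rw [norm_mul, Real.norm_of_nonneg (refWeight_pos _ _ _).le]
  calc _ ≤ (C * Real.exp (-(c * ‖x‖ ^ 2))) * (B * (1 + ‖x‖) ^ n) :=
        mul_le_mul (href κ b le_rfl le_rfl x) (h x) (abs_nonneg _) (by positivity)
    _ = _ := by ring

/-- All parameters in the box share one Gaussian envelope, and the density with the largest
parameters `2 κ`, `2 b` is pointwise the smallest, which bounds every normalizing integral from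
below. The weight is compared with the density at `(κ, b)`, and that one with the density at `(κ',
b')`. -/
theorem IsTypeISpecial.exists_hasLocalLimit {p d : ℕ} (hp : 2 ≤ p) (hd : 1 ≤ d)
    {β h s : ℝ} (hβ : 0 < β) (hsp : IsTypeISpecial p (d + 1) β h s) :
    ∃ κ > 0, ∃ b > 0, ∃ ρ₀, ∃ K > 0, HasLocalLimit p d β h s κ b ρ₀ K := by
  obtain ⟨κ, hκ, b, hb, c₁, hc₁, C₁, hC₁, h₁⟩ := hsp.exists_stepWeight_approx hp hd hβ
  obtain ⟨c₂, hc₂, C₂, hC₂, h₂⟩ := exists_refWeight_param_sub_le hd (half_pos hκ) (half_pos hb)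
  obtain ⟨c₃, hc₃, C₃, hC₃, h₃⟩ := exists_refWeight_le hd (half_pos hκ) (half_pos hb)
  set A := Real.exp (logPrefactor d s)
  have hA : 0 < A := Real.exp_pos _
  set c := min c₁ (min c₂ c₃) with hc
  have hc0 : 0 < c := by positivity
  have hcc : ∀ c', c ≤ c' → ∀ ζ : EuclideanSpace ℝ (Fin d),
      Real.exp (-(c' * ‖ζ‖ ^ 2)) ≤ Real.exp (-(c * ‖ζ‖ ^ 2)) := fun c' h ζ => by gcongr
  replace h₁ := fun N ρ hρ hN ζ => (h₁ N ρ hρ hN ζ).trans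
    (mul_le_mul_of_nonneg_left (hcc c₁ (min_le_left _ _) ζ) (by positivity))
  replace h₂ := fun κ b κ' b' hκ hb hκ' hb' ζ => (h₂ κ b κ' b' hκ hb hκ' hb' ζ).trans
    (mul_le_mul_of_nonneg_left (hcc c₂ ((min_le_right _ _).trans (min_le_left _ _)) ζ)
      (by positivity))
  replace h₃ := fun κ b hκ hb ζ => (h₃ κ b hκ hb ζ).trans
    (mul_le_mul_of_nonneg_left (hcc c₃ ((min_le_right _ _).trans (min_le_right _ _)) ζ)
      hC₃.le)
  set e : EuclideanSpace ℝ (Fin d) → ℝ := fun ζ => Real.exp (-(c * ‖ζ‖ ^ 2)) with he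
  have hie : Integrable e := integrable_exp_neg_norm_sq hc0
  have hiP := integrable_pow_mul_exp_neg_norm_sq (E := EuclideanSpace ℝ (Fin d)) hc0 4
  set I := ∫ ζ : EuclideanSpace ℝ (Fin d), refWeight (2 * κ) (2 * b) ζ with hI
  have hI0 : 0 < I := integral_refWeight_pos hd (by positivity) (by positivity)
  have hIle : ∀ κ' b', 0 < κ' → 0 < b' → κ' ≤ 2 * κ → b' ≤ 2 * b →
      I ≤ ∫ ζ : EuclideanSpace ℝ (Fin d), refWeight κ' b' ζ := fun κ' b' hκ' hb' h h' =>
    integral_mono (integrable_refWeight hd (by positivity) (by positivity))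
      (integrable_refWeight hd hκ' hb') fun ζ => refWeight_anti h h' ζ
  set L := A * I / 2 with hL
  have hL0 : 0 < L := by positivity
  set J := ∫ ζ : EuclideanSpace ℝ (Fin d), (1 + ‖ζ‖) ^ 4 * Real.exp (-(c * ‖ζ‖ ^ 2)) with hJ
  have hJ0 : 0 ≤ J := integral_nonneg fun ζ => by positivity
  have hd0 : (0 : ℝ) < d := by exact_mod_cast hd
  -- This threshold on `ρ` ensures that the total mass of the step weight loses at most `L`, half of
  -- the lower bound `A * I` for the limiting mass. The final `+ 1` only makes the constant
  -- positive.
  refine ⟨κ, hκ, b, hb, C₁ * (∫ ζ, e ζ) / L,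
    (C₁ + A * C₂) * (1 + 3 * d) ^ 4 * (J / L + (A * C₃) * J ^ 2 / L ^ 2) + 1, by positivity, ?_⟩
  intro N ρ hρ hρ₀ hN κ' hκ' b' hb' G G₀ hG hG₀ B hGB hG₀B
  have hρ0 : 0 < ρ := by linarith
  have hκ'0 : 0 < κ' := by linarith [hκ'.1]
  have hb'0 : 0 < b' := by linarith [hb'.1]
  have hB : 0 ≤ B := by
    have := (abs_nonneg _).trans (hGB 0)
    simpa using this
  have hN1 : 1 ≤ N := by
    have : (1 : ℝ) ≤ N := by rw [← hN]; exact one_le_pow₀ hρ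
    exact_mod_cast this
  set W := stepWeight ρ (lowProp d s) N (latticeWeight p β h N (xs (d + 1) s)) with hWdef
  have hWm : Measurable W := measurable_stepWeight _ _ _ _
  have hrm := fun κ b => (continuous_refWeight (d := d) κ b).measurable
  have hLW : L ≤ ∫ ζ, W ζ := by
    have hi0 := (integrable_refWeight hd hκ hb).const_mul A
    have hiD : Integrable fun ζ => W ζ - A * refWeight κ b ζ :=
      (hie.const_mul (C₁ / ρ)).mono' (hWm.sub ((hrm κ b).const_mul A)).aestronglyMeasurable
        (Filter.Eventually.of_forall fun ζ => h₁ N ρ hρ hN ζ)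
    have e1 : ∫ ζ, W ζ = (∫ ζ, W ζ - A * refWeight κ b ζ) + ∫ ζ : EuclideanSpace ℝ (Fin d), A * refWeight κ b ζ := by
      rw [← integral_add hiD hi0]
      congr 1 with ζ
      ring
    have e2 : |∫ ζ, W ζ - A * refWeight κ b ζ| ≤ C₁ / ρ * ∫ ζ, e ζ := by
      rw [← integral_const_mul]
      exact norm_integral_le_of_norm_le (f := fun ζ => W ζ - A * refWeight κ b ζ)
        (hie.const_mul _) (Filter.Eventually.of_forall fun ζ => h₁ N ρ hρ hN ζ)
    have e3 : C₁ / ρ * ∫ ζ, e ζ ≤ L := by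
      rw [div_le_iff₀ hL0] at hρ₀
      rw [div_mul_eq_mul_div, div_le_iff₀ hρ0]
      linarith
    have e4 : 2 * L ≤ ∫ ζ : EuclideanSpace ℝ (Fin d), A * refWeight κ b ζ := by
      rw [integral_const_mul, hL]
      have := hIle κ b hκ hb (by linarith) (by linarith)
      nlinarith
    linarith [(abs_le.1 e2).1]
  have hLW₀ : L ≤ ∫ ζ : EuclideanSpace ℝ (Fin d), A * refWeight κ' b' ζ := by
    rw [integral_const_mul, hL]
    have := hIle κ' b' hκ'0 hb'0 hκ'.2 hb'.2
    nlinarith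
  have hround : ∀ ζ : EuclideanSpace ℝ (Fin d), ‖roundPt ρ (lowProp d s) ζ‖ ≤ ‖ζ‖ + 3 * d :=
      fun ζ => by
    have h1 := norm_sub_roundPt_le hd hρ (lowProp d s) ζ
    have h2 : 3 * d / ρ ^ 2 ≤ 3 * (d : ℝ) := div_le_self (by positivity) (one_le_pow₀ hρ)
    have h3 := norm_sub_norm_le (roundPt ρ (lowProp d s) ζ) ζ
    rw [norm_sub_rev] at h3
    linarith
  have hmain := abs_ratio_sub_ratio_le (μ := volume) (W := W) (W₀ := fun ζ => A * refWeight κ' b' ζ)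
    (G := fun ζ => G (roundPt ρ (lowProp d s) ζ)) (G₀ := G₀) (P := fun ζ => (1 + ‖ζ‖) ^ 4) (e := e)
    (ε := (C₁ + A * C₂) * (1 / ρ + |κ' - κ| + |b' - b|)) (B := B * (1 + 3 * d) ^ 4)
    (C₀ := A * C₃) (L := L) (by positivity) (by positivity) (by positivity) hL0 hWm
    ((hrm κ' b').const_mul A) (hG.comp (measurable_roundPt _ _)) hG₀
    (fun ζ => one_le_pow₀ (by linarith [norm_nonneg ζ])) (fun ζ => (Real.exp_pos _).le)
    (fun ζ => ?_) (fun ζ => (mul_pos hA (refWeight_pos _ _ _)).le) (fun ζ => ?_) (fun ζ => ?_)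
    (fun ζ => ?_) hie hiP hLW hLW₀
  · have q : ∀ F : EuclideanSpace ℝ (Fin d) → ℝ, (∫ ζ : EuclideanSpace ℝ (Fin d), A * refWeight κ' b' ζ * F ζ) /
        (∫ ζ : EuclideanSpace ℝ (Fin d), A * refWeight κ' b' ζ) =
        ∫ ζ, F ζ ∂(refMeasure d κ' b') := fun F => by
      rw [integral_refMeasure hd hκ'0 hb'0]
      simp only [mul_assoc]
      rw [integral_const_mul, integral_const_mul, mul_div_mul_left _ _ hA.ne']
    rw [q, q] at hmain
    rw [expect_eq_integral hd hN1 hρ0 (lowProp d s) (xs (d + 1) s)]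
    refine hmain.trans (add_le_add_left (le_trans (le_of_eq ?_) (mul_le_mul_of_nonneg_right
      (mul_le_mul_of_nonneg_right (le_add_of_nonneg_right zero_le_one) hB) (by positivity))) _)
    ring
  · have t1 := h₁ N ρ hρ hN ζ
    have t2 := h₂ κ b κ' b' (by linarith) (by linarith) hκ'.1 hb'.1 ζ
    rw [abs_sub_comm κ, abs_sub_comm b] at t2
    have t3 : W ζ - A * refWeight κ' b' ζ = (W ζ - A * refWeight κ b ζ) +
        A * (refWeight κ b ζ - refWeight κ' b' ζ) := by ring
    rw [t3]
    refine (abs_add_le _ _).trans ?_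
    rw [abs_mul, abs_of_pos hA]
    have t4 := mul_le_mul_of_nonneg_left t2 hA.le
    have t5 : 0 ≤ C₁ * (|κ' - κ| + |b' - b|) * e ζ := by positivity
    have t6 : 0 ≤ A * C₂ * (1 / ρ) * e ζ := by positivity
    calc _ ≤ C₁ / ρ * e ζ + A * (C₂ * (|κ' - κ| + |b' - b|) * e ζ) := add_le_add t1 t4
      _ ≤ C₁ / ρ * e ζ + A * (C₂ * (|κ' - κ| + |b' - b|) * e ζ) +
          (C₁ * (|κ' - κ| + |b' - b|) * e ζ + A * C₂ * (1 / ρ) * e ζ) := by linarith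
      _ = _ := by ring
  · rw [mul_assoc]
    exact mul_le_mul_of_nonneg_left (h₃ κ' b' hκ'.1 hb'.1 ζ) hA.le
  · refine (hGB _).trans ?_
    rw [mul_assoc, ← mul_pow]
    gcongr
    nlinarith [hround ζ, norm_nonneg ζ]
  · refine (hG₀B _).trans ?_
    rw [mul_assoc]
    gcongr
    refine le_mul_of_one_le_left (by positivity) (one_le_pow₀ (by linarith))

/-! ### The decomposition in the rescaled coordinates -/

/-- By uniqueness of the decomposition it is enough that these two candidates satisfy it. A mean
displacement `τ` of the last colours moves the first one by `-d τ`, hence the whole vector by `τ u`.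
-/
theorem TN_VN_eq {d N : ℕ} (hd : 1 ≤ d) (hN : 1 ≤ N) (s : ℝ) {ρ : ℝ} (hρ : 0 < ρ)
    (hρN : ρ ^ 4 = N) (x : Fin N → Fin (d + 1)) :
    TN (xs (d + 1) s) x = avg (latticePoint ρ (lowProp d s) (counts x)) ∧
      VN (xs (d + 1) s) x = transverse (latticePoint ρ (lowProp d s) (counts x)) := by
  have hd0 : (d : ℝ) ≠ 0 := by positivity
  have h4 : (N : ℝ) ^ (-1 / 4 : ℝ) = 1 / ρ := by
    rw [← hρN, ← Real.rpow_natCast, ← Real.rpow_mul hρ.le]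
    norm_num [Real.rpow_neg_one]
  have h2 : (N : ℝ) ^ (-1 / 2 : ℝ) = 1 / ρ ^ 2 := by
    rw [← hρN, ← Real.rpow_natCast, ← Real.rpow_mul hρ.le, one_div, ← Real.rpow_natCast ρ 2,
      ← Real.rpow_neg hρ.le]
    norm_num
  have hm : ∑ r, xs (d + 1) s r = 1 := by
    rw [xs_eq_colorVec, Fin.sum_univ_succ]
    simpa using highProp_add d s
  have h := (decomposition hN (by omega) hm x
    (avg (latticePoint ρ (lowProp d s) (counts x)))
    (transverse (latticePoint ρ (lowProp d s) (counts x)))).1 ?_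
  · exact ⟨h.1.symm, h.2.symm⟩
  set ζ := latticePoint ρ (lowProp d s) (counts x) with hζ
  refine ⟨?_, ?_, ?_⟩
  · rw [← proportions_counts, proportions_eq hd s hρ hρN (sum_counts x), ← hζ, xs_eq_colorVec, h4,
      h2]
    ext r
    refine Fin.cases ?_ (fun i => ?_) r
    · simp [uVec, transverse]
      ring
    · simp [uVec, transverse]
      ring
  · have := sum_dev hd ζ
    simp only [zeroSum, Set.mem_ofPred_eq, Fin.sum_univ_succ, transverse, colorVec_zero,
      colorVec_succ, zero_add, this]
  · have := sum_dev hd ζ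
    rw [inner_eq_sum, Fin.sum_univ_succ]
    simp only [transverse, colorVec_zero, mul_zero, colorVec_succ, uVec]
    simpa using this

/-! ### Symmetry -/

/-- The field singles out the first colour, so the symmetries are the permutations that fix it. -/
theorem expect_comp_perm {p N q : ℕ} {β h : ℝ} (e : Equiv.Perm (Fin q))
    (he : ∀ r, ((e r : Fin q) : ℕ) = 0 ↔ (r : ℕ) = 0) (F : (Fin N → Fin q) → ℝ) :
    expect p β h (fun x => F (e ∘ x)) = expect p β h F := by
  have hmag : ∀ (x : Fin N → Fin q) r, magnetization (e ∘ x) (e r) = magnetization x r := by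
    intro x r
    simp [magnetization]
  have hg : ∀ x : Fin N → Fin q, gibbs p β h (e ∘ x) = gibbs p β h x := by
    intro x
    unfold gibbs exponent
    rw [← Equiv.sum_comp e (fun r => magnetization (e ∘ x) r ^ p),
      ← Equiv.sum_comp e (fun r => firstColor r * magnetization (e ∘ x) r)]
    simp only [hmag, firstColor, he]
  unfold expect
  rw [← Equiv.sum_comp (Equiv.arrowCongr (Equiv.refl (Fin N)) e) (fun x => gibbs p β h x * F x)]
  refine Finset.sum_congr rfl fun x _ => ?_
  have : (Equiv.arrowCongr (Equiv.refl (Fin N)) e) x = e ∘ x := by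
    ext i
    simp
  rw [this, hg]

theorem VN_comp_perm {N q : ℕ} (s : ℝ) (e : Equiv.Perm (Fin q))
    (he : ∀ r, ((e r : Fin q) : ℕ) = 0 ↔ (r : ℕ) = 0) (x : Fin N → Fin q) (r : Fin q) :
    VN (xs q s) (e ∘ x) (e r) = VN (xs q s) x r := by
  have hmag : ∀ r, magnetization (e ∘ x) (e r) = magnetization x r := by
    intro r
    simp [magnetization]
  have hT : TN (xs q s) (e ∘ x) = TN (xs q s) x := by
    unfold TN
    rw [inner_eq_sum, inner_eq_sum, ← Equiv.sum_comp e]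
    simp [hmag, uVec, xs, he]
  unfold VN
  rw [hT]
  simp [hmag, uVec, xs, he]

theorem VN_zero {d N : ℕ} (hd : 1 ≤ d) (hN : 1 ≤ N) (s : ℝ) (x : Fin N → Fin (d + 1)) :
    VN (xs (d + 1) s) x 0 = 0 := by
  have hN0 : (0 : ℝ) < N := by exact_mod_cast hN
  rw [(TN_VN_eq hd hN s (ρ := (N : ℝ) ^ (1 / 4 : ℝ)) (by positivity)
    (by rw [← Real.rpow_natCast, ← Real.rpow_mul hN0.le]; norm_num) x).2]
  rfl

theorem sum_VN {d N : ℕ} (hd : 1 ≤ d) (hN : 1 ≤ N) (s : ℝ) (x : Fin N → Fin (d + 1)) :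
    ∑ i : Fin d, VN (xs (d + 1) s) x i.succ = 0 := by
  have hN0 : (0 : ℝ) < N := by exact_mod_cast hN
  rw [(TN_VN_eq hd hN s (ρ := (N : ℝ) ^ (1 / 4 : ℝ)) (by positivity)
    (by rw [← Real.rpow_natCast, ← Real.rpow_mul hN0.le]; norm_num) x).2]
  exact sum_dev hd _

/-- By symmetry, the covariance matrix of the transverse part is a multiple of a projection. -/
theorem covMatrix_eq_smul {p d N : ℕ} {β h : ℝ} (hd : 1 ≤ d) (hN : 1 ≤ N) (s : ℝ) {r : ℝ}
    (hr : (d - 1 : ℝ) * r =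
      expect p β h fun x : Fin N → Fin (d + 1) => ‖VN (xs (d + 1) s) x‖ ^ 2) :
    covMatrix p β h N (xs (d + 1) s) = r • transverseProj d := by
  have hd0 : (d : ℝ) ≠ 0 := by positivity
  set f : Fin d → Fin d → ℝ := fun i j => covMatrix p β h N (xs (d + 1) s) i.succ j.succ with hf
  -- Exchanging colours makes the diagonal entries equal, and the off-diagonal entries of each row
  -- equal to each other; the vanishing row sums then express everything through the trace. For `d =
  -- 1` the projection is zero, and the hypothesis in the form `(d - 1) * r = …` leaves `r` free.
  have hswap : ∀ i j k l : Fin d, f (Equiv.swap k l i) (Equiv.swap k l j) = f i j := by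
    intro i j k l
    have hs : ∀ i : Fin d, Equiv.swap k.succ l.succ i.succ = (Equiv.swap k l i).succ := fun i => by
      simp only [Equiv.swap_apply_def, Fin.succ_inj]
      split_ifs <;> rfl
    have he : ∀ r, ((Equiv.swap k.succ l.succ r : Fin (d + 1)) : ℕ) = 0 ↔ (r : ℕ) = 0 := by
      intro r
      refine Fin.cases ?_ (fun i => ?_) r
      · rw [Equiv.swap_apply_of_ne_of_ne (Fin.succ_ne_zero _).symm (Fin.succ_ne_zero _).symm]
      · rw [hs]
        simp
    simp only [hf, covMatrix, Matrix.of_apply]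
    rw [← expect_comp_perm _ he, ← hs, ← hs]
    simp only [VN_comp_perm s _ he]
  have hrow : ∀ i, ∑ j, f i j = 0 := by
    intro i
    simp only [hf, covMatrix, Matrix.of_apply, expect]
    rw [Finset.sum_comm]
    refine Finset.sum_eq_zero fun x _ => ?_
    rw [← Finset.mul_sum, ← Finset.mul_sum, sum_VN hd hN, mul_zero, mul_zero]
  have htr : ∑ i, f i i = (d - 1 : ℝ) * r := by
    rw [hr]
    simp only [hf, covMatrix, Matrix.of_apply, expect]
    rw [Finset.sum_comm]
    refine Finset.sum_congr rfl fun x _ => ?_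
    rw [← Finset.mul_sum, EuclideanSpace.real_norm_sq_eq, Fin.sum_univ_succ, VN_zero hd hN]
    simp [sq]
  have hdiag : ∀ i, d * f i i = (d - 1 : ℝ) * r := by
    intro i
    rw [← htr, Finset.sum_congr rfl fun j _ => (show f j j = f i i by
      have := hswap i i i j
      rwa [Equiv.swap_apply_left] at this)]
    simp
  have hoff : ∀ i j, i ≠ j → (d - 1 : ℝ) * f i j = -f i i := by
    intro i j hij
    have h1 := hrow i
    rw [← Finset.add_sum_erase _ _ (Finset.mem_univ i), Finset.sum_congr rfl fun k hk =>
      (show f i k = f i j by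
        have := hswap i j j k
        rwa [Equiv.swap_apply_left, Equiv.swap_apply_of_ne_of_ne hij
          (Finset.ne_of_mem_erase hk).symm] at this)] at h1
    simp only [Finset.sum_const, Finset.card_erase_of_mem (Finset.mem_univ i), Finset.card_univ,
      Fintype.card_fin, nsmul_eq_mul] at h1
    rw [Nat.cast_sub hd] at h1
    push_cast at h1
    linarith
  have hz : ∀ x : Fin N → Fin (d + 1), VN (xs (d + 1) s) x 0 = 0 := VN_zero hd hN s
  ext i j
  rw [Matrix.smul_apply]
  refine Fin.cases ?_ (fun i => ?_) i
  · simp [covMatrix, transverseProj, hz, expect]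
  refine Fin.cases ?_ (fun j => ?_) j
  · simp [covMatrix, transverseProj, hz, expect]
  change f i j = _
  by_cases hij : i = j
  · subst hij
    simp [transverseProj]
    field_simp
    linarith [hdiag i]
  · have hd2 : (d : ℝ) - 1 ≠ 0 := by
      intro h0
      have hd1 : d = 1 := by
        have : (d : ℝ) = 1 := by linarith
        exact_mod_cast this
      subst hd1
      exact hij (Subsingleton.elim _ _)
    simp [transverseProj, hij]
    have h1 := hoff i j hij
    have h2 := hdiag i
    have h3 : ((d : ℝ) - 1) * (d * f i j) = (d - 1) * (-r) := by
      linear_combination (d : ℝ) * h1 - h2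
    have h4 := mul_left_cancel₀ hd2 h3
    field_simp
    linarith

/-! ### Moments of the limiting law -/

theorem exp_neg_quartic_le {a : ℝ} (ha : 0 < a) (t : ℝ) :
    Real.exp (-t ^ 4 / (4 * a)) ≤
      Real.exp (1 / (4 * a)) * Real.exp (-(1 / (2 * a) * ‖t‖ ^ 2)) := by
  rw [← Real.exp_add, Real.norm_eq_abs, sq_abs]
  refine Real.exp_le_exp.2 ?_
  have h1 : 0 ≤ (1 / (4 * a)) * (t ^ 2 - 1) ^ 2 := by positivity
  have h2 : 1 / (4 * a) + -(1 / (2 * a) * t ^ 2) - -t ^ 4 / (4 * a) =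
      (1 / (4 * a)) * (t ^ 2 - 1) ^ 2 := by
    field_simp
    ring
  linarith

theorem integrable_pow_mul_exp_quartic {a : ℝ} (ha : 0 < a) (n : ℕ) :
    Integrable fun t : ℝ => t ^ n * Real.exp (-t ^ 4 / (4 * a)) := by
  refine ((integrable_pow_mul_exp_neg_norm_sq (E := ℝ) (c := 1 / (2 * a)) (by positivity)
    n).const_mul (Real.exp (1 / (4 * a)))).mono' (by fun_prop)
    (Filter.Eventually.of_forall fun t => ?_)
  rw [norm_mul, norm_pow, Real.norm_of_nonneg (Real.exp_pos _).le]
  calc _ ≤ (1 + ‖t‖) ^ n *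
        (Real.exp (1 / (4 * a)) * Real.exp (-(1 / (2 * a) * ‖t‖ ^ 2))) := by
        refine mul_le_mul ?_ (exp_neg_quartic_le ha t) (Real.exp_pos _).le (by positivity)
        gcongr
        linarith [norm_nonneg t]
    _ = _ := by ring

/-- The derivative of `t exp (-t⁴ / (4 a))` has integral zero. This identity is what makes the law
in the theorem the quartic law with the right fourth moment. -/
theorem integral_pow_four_quarticLaw {a : ℝ} (ha : 0 < a) : ∫ t, t ^ 4 ∂(quarticLaw a) = a := by
  have hi0 := integrable_exp_quartic ha
  have hi4 := integrable_pow_mul_exp_quartic ha 4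
  have hpos : 0 < ∫ t : ℝ, Real.exp (-t ^ 4 / (4 * a)) := integral_exp_pos hi0
  have hder : ∀ t : ℝ, HasDerivAt (fun t => t ^ 1 * Real.exp (-t ^ 4 / (4 * a)))
      (Real.exp (-t ^ 4 / (4 * a)) - 1 / a * (t ^ 4 * Real.exp (-t ^ 4 / (4 * a)))) t := by
    intro t
    have h1 : HasDerivAt (fun t : ℝ => -t ^ 4 / (4 * a)) (-(4 * t ^ 3) / (4 * a)) t := by
      have := ((hasDerivAt_pow 4 t).neg).div_const (4 * a)
      simpa using this
    have h2 := (hasDerivAt_pow 1 t).mul h1.exp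
    refine h2.congr_deriv ?_
    field_simp
    ring
  have h0 := integral_eq_zero_of_hasDerivAt_of_integrable hder
    (hi0.sub (hi4.const_mul (1 / a))) (integrable_pow_mul_exp_quartic ha 1)
  rw [integral_sub hi0 (hi4.const_mul (1 / a)), integral_const_mul] at h0
  rw [quarticLaw_eq_normalized, integral_normalized (by fun_prop) (fun _ => (Real.exp_pos _).le)
    hpos, div_eq_iff hpos.ne']
  have e : ∫ t : ℝ, Real.exp (-t ^ 4 / (4 * a)) * t ^ 4 =
      ∫ t : ℝ, t ^ 4 * Real.exp (-t ^ 4 / (4 * a)) := by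
    congr 1 with t
    ring
  rw [e, sub_eq_zero.1 h0]
  field_simp

theorem integral_avg_pow_four {d : ℕ} (hd : 1 ≤ d) {κ b : ℝ} (hκ : 0 < κ) (hb : 0 < b) :
    ∫ ζ, avg ζ ^ 4 ∂(refMeasure d κ b) = 1 / (4 * κ) := by
  rw [← integral_pow_four_quarticLaw (a := 1 / (4 * κ)) (by positivity),
    ← map_avg_refMeasure hd hκ hb, integral_map continuous_avg.measurable.aemeasurable
      (by fun_prop)]

/-- The second moment is the trace of the covariance `b⁻¹` times a projection of rank `d - 1`. -/
theorem integral_norm_dev_sq {d : ℕ} (hd : 1 ≤ d) {κ b : ℝ} (hκ : 0 < κ) (hb : 0 < b) :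
    ∫ ζ, ‖dev ζ‖ ^ 2 ∂(refMeasure d κ b) = (d - 1) / b := by
  have hd0 : (d : ℝ) ≠ 0 := by positivity
  have h1 : ∫ ζ, ‖dev ζ‖ ^ 2 ∂(refMeasure d κ b) =
      ∫ x, ‖x‖ ^ 2 ∂(multivariateGaussian 0 (b⁻¹ • transverseProj d)) := by
    rw [← map_transverse_refMeasure hd hκ hb,
      integral_map continuous_transverse.measurable.aemeasurable (by fun_prop)]
    simp only [norm_transverse]
  have hS := posSemidef_transverseProj hd (inv_pos.2 hb).le
  have hmem : ∀ i, MemLp (fun x : EuclideanSpace ℝ (Fin (d + 1)) => x i) 2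
      (multivariateGaussian 0 (b⁻¹ • transverseProj d)) := fun i =>
    IsGaussian.memLp_dual _ (EuclideanSpace.proj i : EuclideanSpace ℝ (Fin (d + 1)) →L[ℝ] ℝ) 2
      (by simp)
  have hvar : ∀ i, ∫ x, (x i) ^ 2 ∂(multivariateGaussian 0 (b⁻¹ • transverseProj d)) =
      (b⁻¹ • transverseProj d) i i := fun i => by
    have h2 := variance_eval_multivariateGaussian (μ := 0) hS i
    have h3 : ∫ x : EuclideanSpace ℝ (Fin (d + 1)), x i
        ∂(multivariateGaussian 0 (b⁻¹ • transverseProj d)) = 0 := by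
      have := (EuclideanSpace.proj i : EuclideanSpace ℝ (Fin (d + 1)) →L[ℝ] ℝ).integral_comp_comm
        (μ := multivariateGaussian 0 (b⁻¹ • transverseProj d)) (φ := fun x => x)
        IsGaussian.integrable_id
      simpa using this
    rw [variance_eq_sub (hmem i)] at h2
    rw [h3] at h2
    simpa using h2
  rw [h1]
  simp only [EuclideanSpace.real_norm_sq_eq]
  rw [integral_finsetSum _ fun i _ => (hmem i).integrable_sq, Finset.sum_congr rfl fun i _ =>
    hvar i, Fin.sum_univ_succ]
  simp [transverseProj]
  field_simp

/-! ### Tuning the parameters of the limiting law -/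

theorem norm_roundPt_le {d : ℕ} (hd : 1 ≤ d) {ρ : ℝ} (hρ : 1 ≤ ρ) (v : ℝ)
    (ζ : EuclideanSpace ℝ (Fin d)) : ‖roundPt ρ v ζ‖ ≤ ‖ζ‖ + 3 * d := by
  have h1 := norm_sub_roundPt_le hd hρ v ζ
  have h2 : 3 * d / ρ ^ 2 ≤ 3 * (d : ℝ) := div_le_self (by positivity) (one_le_pow₀ hρ)
  have h3 := norm_sub_norm_le (roundPt ρ v ζ) ζ
  rw [norm_sub_rev] at h3
  linarith

theorem norm_sub_roundPt_le_div {d : ℕ} (hd : 1 ≤ d) {ρ : ℝ} (hρ : 1 ≤ ρ) (v : ℝ)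
    (ζ : EuclideanSpace ℝ (Fin d)) : ‖ζ - roundPt ρ v ζ‖ ≤ 3 * d / ρ := by
  refine (norm_sub_roundPt_le hd hρ v ζ).trans ?_
  have : ρ ≤ ρ ^ 2 := le_self_pow₀ hρ two_ne_zero
  gcongr

/-- The local limit is used at the limiting parameters themselves, so that only the rounding error
has to be estimated; the local Lipschitz constant may grow like a fourth power because the limiting
law has all moments. -/
theorem HasLocalLimit.exists_moment_sub_le {p d : ℕ} {β h s κ b ρ₀ K : ℝ}
    (hlim : HasLocalLimit p d β h s κ b ρ₀ K) (hd : 1 ≤ d) (hκ : 0 < κ) (hb : 0 < b) (hK : 0 < K)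
    {G : EuclideanSpace ℝ (Fin d) → ℝ} (hG : Measurable G) {B : ℝ}
    (hGB : ∀ ζ, |G ζ| ≤ B * (1 + ‖ζ‖) ^ 4)
    (hGl : ∀ ζ ζ', |G ζ - G ζ'| ≤ B * (1 + ‖ζ‖ + ‖ζ'‖) ^ 4 * ‖ζ - ζ'‖) :
    ∃ C > 0, ∀ (N : ℕ) (ρ : ℝ), 1 ≤ ρ → ρ₀ ≤ ρ → ρ ^ 4 = N →
      |(expect p β h fun x : Fin N → Fin (d + 1) => G (latticePoint ρ (lowProp d s) (counts x))) -
        ∫ ζ, G ζ ∂(refMeasure d κ b)| ≤ C / ρ := by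
  have hB : 0 ≤ B := by
    have := (abs_nonneg _).trans (hGB 0)
    simpa using this
  have hM0 : 0 ≤ ∫ ζ, (1 + ‖ζ‖) ^ 4 ∂(refMeasure d κ b) := integral_nonneg fun ζ => by positivity
  have hi : Integrable (fun ζ => (1 + ‖ζ‖) ^ 4) (refMeasure d κ b) :=
    integrable_refMeasure hd hκ hb (by fun_prop) 1 4 fun ζ => by
      rw [abs_of_nonneg (by positivity), one_mul]
  set M := ∫ ζ, (1 + ‖ζ‖) ^ 4 ∂(refMeasure d κ b) with hM
  refine ⟨K * B + B * (2 + 3 * d) ^ 4 * (3 * d) * M + 1, by positivity, fun N ρ hρ hρ₀ hN => ?_⟩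
  have hρ0 : 0 < ρ := by linarith
  refine (hlim N ρ hρ hρ₀ hN κ ⟨by linarith, by linarith⟩ b ⟨by linarith, by linarith⟩ G G hG hG B
    hGB hGB).trans ?_
  have h1 : ∫ ζ, |G (roundPt ρ (lowProp d s) ζ) - G ζ| ∂(refMeasure d κ b) ≤
      B * (2 + 3 * d) ^ 4 * (3 * d) / ρ * M := by
    rw [hM, ← integral_const_mul]
    refine integral_mono_of_nonneg (Filter.Eventually.of_forall fun _ => abs_nonneg _)
      (hi.const_mul _) (Filter.Eventually.of_forall fun ζ => ?_)
    simp only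
    rw [abs_sub_comm]
    refine (hGl _ _).trans ?_
    have e1 := norm_sub_roundPt_le_div hd hρ (lowProp d s) ζ
    have e2 : 1 + ‖ζ‖ + ‖roundPt ρ (lowProp d s) ζ‖ ≤ (2 + 3 * d) * (1 + ‖ζ‖) := by
      have := norm_roundPt_le hd hρ (lowProp d s) ζ
      have h0 : 0 ≤ (d : ℝ) * ‖ζ‖ := by positivity
      nlinarith [norm_nonneg ζ]
    calc _ ≤ B * ((2 + 3 * d) * (1 + ‖ζ‖)) ^ 4 * (3 * d / ρ) := by gcongr
      _ = _ := by ring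
  rw [sub_self, sub_self, abs_zero, add_zero, add_zero]
  calc _ ≤ K * B * (1 / ρ) + B * (2 + 3 * d) ^ 4 * (3 * d) / ρ * M := by gcongr
    _ ≤ K * B * (1 / ρ) + B * (2 + 3 * d) ^ 4 * (3 * d) / ρ * M + 1 / ρ := by
      linarith [show 0 < 1 / ρ by positivity]
    _ = _ := by ring

/-- The parameters are inverses of moments. Closeness of the moments passes to the parameters, and
also puts them in the box where the local limit is uniform. -/
theorem abs_inv_sub_le {x y δ : ℝ} (hy : 0 < y) (h : |x - y⁻¹| ≤ δ) (hδ : δ ≤ y⁻¹ / 2) :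
    0 < x ∧ x⁻¹ ∈ Set.Icc (y / 2) (2 * y) ∧ |x⁻¹ - y| ≤ 2 * y ^ 2 * δ := by
  have hy' : 0 < y⁻¹ := inv_pos.2 hy
  obtain ⟨h1, h2⟩ := abs_le.1 h
  have hx1 : y⁻¹ / 2 ≤ x := by linarith
  have hx : 0 < x := by linarith
  have hxi : x⁻¹ ≤ 2 * y := by
    have := inv_anti₀ (by positivity) hx1
    rw [inv_div, div_inv_eq_mul] at this
    exact this
  refine ⟨hx, ⟨?_, hxi⟩, ?_⟩
  · have := inv_anti₀ hx (show x ≤ 2 * y⁻¹ by linarith)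
    rw [mul_inv, inv_inv] at this
    linarith
  · have e : x⁻¹ - y = x⁻¹ * y * (y⁻¹ - x) := by
      field_simp
    rw [e, abs_mul, abs_of_pos (by positivity), abs_sub_comm]
    calc _ ≤ (2 * y) * y * δ := by gcongr
      _ = _ := by ring

theorem abs_pow_four_sub_le {x y M : ℝ} (hx : |x| ≤ M) (hy : |y| ≤ M) :
    |x ^ 4 - y ^ 4| ≤ 4 * M ^ 3 * |x - y| := by
  have e : x ^ 4 - y ^ 4 = (x ^ 3 + x ^ 2 * y + x * y ^ 2 + y ^ 3) * (x - y) := by ring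
  have hM : 0 ≤ M := (abs_nonneg x).trans hx
  rw [e, abs_mul]
  gcongr
  have h1 : |x ^ 3| ≤ M ^ 3 := by rw [abs_pow]; gcongr
  have h2 : |x ^ 2 * y| ≤ M ^ 2 * M := by rw [abs_mul, abs_pow]; gcongr
  have h3 : |x * y ^ 2| ≤ M * M ^ 2 := by rw [abs_mul, abs_pow]; gcongr
  have h4 : |y ^ 3| ≤ M ^ 3 := by rw [abs_pow]; gcongr
  calc _ ≤ |x ^ 3| + |x ^ 2 * y| + |x * y ^ 2| + |y ^ 3| :=
        (abs_add_le _ _).trans (add_le_add_left (abs_add_three _ _ _) _)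
    _ ≤ M ^ 3 + M ^ 2 * M + M * M ^ 2 + M ^ 3 := by gcongr
    _ = _ := by ring

theorem exists_fourthMoment_sub_le {p d : ℕ} {β h s κ b ρ₀ K : ℝ}
    (hlim : HasLocalLimit p d β h s κ b ρ₀ K) (hd : 1 ≤ d) (hκ : 0 < κ) (hb : 0 < b)
    (hK : 0 < K) : ∃ C > 0, ∀ (N : ℕ) (ρ : ℝ), 1 ≤ ρ → ρ₀ ≤ ρ → ρ ^ 4 = N →
      |fourthMoment p β h N (xs (d + 1) s) - 1 / (4 * κ)| ≤ C / ρ := by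
  obtain ⟨C, hC, hmom⟩ := hlim.exists_moment_sub_le hd hκ hb hK (G := fun ζ => avg ζ ^ 4) (B := 4)
    (continuous_avg.measurable.pow_const 4) (fun ζ => by
      rw [abs_pow]
      have h1 : |avg ζ| ^ 4 ≤ (1 + ‖ζ‖) ^ 4 := by
        gcongr
        linarith [abs_avg_le hd ζ]
      linarith [show 0 ≤ (1 + ‖ζ‖) ^ 4 by positivity]) fun ζ ζ' => by
      have h1 := abs_avg_le hd ζ
      have h2 := abs_avg_le hd ζ'
      have h3 := abs_avg_le hd (ζ - ζ')
      rw [avg_sub] at h3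
      have hm0 := norm_nonneg ζ
      have hm1 := norm_nonneg ζ'
      refine (abs_pow_four_sub_le (M := 1 + ‖ζ‖ + ‖ζ'‖) (by linarith) (by linarith)).trans ?_
      have : (1 + ‖ζ‖ + ‖ζ'‖) ^ 3 ≤ (1 + ‖ζ‖ + ‖ζ'‖) ^ 4 :=
        pow_le_pow_right₀ (by linarith) (by norm_num)
      gcongr
  refine ⟨C, hC, fun N ρ hρ hρ₀ hN => ?_⟩
  have hN1 : 1 ≤ N := by
    have : (1 : ℝ) ≤ N := by rw [← hN]; exact one_le_pow₀ hρ
    exact_mod_cast this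
  have := hmom N ρ hρ hρ₀ hN
  rw [integral_avg_pow_four hd hκ hb] at this
  unfold fourthMoment
  simp only [fun x : Fin N → Fin (d + 1) => (TN_VN_eq hd hN1 s (by linarith) hN x).1]
  exact this

theorem exists_norm_VN_sub_le {p d : ℕ} {β h s κ b ρ₀ K : ℝ}
    (hlim : HasLocalLimit p d β h s κ b ρ₀ K) (hd : 1 ≤ d) (hκ : 0 < κ) (hb : 0 < b)
    (hK : 0 < K) : ∃ C > 0, ∀ (N : ℕ) (ρ : ℝ), 1 ≤ ρ → ρ₀ ≤ ρ → ρ ^ 4 = N →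
      |(expect p β h fun x : Fin N → Fin (d + 1) => ‖VN (xs (d + 1) s) x‖ ^ 2) - (d - 1) / b| ≤
        C / ρ := by
  obtain ⟨C, hC, hmom⟩ := hlim.exists_moment_sub_le hd hκ hb hK (G := fun ζ => ‖dev ζ‖ ^ 2) (B := 1)
    (continuous_dev.norm.measurable.pow_const 2) (fun ζ => by
      rw [abs_of_nonneg (by positivity), one_mul]
      have h1 : ‖dev ζ‖ ^ 2 ≤ (1 + ‖ζ‖) ^ 2 := by
        gcongr
        linarith [norm_dev_le hd ζ]
      exact h1.trans (pow_le_pow_right₀ (by linarith [norm_nonneg ζ]) (by norm_num))) fun ζ ζ' => by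
      have h1 := norm_dev_le hd ζ
      have h2 := norm_dev_le hd ζ'
      have h3 := norm_dev_le hd (ζ - ζ')
      rw [dev_sub] at h3
      have h4 := (abs_norm_sub_norm_le (dev ζ) (dev ζ')).trans h3
      have e : ‖dev ζ‖ ^ 2 - ‖dev ζ'‖ ^ 2 = (‖dev ζ‖ + ‖dev ζ'‖) * (‖dev ζ‖ - ‖dev ζ'‖) := by ring
      rw [e, abs_mul, abs_of_nonneg (by positivity), one_mul]
      gcongr
      have : (1 + ‖ζ‖ + ‖ζ'‖) ^ 1 ≤ (1 + ‖ζ‖ + ‖ζ'‖) ^ 4 :=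
        pow_le_pow_right₀ (by linarith [norm_nonneg ζ, norm_nonneg ζ']) (by norm_num)
      linarith
  refine ⟨C, hC, fun N ρ hρ hρ₀ hN => ?_⟩
  have hN1 : 1 ≤ N := by
    have : (1 : ℝ) ≤ N := by rw [← hN]; exact one_le_pow₀ hρ
    exact_mod_cast this
  have := hmom N ρ hρ hρ₀ hN
  rw [integral_norm_dev_sq hd hκ hb] at this
  simp only [fun x : Fin N → Fin (d + 1) => (TN_VN_eq hd hN1 s (by linarith) hN x).2,
    norm_transverse]
  exact this

/-- Comparison with the limiting law whose moments are those of the model. -/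
theorem IsTypeISpecial.exists_matched_comparison {p d : ℕ} (hp : 2 ≤ p) (hd : 1 ≤ d)
    {β h s : ℝ} (hβ : 0 < β) (hsp : IsTypeISpecial p (d + 1) β h s) :
    ∃ κ > 0, ∃ b > 0, ∃ ρ₁ ≥ 1, ∃ K > 0, ∀ (N : ℕ) (ρ : ℝ), ρ₁ ≤ ρ → ρ ^ 4 = N →
      ∃ κ' ∈ Set.Icc (κ / 2) (2 * κ), ∃ b' ∈ Set.Icc (b / 2) (2 * b),
      fourthMoment p β h N (xs (d + 1) s) = 1 / (4 * κ') ∧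
      covMatrix p β h N (xs (d + 1) s) = b'⁻¹ • transverseProj d ∧
      ∀ G G₀ : EuclideanSpace ℝ (Fin d) → ℝ, Measurable G → Measurable G₀ → ∀ B : ℝ,
      (∀ ζ, |G ζ| ≤ B * (1 + ‖ζ‖) ^ 4) → (∀ ζ, |G₀ ζ| ≤ B * (1 + ‖ζ‖) ^ 4) →
      |(expect p β h fun x : Fin N → Fin (d + 1) =>
          G (latticePoint ρ (lowProp d s) (counts x))) - ∫ ζ, G₀ ζ ∂(refMeasure d κ' b')| ≤
        K * B / ρ + ∫ ζ, |G (roundPt ρ (lowProp d s) ζ) - G₀ ζ| ∂(refMeasure d κ' b') := by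
  obtain ⟨κ, hκ, b, hb, ρ₀, K, hK, hlim⟩ := hsp.exists_hasLocalLimit hp hd hβ
  obtain ⟨C₁, hC₁, hT⟩ := exists_fourthMoment_sub_le hlim hd hκ hb hK
  obtain ⟨C₂, hC₂, hV⟩ := exists_norm_VN_sub_le hlim hd hκ hb hK
  -- The last two thresholds bring the errors of the moments below `κ⁻¹ / 2` and `b⁻¹ / 2`.
  set ρ₁ := max (max 1 ρ₀) (max (8 * C₁ * κ) (2 * C₂ * b)) with hρ₁
  refine ⟨κ, hκ, b, hb, ρ₁, (le_max_left _ _).trans (le_max_left _ _),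
    K * (1 + 2 * κ ^ 2 * (4 * C₁) + 2 * b ^ 2 * C₂), by positivity, fun N ρ hρ hN => ?_⟩
  have hρ1 : 1 ≤ ρ := ((le_max_left _ _).trans (le_max_left _ _)).trans hρ
  have hρρ₀ : ρ₀ ≤ ρ := ((le_max_right _ _).trans (le_max_left _ _)).trans hρ
  have hρC₁ : 8 * C₁ * κ ≤ ρ := ((le_max_left _ _).trans (le_max_right _ _)).trans hρ
  have hρC₂ : 2 * C₂ * b ≤ ρ := ((le_max_right _ _).trans (le_max_right _ _)).trans hρ
  have hρ0 : 0 < ρ := by linarith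
  have hN1 : 1 ≤ N := by
    have : (1 : ℝ) ≤ N := by rw [← hN]; exact one_le_pow₀ hρ1
    exact_mod_cast this
  replace hT := hT N ρ hρ1 hρρ₀ hN
  replace hV := hV N ρ hρ1 hρρ₀ hN
  set τ := fourthMoment p β h N (xs (d + 1) s) with hτ
  have hT' : |4 * τ - κ⁻¹| ≤ 4 * C₁ / ρ := by
    have e : 4 * τ - κ⁻¹ = 4 * (τ - 1 / (4 * κ)) := by
      field_simp
    rw [e, abs_mul, abs_of_pos (by norm_num : (0 : ℝ) < 4), mul_div_assoc]
    gcongr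
  obtain ⟨hτ0, hκ', hκκ'⟩ := abs_inv_sub_le hκ hT' (by
    rw [div_le_div_iff₀ hρ0 two_pos, inv_mul_eq_div, le_div_iff₀ hκ]
    linarith)
  obtain ⟨b', hb', hbb', hcov⟩ : ∃ b' ∈ Set.Icc (b / 2) (2 * b),
      |b' - b| ≤ 2 * b ^ 2 * (C₂ / ρ) ∧
      covMatrix p β h N (xs (d + 1) s) = b'⁻¹ • transverseProj d := by
    -- For `d = 1` the transverse part vanishes and `b` itself is kept; otherwise `b'` is read off
    -- from the trace of the covariance matrix.
    rcases hd.eq_or_lt with hd1 | hd2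
    · refine ⟨b, ⟨by linarith, by linarith⟩, by rw [sub_self, abs_zero]; positivity,
        covMatrix_eq_smul hd hN1 s ?_⟩
      subst hd1
      have hz : ∀ x : Fin N → Fin (1 + 1), ‖VN (xs (1 + 1) s) x‖ = 0 := fun x => by
        rw [(TN_VN_eq le_rfl hN1 s hρ0 hN x).2, norm_transverse, norm_eq_zero]
        ext i
        rw [dev_apply, avg]
        fin_cases i
        simp
      simp [hz, expect]
    · have hd2' : (1 : ℝ) ≤ d - 1 := by
        have : (2 : ℝ) ≤ d := by exact_mod_cast hd2
        linarith
      set V := expect p β h fun x : Fin N → Fin (d + 1) => ‖VN (xs (d + 1) s) x‖ ^ 2 with hVdef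
      have hV' : |V / (d - 1) - b⁻¹| ≤ C₂ / ρ := by
        have e : V / (d - 1) - b⁻¹ = (V - (d - 1) / b) / (d - 1) := by
          have : (d - 1 : ℝ) ≠ 0 := by linarith
          field_simp
        rw [e, abs_div, abs_of_pos (by linarith : (0 : ℝ) < d - 1)]
        exact (div_le_self (abs_nonneg _) hd2').trans hV
      obtain ⟨hV0, hmem, hsub⟩ := abs_inv_sub_le hb hV' (by
        rw [div_le_div_iff₀ hρ0 two_pos, inv_mul_eq_div, le_div_iff₀ hb]
        linarith)
      refine ⟨(V / (d - 1))⁻¹, hmem, hsub, covMatrix_eq_smul hd hN1 s ?_⟩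
      rw [inv_inv, mul_div_cancel₀ _ (by linarith : (d - 1 : ℝ) ≠ 0)]
  refine ⟨(4 * τ)⁻¹, hκ', b', hb', ?_, hcov, fun G G₀ hG hG₀ B hGB hG₀B => ?_⟩
  · field_simp
  · refine (hlim N ρ hρ1 hρρ₀ hN _ hκ' b' hb' G G₀ hG hG₀ B hGB hG₀B).trans
      (add_le_add_left ?_ _)
    have hB : 0 ≤ B := by
      have := (abs_nonneg _).trans (hGB 0)
      simpa using this
    calc _ ≤ K * B * (1 / ρ + 2 * κ ^ 2 * (4 * C₁ / ρ) + 2 * b ^ 2 * (C₂ / ρ)) := by gcongr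
      _ = _ := by ring

/-! ### The longitudinal part -/

theorem abs_indicator_one_le {E : Type*} (S : Set E) (y : E) :
    |S.indicator (1 : E → ℝ) y| ≤ 1 := by
  classical
  rw [Set.indicator_apply]
  split_ifs <;> simp

theorem abs_expect_le {p N q : ℕ} {β h : ℝ} {F B : (Fin N → Fin q) → ℝ} (hF : ∀ x, |F x| ≤ B x) :
    |expect p β h F| ≤ expect p β h B := by
  refine (Finset.abs_sum_le_sum_abs _ _).trans (Finset.sum_le_sum fun x _ => ?_)
  rw [abs_mul, abs_of_nonneg (gibbs_nonneg x)]
  exact mul_le_mul_of_nonneg_left (hF x) (gibbs_nonneg x)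

theorem expect_sub_const {p N q : ℕ} {β h : ℝ} (hN : 1 ≤ N) (hq : q ≠ 0)
    (F : (Fin N → Fin q) → ℝ) (a : ℝ) :
    expect p β h (fun x => F x - a) = expect p β h F - a := by
  simp only [expect, mul_sub, Finset.sum_sub_distrib, ← Finset.sum_mul, sum_gibbs hN hq, one_mul]

theorem expect_const {p N q : ℕ} {β h : ℝ} (hN : 1 ≤ N) (hq : q ≠ 0) (a : ℝ) :
    expect p β h (fun _ : Fin N → Fin q => a) = a := by
  simp only [expect, ← Finset.sum_mul, sum_gibbs hN hq, one_mul]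

theorem rpow_quarter_pow_four (N : ℕ) : ((N : ℝ) ^ (1 / 4 : ℝ)) ^ 4 = N := by
  rw [← Real.rpow_natCast, ← Real.rpow_mul (Nat.cast_nonneg N)]
  norm_num

theorem one_le_rpow_quarter {N : ℕ} (hN : 1 ≤ N) : 1 ≤ (N : ℝ) ^ (1 / 4 : ℝ) :=
  Real.one_le_rpow (by exact_mod_cast hN) (by norm_num)

/-- Only finitely many `N` have `N^(1/4) < ρ₁`, and for them any bound uniform in the index
suffices. The index is a test function or a threshold, so the final constant is uniform in it. -/
theorem exists_forall_le_div {ι : Sort*} {Φ : ℕ → ι → ℝ} {ρ₁ C₀ : ℝ}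
    (hlarge : ∀ N : ℕ, 1 ≤ N → ρ₁ ≤ (N : ℝ) ^ (1 / 4 : ℝ) → ∀ i, Φ N i ≤ C₀ / (N : ℝ) ^ (1 / 4 : ℝ))
    (hsmall : ∀ N : ℕ, 1 ≤ N → ∃ C, ∀ i, Φ N i ≤ C) :
    ∃ C > 0, ∀ N : ℕ, 1 ≤ N → ∀ i, Φ N i ≤ C / (N : ℝ) ^ (1 / 4 : ℝ) := by
  have h' : ∀ N : ℕ, ∃ C, 1 ≤ N → ∀ i, Φ N i ≤ C := fun N => by
    by_cases hN : 1 ≤ N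
    · obtain ⟨C, hC⟩ := hsmall N hN
      exact ⟨C, fun _ => hC⟩
    · exact ⟨0, fun h => absurd h hN⟩
  choose c hc using h'
  obtain ⟨N₁, hN₁⟩ := exists_nat_gt (|ρ₁| ^ 4)
  set S := ∑ N ∈ Finset.range N₁, |c N| * (N : ℝ) ^ (1 / 4 : ℝ) with hS
  have hterm : ∀ N : ℕ, 0 ≤ |c N| * (N : ℝ) ^ (1 / 4 : ℝ) := fun N => by positivity
  have hS0 : 0 ≤ S := Finset.sum_nonneg fun N _ => hterm N
  refine ⟨|C₀| + S + 1, by positivity, fun N hN i => ?_⟩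
  have hr : 0 < (N : ℝ) ^ (1 / 4 : ℝ) := by linarith [one_le_rpow_quarter hN]
  by_cases hρ : ρ₁ ≤ (N : ℝ) ^ (1 / 4 : ℝ)
  · refine (hlarge N hN hρ i).trans ?_
    gcongr
    linarith [le_abs_self C₀]
  · push Not at hρ
    have hlt : N < N₁ := by
      have : (N : ℝ) ≤ |ρ₁| ^ 4 := by
        rw [← rpow_quarter_pow_four N]
        gcongr
        exact hρ.le.trans (le_abs_self _)
      exact_mod_cast this.trans_lt hN₁
    refine (hc N hN i).trans ?_
    rw [le_div_iff₀ hr]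
    have h1 := Finset.single_le_sum (fun N _ => hterm N) (Finset.mem_range.2 hlt)
    have h2 : c N * (N : ℝ) ^ (1 / 4 : ℝ) ≤ |c N| * (N : ℝ) ^ (1 / 4 : ℝ) := by
      gcongr
      exact le_abs_self _
    linarith [abs_nonneg C₀]

/-- The configuration with only the first colour has positive probability and nonzero `T_N`, since
its other counts vanish while the corresponding proportions of `x_s` are positive. -/
theorem fourthMoment_pos {p d N : ℕ} (hd : 1 ≤ d) (hN : 1 ≤ N) {β h s : ℝ} (hs : s < 1) :
    0 < fourthMoment p β h N (xs (d + 1) s) := by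
  have hr := one_le_rpow_quarter hN
  refine Finset.sum_pos' (fun x _ => mul_nonneg (gibbs_nonneg x) (by positivity))
    ⟨fun _ => 0, Finset.mem_univ _, mul_pos (gibbs_pos (by omega) _) ?_⟩
  beta_reduce
  rw [(TN_VN_eq hd hN s (by linarith) (rpow_quarter_pow_four N) _).1, latticePoint, avg_unscale hd]
  have hc : ∀ i : Fin d, counts (fun _ : Fin N => (0 : Fin (d + 1))) i.succ = 0 := fun i => by
    simp [counts, (Fin.succ_ne_zero i).symm]
  simp only [hc, Nat.cast_zero, Finset.sum_const_zero, zero_div, zero_sub]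
  have := lowProp_pos (d := d) hs
  have hne : -(((N : ℝ) ^ (1 / 4 : ℝ)) ^ 4 * lowProp d s) / ((N : ℝ) ^ (1 / 4 : ℝ)) ^ 3 ≠ 0 := by
    have : 0 < ((N : ℝ) ^ (1 / 4 : ℝ)) ^ 4 * lowProp d s := by positivity
    exact div_ne_zero (by linarith) (by positivity)
  positivity

theorem integrable_quarticLaw {a : ℝ} (ha : 0 < a) {g : ℝ → ℝ} (hg : Measurable g) {A : ℝ}
    (h : ∀ t, |g t| ≤ A * (1 + |t|)) : Integrable g (quarticLaw a) := by
  have e : quarticLaw a = (refMeasure 1 (1 / (4 * a)) 1).map avg := by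
    rw [map_avg_refMeasure le_rfl (by positivity) one_pos]
    congr 1
    field_simp
  have hA : 0 ≤ A := by
    have := (abs_nonneg _).trans (h 0)
    simpa using this
  rw [e, integrable_map_measure hg.aestronglyMeasurable continuous_avg.measurable.aemeasurable]
  refine integrable_refMeasure le_rfl (by positivity) one_pos (hg.comp continuous_avg.measurable)
    A 1 fun ζ => (h _).trans ?_
  rw [pow_one]
  gcongr
  exact abs_avg_le le_rfl ζ

theorem integral_quarticLaw_eq {d : ℕ} (hd : 1 ≤ d) {κ b : ℝ} (hκ : 0 < κ) (hb : 0 < b) {g : ℝ → ℝ}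
    (hg : Measurable g) :
    ∫ t, g t ∂(quarticLaw (1 / (4 * κ))) = ∫ ζ, g (avg ζ) ∂(refMeasure d κ b) := by
  rw [← map_avg_refMeasure hd hκ hb, integral_map continuous_avg.measurable.aemeasurable
    hg.aestronglyMeasurable]

/-- The unnormalized density is at most one, and its integral over `[0, 1]` is at least `exp (-κ)`.
The bound does not depend on `t`. -/
theorem quarticLaw_real_Icc_le {κ : ℝ} (hκ : 0 < κ) {t η : ℝ} (hη : 0 ≤ η) :
    (quarticLaw (1 / (4 * κ))).real (Set.Icc (t - η) (t + η)) ≤ 2 * η * Real.exp κ := by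
  have ha : 0 < 1 / (4 * κ) := by positivity
  have hi := integrable_exp_quartic ha
  have hpos : 0 < ∫ y : ℝ, Real.exp (-y ^ 4 / (4 * (1 / (4 * κ)))) := integral_exp_pos hi
  have hlow : Real.exp (-κ) ≤ ∫ y : ℝ, Real.exp (-y ^ 4 / (4 * (1 / (4 * κ)))) := by
    calc Real.exp (-κ) = ∫ y in Set.Icc (0 : ℝ) 1, Real.exp (-κ) := by simp
      _ ≤ ∫ y in Set.Icc (0 : ℝ) 1, Real.exp (-y ^ 4 / (4 * (1 / (4 * κ)))) := by
        refine setIntegral_mono_on (integrable_const _) hi.integrableOn measurableSet_Icc fun y hy => ?_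
        refine Real.exp_le_exp.2 ?_
        have e : -y ^ 4 / (4 * (1 / (4 * κ))) = -(κ * y ^ 4) := by field_simp
        rw [e]
        have : y ^ 4 ≤ 1 := pow_le_one₀ hy.1 hy.2
        nlinarith
      _ ≤ _ := setIntegral_le_integral hi (Filter.Eventually.of_forall fun y =>
        (Real.exp_pos _).le)
  rw [← integral_indicator_one measurableSet_Icc, quarticLaw_eq_normalized,
    integral_normalized (by fun_prop) (fun _ => (Real.exp_pos _).le) hpos, div_le_iff₀ hpos]
  calc _ ≤ ∫ y : ℝ, (Set.Icc (t - η) (t + η)).indicator 1 y := by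
        refine integral_mono_of_nonneg (Filter.Eventually.of_forall fun y => ?_) ?_
          (Filter.Eventually.of_forall fun y => ?_)
        · exact mul_nonneg (Real.exp_pos _).le (Set.indicator_nonneg (fun _ _ => zero_le_one) y)
        · exact (integrable_indicator_iff measurableSet_Icc).2 (integrable_const (1 : ℝ))
        · refine mul_le_of_le_one_left (Set.indicator_nonneg (fun _ _ => zero_le_one) y) ?_
          rw [Real.exp_le_one_iff]
          exact div_nonpos_of_nonpos_of_nonneg (by linarith [show 0 ≤ y ^ 4 by positivity])
            (by positivity)
    _ = 2 * η * (Real.exp κ * Real.exp (-κ)) := by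
        rw [integral_indicator_one measurableSet_Icc, Measure.real, Real.volume_Icc,
          ENNReal.toReal_ofReal (by linarith), ← Real.exp_add, add_neg_cancel, Real.exp_zero]
        ring
    _ ≤ _ := by
        rw [← mul_assoc]
        gcongr

theorem IsTypeISpecial.exists_longitudinal_lipschitz {p d : ℕ} (hp : 2 ≤ p) (hd : 1 ≤ d)
    {β h s : ℝ} (hβ : 0 < β) (hsp : IsTypeISpecial p (d + 1) β h s) :
    ∃ C > 0, ∀ N : ℕ, 1 ≤ N → ∀ g : {g : ℝ → ℝ // LipschitzWith 1 g},
      |(expect p β h fun x : Fin N → Fin (d + 1) => g.1 (TN (xs (d + 1) s) x)) -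
          ∫ z, g.1 z ∂(quarticLaw (fourthMoment p β h N (xs (d + 1) s)))|
        ≤ C / (N : ℝ) ^ (1 / 4 : ℝ) := by
  obtain ⟨κ, hκ, b, hb, ρ₁, hρ₁, K, hK, hcomp⟩ := hsp.exists_matched_comparison hp hd hβ
  have hlip : ∀ g : {g : ℝ → ℝ // LipschitzWith 1 g}, ∀ x y, |g.1 x - g.1 y| ≤ |x - y| :=
    fun g x y => by simpa [Real.dist_eq] using g.2.dist_le_mul x y
  -- Subtracting `g 0` leaves the difference unchanged and makes the test function bounded by `|t|`,
  -- so that the constants are uniform over all 1-Lipschitz `g`.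
  have hred : ∀ N : ℕ, 1 ≤ N → ∀ g : {g : ℝ → ℝ // LipschitzWith 1 g},
      (expect p β h fun x : Fin N → Fin (d + 1) => g.1 (TN (xs (d + 1) s) x)) -
          ∫ z, g.1 z ∂(quarticLaw (fourthMoment p β h N (xs (d + 1) s))) =
      (expect p β h fun x : Fin N → Fin (d + 1) => (g.1 (TN (xs (d + 1) s) x) - g.1 0)) -
          ∫ z, (g.1 z - g.1 0) ∂(quarticLaw (fourthMoment p β h N (xs (d + 1) s))) := by
    intro N hN g
    have ha := fourthMoment_pos (p := p) (β := β) (h := h) hd hN hsp.lt_one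
    have := isProbabilityMeasure_quarticLaw ha
    rw [expect_sub_const hN (by omega), integral_sub _ (integrable_const _), integral_const]
    · simp
    · refine integrable_quarticLaw ha g.2.continuous.measurable (A := |g.1 0| + 1) fun t => ?_
      have h1 := hlip g t 0
      have h2 := abs_sub_abs_le_abs_sub (g.1 t) (g.1 0)
      rw [sub_zero] at h1
      nlinarith [abs_nonneg (g.1 0), abs_nonneg t]
  refine exists_forall_le_div (ρ₁ := ρ₁) (C₀ := K + 3 * d) (fun N hN hρ g => ?_) fun N hN => ?_
  · set ρ := (N : ℝ) ^ (1 / 4 : ℝ) with hρdef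
    have hρN : ρ ^ 4 = N := rpow_quarter_pow_four N
    have hρ1 : 1 ≤ ρ := hρ₁.trans hρ
    obtain ⟨κ', hκ', b', hb', hfour, -, hmain⟩ := hcomp N ρ hρ hρN
    have hκ'0 : 0 < κ' := by linarith [hκ'.1]
    have hb'0 : 0 < b' := by linarith [hb'.1]
    have := isProbabilityMeasure_refMeasure hd hκ'0 hb'0
    have hgm : Measurable fun t => g.1 t - g.1 0 := g.2.continuous.measurable.sub_const _
    rw [hred N hN g, hfour, integral_quarticLaw_eq hd hκ'0 hb'0 hgm]
    simp only [fun x : Fin N → Fin (d + 1) => (TN_VN_eq hd hN s (by linarith) hρN x).1]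
    have hbound : ∀ ζ : EuclideanSpace ℝ (Fin d), |g.1 (avg ζ) - g.1 0| ≤ 1 * (1 + ‖ζ‖) ^ 4 := by
      intro ζ
      have h1 := hlip g (avg ζ) 0
      rw [sub_zero] at h1
      have h2 : (1 + ‖ζ‖) ^ 1 ≤ (1 + ‖ζ‖) ^ 4 :=
        pow_le_pow_right₀ (by linarith [norm_nonneg ζ]) (by norm_num)
      linarith [abs_avg_le hd ζ]
    refine (hmain (fun ζ => g.1 (avg ζ) - g.1 0) (fun ζ => g.1 (avg ζ) - g.1 0)
      (hgm.comp continuous_avg.measurable) (hgm.comp continuous_avg.measurable) 1 hbound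
      hbound).trans ?_
    have h1 : ∫ ζ, |(g.1 (avg (roundPt ρ (lowProp d s) ζ)) - g.1 0) - (g.1 (avg ζ) - g.1 0)|
        ∂(refMeasure d κ' b') ≤ ∫ _, 3 * d / ρ ∂(refMeasure d κ' b') := by
      refine integral_mono_of_nonneg (Filter.Eventually.of_forall fun _ => abs_nonneg _)
        (integrable_const _) (Filter.Eventually.of_forall fun ζ => ?_)
      simp only [sub_sub_sub_cancel_right]
      refine (hlip g _ _).trans ?_
      rw [abs_sub_comm, ← avg_sub]
      exact (abs_avg_le hd _).trans (norm_sub_roundPt_le_div hd hρ1 _ ζ)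
    rw [integral_const] at h1
    simp only [probReal_univ, one_smul] at h1
    rw [mul_one, add_div]
    gcongr
  · refine ⟨(expect p β h fun x : Fin N → Fin (d + 1) => |TN (xs (d + 1) s) x|) +
      ∫ z, |z| ∂(quarticLaw (fourthMoment p β h N (xs (d + 1) s))), fun g => ?_⟩
    have ha := fourthMoment_pos (p := p) (β := β) (h := h) hd hN hsp.lt_one
    have h0 : ∀ t, |g.1 t - g.1 0| ≤ |t| := fun t => by simpa using hlip g t 0
    rw [hred N hN g]
    refine (abs_sub _ _).trans (add_le_add (abs_expect_le fun x => h0 _) ?_)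
    refine norm_integral_le_of_norm_le (f := fun z => g.1 z - g.1 0) ?_
      (Filter.Eventually.of_forall h0)
    exact integrable_quarticLaw ha (by fun_prop) (A := 1) fun t => by
      rw [abs_abs]
      linarith

theorem IsTypeISpecial.exists_longitudinal_kolmogorov {p d : ℕ} (hp : 2 ≤ p) (hd : 1 ≤ d)
    {β h s : ℝ} (hβ : 0 < β) (hsp : IsTypeISpecial p (d + 1) β h s) :
    ∃ C > 0, ∀ N : ℕ, 1 ≤ N → ∀ t : ℝ,
      |prob p β h {x : Fin N → Fin (d + 1) | TN (xs (d + 1) s) x ≤ t} -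
          (quarticLaw (fourthMoment p β h N (xs (d + 1) s))).real (Set.Iic t)|
        ≤ C / (N : ℝ) ^ (1 / 4 : ℝ) := by
  obtain ⟨κ, hκ, b, hb, ρ₁, hρ₁, K, hK, hcomp⟩ := hsp.exists_matched_comparison hp hd hβ
  have hprob : ∀ N t, prob p β h {x : Fin N → Fin (d + 1) | TN (xs (d + 1) s) x ≤ t} =
      expect p β h fun x : Fin N → Fin (d + 1) =>
        (Set.Iic t).indicator (1 : ℝ → ℝ) (TN (xs (d + 1) s) x) := fun N t => rfl
  have hind : ∀ t y : ℝ, |(Set.Iic t).indicator (1 : ℝ → ℝ) y| ≤ 1 := fun t y =>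
    abs_indicator_one_le _ y
  refine exists_forall_le_div (ρ₁ := ρ₁) (C₀ := K + 2 * (3 * d) * Real.exp (2 * κ))
    (fun N hN hρ t => ?_) fun N hN => ⟨2, fun t => ?_⟩
  · set ρ := (N : ℝ) ^ (1 / 4 : ℝ) with hρdef
    have hρN : ρ ^ 4 = N := rpow_quarter_pow_four N
    have hρ1 : 1 ≤ ρ := hρ₁.trans hρ
    obtain ⟨κ', hκ', b', hb', hfour, -, hmain⟩ := hcomp N ρ hρ hρN
    have hκ'0 : 0 < κ' := by linarith [hκ'.1]
    have hb'0 : 0 < b' := by linarith [hb'.1]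
    have := isProbabilityMeasure_refMeasure hd hκ'0 hb'0
    have hgm : Measurable ((Set.Iic t).indicator (1 : ℝ → ℝ)) :=
      measurable_one.indicator measurableSet_Iic
    rw [hprob, hfour, ← integral_indicator_one measurableSet_Iic,
      integral_quarticLaw_eq hd hκ'0 hb'0 hgm]
    simp only [fun x : Fin N → Fin (d + 1) => (TN_VN_eq hd hN s (by linarith) hρN x).1]
    have hbound : ∀ ζ : EuclideanSpace ℝ (Fin d),
        |(Set.Iic t).indicator (1 : ℝ → ℝ) (avg ζ)| ≤ 1 * (1 + ‖ζ‖) ^ 4 := fun ζ => by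
      rw [one_mul]
      exact (hind t _).trans (one_le_pow₀ (by linarith [norm_nonneg ζ]))
    refine (hmain (fun ζ => (Set.Iic t).indicator (1 : ℝ → ℝ) (avg ζ))
      (fun ζ => (Set.Iic t).indicator (1 : ℝ → ℝ) (avg ζ))
      (hgm.comp continuous_avg.measurable) (hgm.comp continuous_avg.measurable) 1 hbound
      hbound).trans ?_
    set η := 3 * d / ρ with hη
    have hη0 : 0 ≤ η := by positivity
    have hIm : Measurable ((Set.Icc (t - η) (t + η)).indicator (1 : ℝ → ℝ)) :=
      measurable_one.indicator measurableSet_Icc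
    -- Rounding can carry `avg ζ` across the level `t` only if it lies within `η` of `t`, which has
    -- small probability under the quartic law.
    have h1 : ∫ ζ, |(Set.Iic t).indicator (1 : ℝ → ℝ) (avg (roundPt ρ (lowProp d s) ζ)) -
          (Set.Iic t).indicator (1 : ℝ → ℝ) (avg ζ)| ∂(refMeasure d κ' b') ≤
        ∫ ζ, (Set.Icc (t - η) (t + η)).indicator (1 : ℝ → ℝ) (avg ζ) ∂(refMeasure d κ' b') := by
      refine integral_mono_of_nonneg (Filter.Eventually.of_forall fun _ => abs_nonneg _)
        ?_ (Filter.Eventually.of_forall fun ζ => ?_)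
      · refine integrable_refMeasure hd hκ'0 hb'0 (hIm.comp continuous_avg.measurable) 1 0
          fun ζ => ?_
        rw [pow_zero, mul_one]
        exact abs_indicator_one_le _ _
      · have h2 : |avg ζ - avg (roundPt ρ (lowProp d s) ζ)| ≤ η := by
          rw [← avg_sub]
          exact (abs_avg_le hd _).trans (norm_sub_roundPt_le_div hd hρ1 _ ζ)
        obtain ⟨h3, h4⟩ := abs_le.1 h2
        simp only [Set.indicator_apply, Set.mem_Iic, Set.mem_Icc, Pi.one_apply]
        split_ifs <;> first
          | norm_num; done
          | exact absurd ⟨by linarith, by linarith⟩ ‹¬ (_ ∧ _)›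
    rw [← integral_quarticLaw_eq hd hκ'0 hb'0 hIm, integral_indicator_one measurableSet_Icc] at h1
    have h2 := h1.trans (quarticLaw_real_Icc_le hκ'0 (t := t) hη0)
    have h3 : Real.exp κ' ≤ Real.exp (2 * κ) := Real.exp_le_exp.2 hκ'.2
    calc _ ≤ K * 1 / ρ + 2 * η * Real.exp (2 * κ) := by
          refine add_le_add_right (h2.trans ?_) _
          gcongr
      _ = _ := by
          rw [hη]
          ring
  · have ha := fourthMoment_pos (p := p) (β := β) (h := h) hd hN hsp.lt_one
    have := isProbabilityMeasure_quarticLaw ha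
    have h1 : |prob p β h {x : Fin N → Fin (d + 1) | TN (xs (d + 1) s) x ≤ t}| ≤ 1 := by
      rw [hprob]
      refine (abs_expect_le fun x => hind t _).trans (le_of_eq (expect_const hN (by omega) 1))
    have h2 : |(quarticLaw (fourthMoment p β h N (xs (d + 1) s))).real (Set.Iic t)| ≤ 1 := by
      rw [abs_of_nonneg measureReal_nonneg]
      exact measureReal_le_one
    linarith [abs_sub (prob p β h {x : Fin N → Fin (d + 1) | TN (xs (d + 1) s) x ≤ t})
      ((quarticLaw (fourthMoment p β h N (xs (d + 1) s))).real (Set.Iic t))]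

/-! ### The transverse part -/

/-- Of the three bounded derivatives only the first is needed: the densities themselves are
compared, so the test function enters only through its growth and the rounding error. -/
theorem IsThriceDiffTest.exists_lipschitz {n : ℕ} {g : EuclideanSpace ℝ (Fin n) → ℝ}
    (hg : IsThriceDiffTest g) : Continuous g ∧ ∃ L ≥ 0, ∀ x y, |g x - g y| ≤ L * ‖x - y‖ := by
  obtain ⟨hdiff, L, hL⟩ := hg
  have hd : Differentiable ℝ g := by
    have h0 := hdiff 0 (by norm_num)
    rw [iteratedFDeriv_zero_eq_comp] at h0
    exact (LinearIsometryEquiv.comp_differentiable_iff _).1 h0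
  have hL' : ∀ x, ‖fderiv ℝ g x‖ ≤ L := fun x => by
    rw [← norm_iteratedFDeriv_one]
    exact hL 1 (by simp) x
  refine ⟨hd.continuous, L, (norm_nonneg _).trans (hL' 0), fun x y => ?_⟩
  exact Convex.norm_image_sub_le_of_norm_fderiv_le (fun z _ => hd z) (fun z _ => hL' z)
    convex_univ (Set.mem_univ y) (Set.mem_univ x)

theorem integral_multivariateGaussian_eq {d : ℕ} (hd : 1 ≤ d) {κ b : ℝ} (hκ : 0 < κ) (hb : 0 < b)
    {g : EuclideanSpace ℝ (Fin (d + 1)) → ℝ} (hg : Measurable g) :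
    ∫ x, g x ∂(multivariateGaussian 0 (b⁻¹ • transverseProj d)) =
      ∫ ζ, g (transverse ζ) ∂(refMeasure d κ b) := by
  rw [← map_transverse_refMeasure hd hκ hb,
    integral_map continuous_transverse.measurable.aemeasurable hg.aestronglyMeasurable]

theorem norm_transverse_sub_le {d : ℕ} (hd : 1 ≤ d) (ζ ζ' : EuclideanSpace ℝ (Fin d)) :
    ‖transverse ζ - transverse ζ'‖ ≤ ‖ζ - ζ'‖ := by
  rw [transverse_sub, norm_transverse]
  exact norm_dev_le hd _

theorem IsTypeISpecial.exists_transverse_smooth {p d : ℕ} (hp : 2 ≤ p) (hd : 1 ≤ d)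
    {β h s : ℝ} (hβ : 0 < β) (hsp : IsTypeISpecial p (d + 1) β h s)
    {g : EuclideanSpace ℝ (Fin (d + 1)) → ℝ} (hg : Continuous g) {L : ℝ} (hL : 0 ≤ L)
    (hgL : ∀ x y, |g x - g y| ≤ L * ‖x - y‖) :
    ∃ C > 0, ∀ N : ℕ, 1 ≤ N →
      Integrable g (multivariateGaussian 0 (covMatrix p β h N (xs (d + 1) s))) ∧
      |(expect p β h fun x : Fin N → Fin (d + 1) => g (VN (xs (d + 1) s) x)) -
          ∫ z, g z ∂(multivariateGaussian 0 (covMatrix p β h N (xs (d + 1) s)))|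
        ≤ C / (N : ℝ) ^ (1 / 4 : ℝ) := by
  obtain ⟨κ, hκ, b, hb, ρ₁, hρ₁, K, hK, hcomp⟩ := hsp.exists_matched_comparison hp hd hβ
  have hint : ∀ S : Matrix (Fin (d + 1)) (Fin (d + 1)) ℝ,
      Integrable g (multivariateGaussian 0 S) := fun S => by
    refine ((integrable_const |g 0|).add ((IsGaussian.integrable_id
      (μ := multivariateGaussian 0 S)).norm.const_mul L)).mono' hg.aestronglyMeasurable
      (Filter.Eventually.of_forall fun x => ?_)
    have h1 := hgL x 0
    rw [sub_zero] at h1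
    have h2 := abs_sub_abs_le_abs_sub (g x) (g 0)
    simp only [Real.norm_eq_abs, Pi.add_apply, id]
    linarith
  -- The function `g` is fixed and the index trivial, so for small `N` the left-hand side serves as
  -- its own bound.
  obtain ⟨C, hC, hmain⟩ : ∃ C > 0, ∀ N : ℕ, 1 ≤ N → ∀ _ : Unit,
      |(expect p β h fun x : Fin N → Fin (d + 1) => g (VN (xs (d + 1) s) x)) -
          ∫ z, g z ∂(multivariateGaussian 0 (covMatrix p β h N (xs (d + 1) s)))|
        ≤ C / (N : ℝ) ^ (1 / 4 : ℝ) := by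
    refine exists_forall_le_div (ρ₁ := ρ₁) (C₀ := K * L + L * (3 * d)) (fun N hN hρ _ => ?_)
      fun N hN => ⟨_, fun _ => le_rfl⟩
    set ρ := (N : ℝ) ^ (1 / 4 : ℝ) with hρdef
    have hρN : ρ ^ 4 = N := rpow_quarter_pow_four N
    have hρ1 : 1 ≤ ρ := hρ₁.trans hρ
    obtain ⟨κ', hκ', b', hb', -, hcov, hmain⟩ := hcomp N ρ hρ hρN
    have hκ'0 : 0 < κ' := by linarith [hκ'.1]
    have hb'0 : 0 < b' := by linarith [hb'.1]
    have := isProbabilityMeasure_refMeasure hd hκ'0 hb'0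
    have hred : (expect p β h fun x : Fin N → Fin (d + 1) => g (VN (xs (d + 1) s) x)) -
          ∫ z, g z ∂(multivariateGaussian 0 (covMatrix p β h N (xs (d + 1) s))) =
        (expect p β h fun x : Fin N → Fin (d + 1) => (g (VN (xs (d + 1) s) x) - g 0)) -
          ∫ z, (g z - g 0) ∂(multivariateGaussian 0 (covMatrix p β h N (xs (d + 1) s))) := by
      rw [expect_sub_const hN (by omega), integral_sub (hint _) (integrable_const _),
        integral_const]
      simp
    have hgm : Measurable fun x => g x - g 0 := hg.measurable.sub_const _
    rw [hred, hcov, integral_multivariateGaussian_eq hd hκ'0 hb'0 hgm]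
    simp only [fun x : Fin N → Fin (d + 1) => (TN_VN_eq hd hN s (by linarith) hρN x).2]
    have hbound : ∀ ζ : EuclideanSpace ℝ (Fin d), |g (transverse ζ) - g 0| ≤ L * (1 + ‖ζ‖) ^ 4 := by
      intro ζ
      refine (hgL _ _).trans ?_
      rw [sub_zero, norm_transverse]
      gcongr
      have h2 : (1 + ‖ζ‖) ^ 1 ≤ (1 + ‖ζ‖) ^ 4 :=
        pow_le_pow_right₀ (by linarith [norm_nonneg ζ]) (by norm_num)
      linarith [norm_dev_le hd ζ]
    have hGm : Measurable fun ζ : EuclideanSpace ℝ (Fin d) => g (transverse ζ) - g 0 :=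
      hgm.comp continuous_transverse.measurable
    refine (hmain _ _ hGm hGm L hbound hbound).trans ?_
    have h1 : ∫ ζ, |(g (transverse (roundPt ρ (lowProp d s) ζ)) - g 0) - (g (transverse ζ) - g 0)|
        ∂(refMeasure d κ' b') ≤ ∫ _, L * (3 * d / ρ) ∂(refMeasure d κ' b') := by
      refine integral_mono_of_nonneg (Filter.Eventually.of_forall fun _ => abs_nonneg _)
        (integrable_const _) (Filter.Eventually.of_forall fun ζ => ?_)
      simp only [sub_sub_sub_cancel_right]
      refine (hgL _ _).trans (mul_le_mul_of_nonneg_left ?_ hL)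
      rw [norm_sub_rev]
      exact (norm_transverse_sub_le hd _ _).trans (norm_sub_roundPt_le_div hd hρ1 _ ζ)
    rw [integral_const] at h1
    simp only [probReal_univ, one_smul] at h1
    rw [add_div, ← mul_div_assoc] at *
    gcongr
  exact ⟨C, hC, fun N hN => ⟨hint _, hmain N hN ()⟩⟩

/-! ### Oscillation of a bounded function over balls. -/

section envelopes

variable {n : ℕ} {g : EuclideanSpace ℝ (Fin n) → ℝ} {M δ : ℝ}

theorem le_upperEnv (hM : ∀ x, |g x| ≤ M) (x : EuclideanSpace ℝ (Fin n))
    {y : EuclideanSpace ℝ (Fin n)} (hy : ‖y‖ ≤ δ) : g (x + y) ≤ upperEnv g δ x := by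
  refine le_csSup ⟨M, ?_⟩ ⟨y, hy, rfl⟩
  rintro _ ⟨z, -, rfl⟩
  exact (abs_le.1 (hM _)).2

theorem lowerEnv_le (hM : ∀ x, |g x| ≤ M) (x : EuclideanSpace ℝ (Fin n))
    {y : EuclideanSpace ℝ (Fin n)} (hy : ‖y‖ ≤ δ) : lowerEnv g δ x ≤ g (x + y) := by
  refine csInf_le ⟨-M, ?_⟩ ⟨y, hy, rfl⟩
  rintro _ ⟨z, -, rfl⟩
  exact (abs_le.1 (hM _)).1

theorem abs_sub_le_upperEnv_sub_lowerEnv (hM : ∀ x, |g x| ≤ M) (hδ : 0 ≤ δ)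
    {x x' : EuclideanSpace ℝ (Fin n)} (h : ‖x' - x‖ ≤ δ) :
    |g x' - g x| ≤ upperEnv g δ x - lowerEnv g δ x := by
  have h1 := le_upperEnv hM x h
  have h2 := lowerEnv_le hM x h
  have h3 := le_upperEnv hM x (y := 0) (by simpa using hδ)
  have h4 := lowerEnv_le hM x (y := 0) (by simpa using hδ)
  rw [add_sub_cancel] at h1 h2
  rw [add_zero] at h3 h4
  rw [abs_le]
  constructor <;> linarith

end envelopes

theorem tailVec_transverse {d : ℕ} (ζ : EuclideanSpace ℝ (Fin d)) :
    tailVec (transverse ζ) = dev ζ := rfl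

theorem transverse_dev {d : ℕ} (hd : 1 ≤ d) (ζ : EuclideanSpace ℝ (Fin d)) :
    transverse (dev ζ) = transverse ζ := by
  rw [transverse, dev_dev hd, transverse]

/-- The mean oscillation of a test function on a ball is controlled by the smoothness of the
class. -/
theorem IsTestClass.integral_abs_sub_le {d : ℕ} (hd : 1 ≤ d)
    {𝒢 : Set (EuclideanSpace ℝ (Fin (d + 1)) → ℝ)} {M c : ℝ} (h𝒢 : IsTestClass 𝒢 M c)
    {g : EuclideanSpace ℝ (Fin (d + 1)) → ℝ} (hg : g ∈ 𝒢) {κ b : ℝ} (hκ : 0 < κ) (hb : 0 < b)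
    {η : ℝ} (hη : 0 < η) (r : EuclideanSpace ℝ (Fin d) → EuclideanSpace ℝ (Fin d))
    (hr : ∀ ζ, ‖ζ - r ζ‖ ≤ η) :
    ∫ ζ, |g (transverse (r ζ)) - g (transverse ζ)| ∂(refMeasure d κ b) ≤ c * (√b * η) := by
  have := isProbabilityMeasure_refMeasure hd hκ hb
  have hsb : 0 < √b := Real.sqrt_pos.2 hb
  -- The oscillation condition concerns the standard Gaussian on the full space, whereas the
  -- transverse law is degenerate. It is applied to `g' = g ∘ T`, where `T` is `(√b)⁻¹` times the
  -- projection and maps the standard Gaussian to the transverse law; the radius is rescaled by `√b`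
  -- accordingly.
  set δ := √b * η with hδ
  have hδ0 : 0 < δ := by positivity
  set σ := (√b)⁻¹ with hσ
  have hσb : σ ^ 2 = b⁻¹ := by rw [hσ, inv_pow, Real.sq_sqrt hb.le]
  set T := Matrix.toEuclideanCLM (𝕜 := ℝ) (σ • transverseProj d) with hT
  have hTapp : ∀ x, T x = σ • transverse (tailVec x) := fun x => by
    rw [hT, map_smul, _root_.smul_apply, toEuclideanCLM_transverseProj]
  set g' : EuclideanSpace ℝ (Fin (d + 1)) → ℝ := fun x => g (T x) with hg'
  have hmem : g' ∈ 𝒢 := by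
    have := h𝒢.affine g hg (σ • transverseProj d) 0
    simpa only [add_zero] using this
  have hM := h𝒢.bounded g' hmem
  set O : EuclideanSpace ℝ (Fin (d + 1)) → ℝ := fun x => upperEnv g' δ x - lowerEnv g' δ x with hO
  have hOm : Measurable O := (h𝒢.measurable _ (h𝒢.upper_mem _ hmem δ hδ0)).sub
    (h𝒢.measurable _ (h𝒢.lower_mem _ hmem δ hδ0))
  have hOb : ∀ x, |O x| ≤ 2 * M := fun x => by
    have h1 := h𝒢.bounded _ (h𝒢.upper_mem _ hmem δ hδ0) x
    have h2 := h𝒢.bounded _ (h𝒢.lower_mem _ hmem δ hδ0) x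
    linarith [abs_sub (upperEnv g' δ x) (lowerEnv g' δ x)]
  -- Since `√b • T` is the projection and `g'` does not change along its kernel, the oscillation of
  -- `g'` at `√b • T z` equals the one at `z`; this removes the degeneracy.
  have hTT : ∀ z, transverse (tailVec (√b • T z)) = transverse (tailVec z) := fun z => by
    rw [hTapp, smul_smul, hσ, mul_inv_cancel₀ hsb.ne', one_smul, tailVec_transverse,
      transverse_dev hd]
  have hOT : ∀ z, O (√b • T z) = O z := fun z => by
    have e : ∀ y, g' (√b • T z + y) = g' (z + y) := fun y => by
      simp only [hg', map_add]
      rw [hTapp (√b • T z), hTT, ← hTapp z]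
    simp only [hO, upperEnv, lowerEnv, e]
  have hgg' : ∀ ζ, g' (√b • transverse ζ) = g (transverse ζ) := fun ζ => by
    have e : T (√b • transverse ζ) = transverse ζ := by
      rw [map_smul, hTapp, smul_smul, hσ, mul_inv_cancel₀ hsb.ne', one_smul, tailVec_transverse,
        transverse_dev hd]
    simp only [hg', e]
  have hOm' : Measurable fun x => O (√b • x) := hOm.comp (measurable_const_smul _)
  calc ∫ ζ, |g (transverse (r ζ)) - g (transverse ζ)| ∂(refMeasure d κ b)
      ≤ ∫ ζ, O (√b • transverse ζ) ∂(refMeasure d κ b) := by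
        refine integral_mono_of_nonneg (Filter.Eventually.of_forall fun _ => abs_nonneg _)
          (integrable_refMeasure hd hκ hb (hOm'.comp continuous_transverse.measurable)
            (2 * M) 0 fun ζ => ?_) (Filter.Eventually.of_forall fun ζ => ?_)
        · rw [pow_zero, mul_one]
          exact hOb _
        · simp only
          rw [← hgg' ζ, ← hgg' (r ζ)]
          refine abs_sub_le_upperEnv_sub_lowerEnv hM hδ0.le ?_
          rw [← smul_sub, norm_smul, Real.norm_of_nonneg hsb.le, norm_sub_rev]
          exact mul_le_mul_of_nonneg_left ((norm_transverse_sub_le hd _ _).trans (hr ζ)) hsb.le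
    _ = ∫ x, O (√b • x) ∂(multivariateGaussian 0 (b⁻¹ • transverseProj d)) :=
        (integral_multivariateGaussian_eq hd hκ hb hOm').symm
    _ = ∫ z, O (√b • T z) ∂(stdGaussian (EuclideanSpace ℝ (Fin (d + 1)))) := by
        rw [← hσb, ← map_stdGaussian_transverse hd σ,
          integral_map (by fun_prop) hOm'.aestronglyMeasurable]
    _ = ∫ z, O z ∂(stdGaussian (EuclideanSpace ℝ (Fin (d + 1)))) := by simp only [hOT]
    _ ≤ c * δ := h𝒢.oscillation g' hmem δ hδ0

/-- The index runs over pairs of a class and a member, which makes the constant depend on the class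
only through `M` and `c`. No smoothing of the test function is needed, hence no logarithm appears.
-/
theorem IsTypeISpecial.exists_transverse_class {p d : ℕ} (hp : 2 ≤ p) (hd : 1 ≤ d)
    {β h s : ℝ} (hβ : 0 < β) (hsp : IsTypeISpecial p (d + 1) β h s) (M c : ℝ) :
    ∃ C > 0, ∀ N : ℕ, 1 ≤ N →
      ∀ a : {a : Set (EuclideanSpace ℝ (Fin (d + 1)) → ℝ) × (EuclideanSpace ℝ (Fin (d + 1)) → ℝ) //
        IsTestClass a.1 M c ∧ a.2 ∈ a.1},
      |(expect p β h fun x : Fin N → Fin (d + 1) => a.1.2 (VN (xs (d + 1) s) x)) -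
          ∫ z, a.1.2 z ∂(multivariateGaussian 0 (covMatrix p β h N (xs (d + 1) s)))|
        ≤ C / (N : ℝ) ^ (1 / 4 : ℝ) := by
  obtain ⟨κ, hκ, b, hb, ρ₁, hρ₁, K, hK, hcomp⟩ := hsp.exists_matched_comparison hp hd hβ
  refine exists_forall_le_div (ρ₁ := ρ₁) (C₀ := K * M + |c| * (√(2 * b) * (3 * d)))
    (fun N hN hρ => ?_) fun N hN => ⟨2 * M, ?_⟩
  · rintro ⟨⟨𝒢, g⟩, h𝒢, hg⟩
    simp only at h𝒢 hg ⊢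
    set ρ := (N : ℝ) ^ (1 / 4 : ℝ) with hρdef
    have hρN : ρ ^ 4 = N := rpow_quarter_pow_four N
    have hρ1 : 1 ≤ ρ := hρ₁.trans hρ
    obtain ⟨κ', hκ', b', hb', -, hcov, hmain⟩ := hcomp N ρ hρ hρN
    have hκ'0 : 0 < κ' := by linarith [hκ'.1]
    have hb'0 : 0 < b' := by linarith [hb'.1]
    have hM : 0 ≤ M := (abs_nonneg _).trans (h𝒢.bounded g hg 0)
    have hd0 : (0 : ℝ) < d := by exact_mod_cast hd
    rw [hcov, integral_multivariateGaussian_eq hd hκ'0 hb'0 (h𝒢.measurable g hg)]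
    simp only [fun x : Fin N → Fin (d + 1) => (TN_VN_eq hd hN s (by linarith) hρN x).2]
    have hGm : Measurable fun ζ : EuclideanSpace ℝ (Fin d) => g (transverse ζ) :=
      (h𝒢.measurable g hg).comp continuous_transverse.measurable
    have hbound : ∀ ζ : EuclideanSpace ℝ (Fin d), |g (transverse ζ)| ≤ M * (1 + ‖ζ‖) ^ 4 :=
      fun ζ => (h𝒢.bounded g hg _).trans
        (le_mul_of_one_le_right hM (one_le_pow₀ (by linarith [norm_nonneg ζ])))
    refine (hmain _ _ hGm hGm M hbound hbound).trans ?_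
    have h1 := h𝒢.integral_abs_sub_le hd hg hκ'0 hb'0 (η := 3 * d / ρ) (by positivity)
      (roundPt ρ (lowProp d s)) (norm_sub_roundPt_le_div hd hρ1 _)
    have h2 : c * (√b' * (3 * d / ρ)) ≤ |c| * (√(2 * b) * (3 * d / ρ)) := by
      refine mul_le_mul (le_abs_self c) ?_ (by positivity) (abs_nonneg c)
      gcongr
      exact hb'.2
    calc _ ≤ K * M / ρ + |c| * (√(2 * b) * (3 * d / ρ)) := add_le_add_right (h1.trans h2) _
      _ = _ := by ring
  · rintro ⟨⟨𝒢, g⟩, h𝒢, hg⟩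
    simp only at h𝒢 hg ⊢
    have h1 := (abs_expect_le (p := p) (β := β) (h := h)
      fun x : Fin N → Fin (d + 1) => h𝒢.bounded g hg (VN (xs (d + 1) s) x)).trans_eq
      (expect_const hN (by omega) M)
    have h2 : |∫ z, g z ∂(multivariateGaussian 0 (covMatrix p β h N (xs (d + 1) s)))| ≤ M := by
      have := norm_integral_le_of_norm_le (f := g) (integrable_const M
        (μ := multivariateGaussian 0 (covMatrix p β h N (xs (d + 1) s))))
        (Filter.Eventually.of_forall (h𝒢.bounded g hg))
      simpa using this
    exact (abs_sub _ _).trans (by linarith)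

end CWPotts

end

open CWPotts
/-- At a type-I special point `(β, h)` with maximizer `m_* = x_s`. The constants `C` of the first
part and `D` do not depend on `N`, `g`, `t`; `D` depends on the class `𝒢` only through its uniform
bound `M` and its constant `c`. The measure `multivariateGaussian 0 Σ` is the law of `Σ^(1/2) Z`
with `Z` standard normal in `ℝ^q`. -/
theorem theorem3p3 (p q : ℕ) (hp : 2 ≤ p) (hq : 2 ≤ q) (β h s : ℝ) (hβ : 0 < β) (hh : 0 ≤ h)
    (hspecial : IsTypeISpecial p q β h s) :
    (∃ C > 0, ∀ N : ℕ, 1 ≤ N →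
      0 < fourthMoment p β h N (xs q s) ∧
      (∀ g : ℝ → ℝ, LipschitzWith 1 g →
        Integrable g (quarticLaw (fourthMoment p β h N (xs q s))) ∧
        |(expect p β h fun x : Fin N → Fin q => g (TN (xs q s) x)) -
            ∫ z, g z ∂(quarticLaw (fourthMoment p β h N (xs q s)))|
          ≤ C / (N : ℝ) ^ (1 / 4 : ℝ)) ∧
      (∀ t : ℝ,
        |prob p β h {x : Fin N → Fin q | TN (xs q s) x ≤ t} -
            (quarticLaw (fourthMoment p β h N (xs q s))).real (Set.Iic t)|
          ≤ C / (N : ℝ) ^ (1 / 4 : ℝ))) ∧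
    (∀ g : EuclideanSpace ℝ (Fin q) → ℝ, IsThriceDiffTest g → ∃ C > 0, ∀ N : ℕ, 1 ≤ N →
      Integrable g (multivariateGaussian 0 (covMatrix p β h N (xs q s))) ∧
      |(expect p β h fun x : Fin N → Fin q => g (VN (xs q s) x)) -
          ∫ z, g z ∂(multivariateGaussian 0 (covMatrix p β h N (xs q s)))|
        ≤ C / (N : ℝ) ^ (1 / 4 : ℝ)) ∧
    (∀ M c : ℝ, ∃ D > 0, ∀ 𝒢 : Set (EuclideanSpace ℝ (Fin q) → ℝ), IsTestClass 𝒢 M c →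
      ∀ N : ℕ, 2 ≤ N → ∀ g ∈ 𝒢,
      |(expect p β h fun x : Fin N → Fin q => g (VN (xs q s) x)) -
          ∫ z, g z ∂(multivariateGaussian 0 (covMatrix p β h N (xs q s)))|
        ≤ D * Real.log N / (N : ℝ) ^ (1 / 4 : ℝ)) := by
  obtain ⟨d, hd, rfl⟩ : ∃ d, 1 ≤ d ∧ q = d + 1 := ⟨q - 1, by omega, by omega⟩
  refine ⟨?_, fun g hg => ?_, fun M c => ?_⟩
  · obtain ⟨C₁, hC₁, h₁⟩ := hspecial.exists_longitudinal_lipschitz hp hd hβ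
    obtain ⟨C₂, hC₂, h₂⟩ := hspecial.exists_longitudinal_kolmogorov hp hd hβ
    refine ⟨C₁ + C₂, by positivity, fun N hN => ?_⟩
    have ha := fourthMoment_pos (p := p) (β := β) (h := h) hd hN hspecial.lt_one
    refine ⟨ha, fun g hg => ⟨?_, (h₁ N hN ⟨g, hg⟩).trans ?_⟩, fun t => (h₂ N hN t).trans ?_⟩
    · refine integrable_quarticLaw ha hg.continuous.measurable (A := |g 0| + 1) fun t => ?_
      have h1 := hg.dist_le_mul t 0
      have h2 := abs_sub_abs_le_abs_sub (g t) (g 0)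
      rw [Real.dist_eq, Real.dist_eq, sub_zero, NNReal.coe_one, one_mul] at h1
      nlinarith [abs_nonneg (g 0), abs_nonneg t]
    · gcongr
      linarith
    · gcongr
      linarith
  · obtain ⟨hcont, L, hL, hgL⟩ := hg.exists_lipschitz
    exact hspecial.exists_transverse_smooth hp hd hβ hcont hL hgL
  · obtain ⟨C, hC, h₁⟩ := hspecial.exists_transverse_class hp hd hβ M c
    -- The stronger bound without logarithm is weakened: `log N / log 2 ≥ 1` for `N ≥ 2`.
    have hlog2 : 0 < Real.log 2 := Real.log_pos one_lt_two
    refine ⟨C / Real.log 2, by positivity, fun 𝒢 h𝒢 N hN g hg => ?_⟩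
    refine (h₁ N (by omega) ⟨⟨𝒢, g⟩, h𝒢, hg⟩).trans ?_
    have h2 : Real.log 2 ≤ Real.log N := Real.log_le_log two_pos (by exact_mod_cast hN)
    gcongr
    rw [div_mul_eq_mul_div, le_div_iff₀ hlog2]
    gcongr
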